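/- **Theorem (Thermodynamic limit with no external field).** Let $0\le\alpha<4/\pi$, $\Lambda>0$, $m_0>0$, let $B=B(0,\Lambda)$ be the open ball in $\mathbb R^3$, and let $D^0(p)=\boldsymbol\alpha\cdot p+m_0\beta$ with the standard $4\times4$ Dirac matrices. *Setting on the torus.* For $L>0$ let $\mathbb T_L=\mathbb R^3/L\mathbb Z^3$, with fundamental cell $[-L/2,L/2)^3$, $\Gamma^L_\Lambda=\frac{2\pi}{L}\mathbb Z^3\cap B$, $e_k(x)=L^{-3/2}e^{ik\cdot x}$, and let $\mathfrak H^L_\Lambda\subset L^2(\mathbb T_L,\mathbb C^4)$ be spanned by the functions $e_k\varepsilon_\sigma$ ($k\in\Gamma^L_\Lambda$, $(\varepsilon_\sigma)_{1\le\sigma\le4}$ the canonical basis of $\mathbb C^4$). An operator $\gamma$ on $\mathfrak H^L_\Lambda$ has the $4\times 4$ matrix-valued kernel $\gamma(x,y)=\sum_{k,l\in\Gamma^L_\Lambda}\widehat\gamma(k,l)e_k(x)\overline{e_l(y)}$, where $\widehat\gamma(k,l)_{\sigma,\tau}=\langle e_k\varepsilon_\sigma,\gamma\, e_l\varepsilon_\tau\rangle$,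 and density $\rho_\gamma(x)=\operatorname{tr}_{\mathbb C^4}\gamma(x,x)$. For $g:\Gamma^L_\Lambda\to\mathbb C^{4\times4}$, $g(-i\nabla)$ denotes the operator with $\widehat{g(-i\nabla)}(k,l)=g(k)\delta_{kl}$. Let $W_L$ be the $L\mathbb Z^3$-periodic solution of $-\Delta W_L=4\pi\big(\sum_{x\in L\mathbb Z^3}\delta_x-L^{-3}\big)$ that is normalized by $\min W_L=0$. Let $\mathcal G^L_\Lambda$ be the set of self-adjoint operators $\gamma$ on $\mathfrak H^L_\Lambda$ with $-\frac12I\le\gamma\le\frac12I$ and, for $\gamma\in\mathcal G^L_\Lambda$, $$\mathcal E^0_L(\gamma)=\operatorname{tr}(D^0(-i\nabla)\gamma)+\frac\alpha2\iint_{\mathbb T_L^2}\rho_\gamma(x)\rho_\gamma(y)W_L(x-y)\,dx\,dy-\frac\alpha2\iint_{\mathbb T_L^2}|\gamma(x,y)|^2W_L(x-y)\,dx\,dy,$$ where $|A|^2=\operatorname{tr}(A^*A)$. Put $E_L(0)=\inf_{\mathcal G^L_\Lambda}\mathcal E^0_L$. *Setting in the whole space.* Let $\mathcal A_\Lambda$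 be the set of measurable $f$ on $B$ with values in the self-adjoint $4\times4$ matrices such that $-\frac12\le f\le\frac12$ a.e., let $$\mathcal T(f)=\frac1{(2\pi)^3}\int_B\operatorname{tr}[D^0(p)f(p)]\,dp-\frac{\alpha}{(2\pi)^5}\iint_{B^2}\frac{\operatorname{tr}[f(p)f(q)]}{|p-q|^2}\,dp\,dq,$$ and $E^{\mathcal T}=\inf_{\mathcal A_\Lambda}\mathcal T$. *Conclusion.* The infimum $E^{\mathcal T}$ is attained, and $\mathcal T$ has on $\mathcal A_\Lambda$ a unique (up to a.e. equality) minimizer, which has a representative $\bar f$ that is continuous on $B$; for every $p\in B$ the matrix $\mathcal P^0_-(p):=\bar f(p)+\frac12$ is an orthogonal projector. For all sufficiently large $L$, $\mathcal E^0_L$ has a unique minimizer $\gamma^0_L$ on $\mathcal G^L_\Lambda$; it has the form $\gamma_L^0=\mathcal P^0_L-\frac12I$ with an orthogonal projector $\mathcal P^0_L$, and it is translation-invariant: $\gamma^0_L=f^0_L(-i\nabla)$ for some $f^0_L:\Gamma^L_\Lambda\to\mathbb C^{4\times4}$, equivalently $\gamma^0_L(x,y)=(2\pi)^{-3/2}\check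 f^0_L(x-y)$ with $\check f(x)=(2\pi/L)^{3/2}\sum_{k\in\Gamma^L_\Lambda}f(k)e_k(x)$. Moreover, as $L\to\infty$ through the reals, $$\lim_{L\to\infty}\frac{E_L(0)}{L^3}=E^{\mathcal T}=\min_{\mathcal A_\Lambda}\mathcal T ,$$ $$\lim_{L\to\infty}\|\gamma^0_L-\bar f(-i\nabla)\|=\lim_{L\to\infty}\sup_{k\in\Gamma^L_\Lambda}|f^0_L(k)-\bar f(k)|=0,$$ $$\lim_{L\to\infty}\|\mathcal P^0_L-\mathcal P^0_-(-i\nabla)\|=\lim_{L\to\infty}\sup_{k\in\Gamma^L_\Lambda}|\mathcal P^0_L(k)-\mathcal P^0_-(k)|=0,$$ where $\|\cdot\|$ is the operator norm on $\mathfrak H^L_\Lambda$, $|\cdot|$ is the operator norm of $4\times4$ matrices, and $\mathcal P^0_L(k)=f^0_L(k)+\frac12$. -/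

import Mathlib

open Filter Topology MeasureTheory
open scoped ContDiff ComplexOrder

noncomputable section

namespace HFVacuum

/-- Physical space, and also momentum space. -/
abbrev E3 : Type := EuclideanSpace ℝ (Fin 3)

/-- Complex `4 × 4` matrices, acting on spinors. -/
abbrev M4 : Type := Matrix (Fin 4) (Fin 4) ℂ

/-! ### Dirac matrices and the free Dirac symbol -/

/-- The Dirac matrix `α₁`. -/
def diracA1 : M4 := !![0, 0, 0, 1; 0, 0, 1, 0; 0, 1, 0, 0; 1, 0, 0, 0]

/-- The Dirac matrix `α₂`. -/
def diracA2 : M4 :=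
  !![0, 0, 0, -Complex.I; 0, 0, Complex.I, 0; 0, -Complex.I, 0, 0; Complex.I, 0, 0, 0]

/-- The Dirac matrix `α₃`. -/
def diracA3 : M4 := !![0, 0, 1, 0; 0, 0, 0, -1; 1, 0, 0, 0; 0, -1, 0, 0]

/-- The Dirac matrix `β`. -/
def diracB : M4 := !![1, 0, 0, 0; 0, 1, 0, 0; 0, 0, -1, 0; 0, 0, 0, -1]

/-- The Fourier symbol `D⁰(p) = α · p + m₀ β` of the free Dirac operator. -/
def D0 (m₀ : ℝ) (p : E3) : M4 :=
  (p 0 : ℂ) • diracA1 + (p 1 : ℂ) • diracA2 + (p 2 : ℂ) • diracA3 + (m₀ : ℂ) • diracB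

/-! ### The torus of side `L` with ultraviolet cut-off `Λ` -/

/-- The point `c n` of the rescaled lattice `c ℤ³`. -/
def latticePoint (c : ℝ) (n : Fin 3 → ℤ) : E3 := WithLp.toLp 2 fun i => c * (n i : ℝ)

/-- The momenta `k ∈ (2π/L) ℤ³` in the ball `B(0,Λ)`. -/
def momenta (L Λ : ℝ) : Set E3 :=
  Set.range (latticePoint (2 * Real.pi / L)) ∩ Metric.ball 0 Λ

theorem finite_momenta (L Λ : ℝ) : (momenta L Λ).Finite := by
  by_cases hL : L = 0
  · refine (Set.finite_singleton (0 : E3)).subset ?_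
    rintro _ ⟨⟨n, rfl⟩, -⟩
    simp only [Set.mem_singleton_iff]
    ext i
    simp [latticePoint, hL]
  · have hc : 0 < |2 * Real.pi / L| := abs_pos.mpr (div_ne_zero (by positivity) hL)
    have hfin : (Set.univ.pi fun _ : Fin 3 =>
        Set.Icc (-⌈Λ / |2 * Real.pi / L|⌉) ⌈Λ / |2 * Real.pi / L|⌉).Finite :=
      Set.Finite.pi fun _ => Set.finite_Icc _ _
    refine (hfin.image (latticePoint (2 * Real.pi / L))).subset ?_
    rintro _ ⟨⟨n, rfl⟩, hn⟩
    refine ⟨n, fun i _ => ?_, rfl⟩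
    have h1 : ‖latticePoint (2 * Real.pi / L) n‖ < Λ := by simpa using hn
    have h2 : |2 * Real.pi / L| * |(n i : ℝ)| < Λ := by
      have h3 := PiLp.norm_apply_le (latticePoint (2 * Real.pi / L) n) i
      simp only [latticePoint, Real.norm_eq_abs, abs_mul] at h3
      exact h3.trans_lt h1
    have h4 : |(n i : ℝ)| ≤ (⌈Λ / |2 * Real.pi / L|⌉ : ℝ) := by
      refine le_trans ?_ (Int.le_ceil _)
      rw [le_div_iff₀ hc, mul_comm]
      exact h2.le
    have h5 := abs_le.mp h4
    exact ⟨by exact_mod_cast h5.1, by exact_mod_cast h5.2⟩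

instance instFiniteMomenta (L Λ : ℝ) : Finite (momenta L Λ) := (finite_momenta L Λ).to_subtype

instance instFintypeMomenta (L Λ : ℝ) : Fintype (momenta L Λ) := Fintype.ofFinite _

instance instDecidableEqMomenta (L Λ : ℝ) : DecidableEq (momenta L Λ) := Classical.decEq _

/-- Linear operators `γ` on the finite-dimensional space `𝔥 = span {e_k ε_σ}`, `k ∈ momenta L Λ`,
`σ = 1, …, 4`, where `e_k(x) = L^{-3/2} exp(i k·x)`. Such an operator is given by its matrix in the
orthonormal basis `(e_k ε_σ)` of `𝔥 ⊂ L²(torus, ℂ⁴)`: the entry of index `((σ', k), (σ, l))` is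
`⟨e_k ε_σ', γ e_l ε_σ⟩`. -/
abbrev TorusOp (L Λ : ℝ) : Type :=
  Matrix (Fin 4 × momenta L Λ) (Fin 4 × momenta L Λ) ℂ

/-- The multiplication operator `f(-i∇)` in Fourier space. -/
def fourierMultiplier {L Λ : ℝ} (f : momenta L Λ → M4) : TorusOp L Λ := Matrix.blockDiagonal f

/-- The normalized plane wave `e_k(x) = L^{-3/2} exp(i k·x)`. -/
def planeWave (L : ℝ) (k x : E3) : ℂ :=
  Complex.exp (Complex.I * (inner ℝ k x : ℝ)) / ((L ^ (3 / 2 : ℝ) : ℝ) : ℂ)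

/-- The integral kernel `γ(x,y) = ∑_{k,l} γ̂(k,l) e_k(x) conj(e_l(y))`, a `4 × 4` matrix. -/
def kernel {L Λ : ℝ} (γ : TorusOp L Λ) (x y : E3) : M4 :=
  Matrix.of fun σ τ => ∑ k : momenta L Λ, ∑ l : momenta L Λ,
    γ (σ, k) (τ, l) * planeWave L k x * star (planeWave L l y)

/-- The function `f̌(x) = (2π/L)^{3/2} ∑_k f(k) e_k(x)`. -/
def inverseFourier {L Λ : ℝ} (f : momenta L Λ → M4) (x : E3) : M4 :=
  (((2 * Real.pi / L) ^ (3 / 2 : ℝ) : ℝ) : ℂ) • ∑ k : momenta L Λ, planeWave L k x • f k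

/-- The density `ρ_γ(x) = tr γ(x,x)` (a real number when `γ` is self-adjoint). -/
def density {L Λ : ℝ} (γ : TorusOp L Λ) (x : E3) : ℝ := (kernel γ x x).trace.re

/-- The fundamental cell `[-L/2, L/2)³` of the torus `ℝ³ / Lℤ³`. -/
def cell (L : ℝ) : Set E3 := {x | ∀ i, x i ∈ Set.Ico (-(L / 2)) (L / 2)}

/-- `W` is the periodic Coulomb potential: it is `Lℤ³`-periodic, solves
`-Δ W = 4π (∑_{x ∈ Lℤ³} δ_x - L⁻³)` in the sense of distributions on the torus, and its minimum
is zero. The values of `W` at the singular points `Lℤ³` (a null set) are irrelevant. -/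
structure IsTorusCoulomb (L : ℝ) (W : E3 → ℝ) : Prop where
  periodic : ∀ (n : Fin 3 → ℤ) (x : E3), W (x + latticePoint L n) = W x
  integrable : IntegrableOn W (cell L)
  equation : ∀ φ : E3 → ℝ, ContDiff ℝ ∞ φ →
    (∀ (n : Fin 3 → ℤ) (x : E3), φ (x + latticePoint L n) = φ x) →
    (∫ x in cell L, W x * -(Laplacian.laplacian φ x)) =
      4 * Real.pi * (φ 0 - (L ^ 3)⁻¹ * (∫ x in cell L, φ x))
  continuous : ContinuousOn W (Set.range (latticePoint L))ᶜ
  min_eq_zero : IsLeast (W '' (Set.range (latticePoint L))ᶜ) 0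

/-- The periodic Coulomb potential `W_L`: the function satisfying `IsTorusCoulomb L`, which is
unique up to its values on `Lℤ³`. -/
def torusCoulomb (L : ℝ) : E3 → ℝ := Classical.epsilon (IsTorusCoulomb L)

/-- The squared Hilbert-Schmidt norm `∑ |A_{στ}|²` of a `4 × 4` matrix. -/
def hsNormSq (A : M4) : ℝ := ∑ σ, ∑ τ, ‖A σ τ‖ ^ 2

/-- The Hartree-Fock energy without external field on the torus,
`tr(D⁰γ) + α/2 ∬ ρ_γ(x) ρ_γ(y) W_L(x-y) dx dy - α/2 ∬ |γ(x,y)|² W_L(x-y) dx dy`. -/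
def torusEnergy (α m₀ L Λ : ℝ) (γ : TorusOp L Λ) : ℝ :=
  (fourierMultiplier (fun k : momenta L Λ => D0 m₀ k) * γ).trace.re
    + α / 2 * (∫ x in cell L, ∫ y in cell L,
        density γ x * density γ y * torusCoulomb L (x - y))
    - α / 2 * (∫ x in cell L, ∫ y in cell L,
        hsNormSq (kernel γ x y) * torusCoulomb L (x - y))

/-- The set `𝒢` of self-adjoint operators `γ` on `𝔥` with `-I/2 ≤ γ ≤ I/2`. -/
def torusStates (L Λ : ℝ) : Set (TorusOp L Λ) :=
  {γ | γ.IsHermitian ∧ (γ + (1 / 2 : ℂ) • (1 : TorusOp L Λ)).PosSemidef ∧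
    ((1 / 2 : ℂ) • (1 : TorusOp L Λ) - γ).PosSemidef}

/-- The ground state energy `E_L(0)`. -/
def torusGroundEnergy (α m₀ L Λ : ℝ) : ℝ :=
  sInf (torusEnergy α m₀ L Λ '' torusStates L Λ)

/-! ### Translation-invariant states in the whole space -/

/-- Measurable functions `f` on `B(0,Λ)` with values in the self-adjoint matrices such that
`-1/2 ≤ f ≤ 1/2` almost everywhere (so that `f` is essentially bounded). -/
def freeStates (Λ : ℝ) : Set (E3 → M4) :=
  {f | AEStronglyMeasurable f (volume.restrict (Metric.ball 0 Λ)) ∧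
    ∀ᵐ p ∂(volume.restrict (Metric.ball (0 : E3) Λ)),
      (f p).IsHermitian ∧ (f p + (1 / 2 : ℂ) • (1 : M4)).PosSemidef ∧
        ((1 / 2 : ℂ) • (1 : M4) - f p).PosSemidef}

/-- The energy per unit volume `𝒯(f)`. -/
def energyPerVolume (α m₀ Λ : ℝ) (f : E3 → M4) : ℝ :=
  ((2 * Real.pi) ^ 3)⁻¹ * (∫ p in Metric.ball (0 : E3) Λ, (D0 m₀ p * f p).trace.re)
    - α / (2 * Real.pi) ^ 5 * (∫ p in Metric.ball (0 : E3) Λ, ∫ q in Metric.ball (0 : E3) Λ,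
        (f p * f q).trace.re / ‖p - q‖ ^ 2)

/-- The infimum of the energy per unit volume. -/
def freeGroundEnergy (α m₀ Λ : ℝ) : ℝ := sInf (energyPerVolume α m₀ Λ '' freeStates Λ)

/-- `f` is the continuous representative on `B(0,Λ)` of the unique minimizer of the energy per unit
volume, uniqueness being understood up to almost everywhere equality. -/
structure IsFreeVacuum (α m₀ Λ : ℝ) (f : E3 → M4) : Prop where
  mem : f ∈ freeStates Λ
  continuousOn : ContinuousOn f (Metric.ball 0 Λ)
  isMinOn : IsMinOn (energyPerVolume α m₀ Λ) (freeStates Λ) f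
  unique : ∀ g ∈ freeStates Λ, IsMinOn (energyPerVolume α m₀ Λ) (freeStates Λ) g →
    g =ᵐ[volume.restrict (Metric.ball 0 Λ)] f

/-- The operator norm of a square matrix acting on the Hilbert space `ℂⁿ`. -/
def opNorm {n : Type} [Fintype n] [DecidableEq n] (A : Matrix n n ℂ) : ℝ :=
  ‖Matrix.toEuclideanCLM (n := n) (𝕜 := ℂ) A‖

end HFVacuum

end

open HFVacuum

noncomputable section

namespace HFVacuum

/-! ### Clifford matrices -/

/-! In both settings the energy is a linear term minus a quadratic exchange term; on the torus a
nonnegative direct term is added. At a state with symbol `-(1/2) cliff N` the derivative of the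
linear and exchange terms is `cliff Y`, where `Y = X + ∫ K N` is the mean field of `N`, `X = (p,
m₀)`, and `K` is a multiple of `|p - q|⁻²` or, on the torus, of the Fourier coefficients of `W_L`.
The linear form `tr (cliff Y ·)` is smallest on the negative spectral projector of `cliff Y` minus
`1/2`, so the candidate minimizer solves the self-consistent equation `N = Y / |Y|`.

The bound on `α` enters through the Schur integral `∫ dq / (|p - q|² (|q|² + m²)) ≤ π³ / √(|p|² +
m²)` (`lintegral_schur_le`). It says `∫ K h ≤ θ |X| h` with `h = |X|⁻²` on the ball and `θ = α π / 4
< 1`, and it is used twice.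

Existence (`IsMeanField.exists_solution`): fields `N` whose coordinates have the parity and the sign
of those of `X` form a closed cone. The kernel is larger between points on the same side of a
coordinate plane, so the potential of `N` again has the signs of `X`. Hence `|Y| ≥ |X|`,
normalization is Lipschitz with constant `1 / |X|` there, and `N ↦ Y / |Y|` contracts with factor
`θ` in the sup norm weighted by `h`.

Coercivity (`energyPerVolume_sub_ge`, `torusEnergy_sub_ge`): with `Q` the difference of a state and
the solution, the linear term is at least `∫ |Y| |Q|² ≥ ∫ |X| |Q|²`, because `R² ≤ R` when `0 ≤ R ≤
1`. Schur's test bounds the exchange energy of `Q` by `θ ∫ |X| |Q|²`. The energy therefore exceeds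
its value at the solution by at least `(1 - θ) ∫ |X| |Q|²`, up to the volume factor, which gives
minimality and uniqueness. On the torus `Q` may have off-diagonal momentum blocks, and the direct
term vanishes at the solution because its symbol is traceless.

Limit: sums over the momenta against the torus kernel converge to the integrals against `|p - q|⁻²`,
uniformly in the momentum (`eventually_torusKernel_potential`). Hence the Schur bound holds on large
tori for any `θ > α π / 4`, and the contraction turns the consistency error into uniform convergence
of the solutions (`eventually_torusSolution_close`). The energies follow as Riemann sums
(`tendsto_torusEnergy`).

The torus kernel requires the potential `W_L` itself. It is built from the time integral of the
periodic heat kernel minus its mean, and is unique because an integrable periodic function with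
vanishing Fourier coefficients vanishes wherever it is continuous. Its zero mode is of order `L²`,
hence negligible after division by `L³`. -/

/-- The real four-dimensional space of coefficients of the Dirac matrices `α₁, α₂, α₃, β`. -/
abbrev E4 : Type := EuclideanSpace ℝ (Fin 4)

/-- The matrix `v₀ α₁ + v₁ α₂ + v₂ α₃ + v₃ β`. -/
def cliff : E4 →ₗ[ℝ] M4 where
  toFun v := (v 0 : ℂ) • diracA1 + (v 1 : ℂ) • diracA2 + (v 2 : ℂ) • diracA3 + (v 3 : ℂ) • diracB
  map_add' v w := by
    simp only [PiLp.add_apply, Complex.ofReal_add, add_smul]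
    abel
  map_smul' c v := by
    simp only [PiLp.smul_apply, smul_eq_mul, Complex.ofReal_mul, mul_smul, RingHom.id_apply,
      smul_add]
    rfl

theorem cliff_apply (v : E4) : cliff v = (v 0 : ℂ) • diracA1 + (v 1 : ℂ) • diracA2 +
    (v 2 : ℂ) • diracA3 + (v 3 : ℂ) • diracB := rfl

/-- The vector `(p, m)` of coefficients of the free Dirac symbol. -/
def diracVec (m : ℝ) (p : E3) : E4 := WithLp.toLp 2 ![p 0, p 1, p 2, m]

theorem D0_eq_cliff (m : ℝ) (p : E3) : D0 m p = cliff (diracVec m p) := by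
  simp [D0, cliff_apply, diracVec]

theorem cliff_eq_of (v : E4) : cliff v =
    !![(v 3 : ℂ), 0, (v 2 : ℂ), v 0 - v 1 * Complex.I;
      0, (v 3 : ℂ), v 0 + v 1 * Complex.I, -(v 2 : ℂ);
      (v 2 : ℂ), v 0 - v 1 * Complex.I, -(v 3 : ℂ), 0;
      v 0 + v 1 * Complex.I, -(v 2 : ℂ), 0, -(v 3 : ℂ)] := by
  ext i j
  fin_cases i <;> fin_cases j <;>
    simp [cliff_apply, diracA1, diracA2, diracA3, diracB, sub_eq_add_neg]

theorem cliff_isHermitian (v : E4) : (cliff v).IsHermitian := by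
  rw [cliff_eq_of]
  ext i j
  fin_cases i <;> fin_cases j <;> simp [sub_eq_add_neg]

theorem trace_cliff (v : E4) : (cliff v).trace = 0 := by
  rw [cliff_eq_of]
  simp [Matrix.trace, Fin.sum_univ_four]

theorem trace_cliff_mul (v w : E4) :
    (cliff v * cliff w).trace = ((4 * inner ℝ v w : ℝ) : ℂ) := by
  rw [cliff_eq_of, cliff_eq_of]
  simp [Matrix.trace, Fin.sum_univ_four, PiLp.inner_apply]
  linear_combination (-4 * (v 1 : ℂ) * (w 1 : ℂ)) * Complex.I_sq

theorem cliff_mul_self (v : E4) : cliff v * cliff v = ((‖v‖ ^ 2 : ℝ) : ℂ) • (1 : M4) := by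
  rw [cliff_eq_of, EuclideanSpace.real_norm_sq_eq]
  have hI := Complex.I_sq
  ext i j
  fin_cases i <;> fin_cases j <;>
    simp [Matrix.mul_apply, Fin.sum_univ_four] <;>
    first | ring1 | linear_combination (-(v 1 : ℂ) ^ 2) * hI

/-- The state symbol with direction `-N`. -/
def spinState (N : E4) : M4 := (-(1 / 2) : ℂ) • cliff N

theorem spinState_isHermitian (N : E4) : (spinState N).IsHermitian := by
  have h := cliff_isHermitian N
  unfold spinState Matrix.IsHermitian
  rw [Matrix.conjTranspose_smul, h.eq]
  simp

theorem spinState_isStarProjection {N : E4} (hN : ‖N‖ = 1) :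
    IsStarProjection (spinState N + (1 / 2 : ℂ) • (1 : M4)) := by
  constructor
  · unfold IsIdempotentElem spinState
    have h := cliff_mul_self N
    simp only [mul_add, add_mul, smul_mul_smul_comm, h, hN, mul_one, one_mul]
    simp only [one_pow, Complex.ofReal_one, one_smul]
    module
  · have h := spinState_isHermitian N
    unfold IsSelfAdjoint
    rw [star_add, Matrix.star_eq_conjTranspose, h.eq]
    simp

theorem trace_spinState (N : E4) : (spinState N).trace = 0 := by
  simp [spinState, Matrix.trace_smul, trace_cliff]

/-! ### Orthogonal projections and their complements -/

section Projections

variable {n : Type*} [Fintype n] [DecidableEq n]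

omit [DecidableEq n] in
theorem posSemidef_of_isStarProjection {P : Matrix n n ℂ} (hP : IsStarProjection P) :
    P.PosSemidef := by
  have h : P = P.conjTranspose * P := by
    rw [← Matrix.star_eq_conjTranspose, hP.2.star_eq, hP.1.eq]
  rw [h]
  exact Matrix.posSemidef_conjTranspose_mul_self P

theorem state_of_isStarProjection {P : Matrix n n ℂ} (hP : IsStarProjection P) :
    (P - (1 / 2 : ℂ) • (1 : Matrix n n ℂ)).IsHermitian ∧
      (P - (1 / 2 : ℂ) • (1 : Matrix n n ℂ) + (1 / 2 : ℂ) • (1 : Matrix n n ℂ)).PosSemidef ∧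
      ((1 / 2 : ℂ) • (1 : Matrix n n ℂ) - (P - (1 / 2 : ℂ) • (1 : Matrix n n ℂ))).PosSemidef := by
  refine ⟨?_, ?_, ?_⟩
  · have h : P.IsHermitian := hP.2
    unfold Matrix.IsHermitian
    rw [Matrix.conjTranspose_sub, h.eq]
    simp
  · rw [sub_add_cancel]
    exact posSemidef_of_isStarProjection hP
  · have h : (1 / 2 : ℂ) • (1 : Matrix n n ℂ) - (P - (1 / 2 : ℂ) • (1 : Matrix n n ℂ)) = 1 - P := by
      module
    rw [h]
    exact posSemidef_of_isStarProjection hP.one_sub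

/-- `R - R²` is the sum of the congruences `R (1 - R) R` and `(1 - R) R (1 - R)`, so `R² ≤ R`
follows without spectral theory. -/
theorem posSemidef_sub_mul_self {R : Matrix n n ℂ} (h0 : R.PosSemidef) (h1 : (1 - R).PosSemidef) :
    (R - R * R).PosSemidef := by
  have e : R - R * R = R.conjTranspose * (1 - R) * R + (1 - R).conjTranspose * R * (1 - R) := by
    rw [h0.isHermitian.eq, h1.isHermitian.eq]
    noncomm_ring
  rw [e]
  exact (h1.conjTranspose_mul_mul_same R).add (h0.conjTranspose_mul_mul_same (1 - R))

/-- Rows of a density matrix have square norm at most the diagonal entry. -/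
theorem sum_norm_sq_row_le {R : Matrix n n ℂ} (h0 : R.PosSemidef) (h1 : (1 - R).PosSemidef)
    (i : n) : ∑ j, ‖R i j‖ ^ 2 ≤ (R i i).re := by
  have h := (posSemidef_sub_mul_self h0 h1).diag_nonneg (i := i)
  rw [Complex.le_def] at h
  have h2 := h.1
  simp only [Matrix.sub_apply, Complex.zero_re, Complex.sub_re, Matrix.mul_apply, Complex.re_sum,
    sub_nonneg] at h2
  refine le_trans (le_of_eq (Finset.sum_congr rfl fun j _ => ?_)) h2
  have hj : R j i = star (R i j) := (h0.isHermitian.apply j i).symm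
  rw [hj, ← Complex.normSq_eq_norm_sq]
  simp [Complex.normSq_apply]

end Projections

/-! ### Hilbert-Schmidt norm and the quadratic bound at a spectral projector -/

theorem hsNormSq_nonneg (A : M4) : 0 ≤ hsNormSq A :=
  Finset.sum_nonneg fun _ _ => Finset.sum_nonneg fun _ _ => sq_nonneg _

theorem hsNormSq_sub (A B : M4) :
    hsNormSq (A - B) = hsNormSq A - 2 * (B.conjTranspose * A).trace.re + hsNormSq B := by
  have h : ∀ a b : ℂ, ‖a - b‖ ^ 2 = ‖a‖ ^ 2 - 2 * (star b * a).re + ‖b‖ ^ 2 := by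
    intro a b
    simp only [← Complex.normSq_eq_norm_sq, Complex.normSq_apply, Complex.sub_re, Complex.sub_im,
      Complex.mul_re, Complex.star_def, Complex.conj_re, Complex.conj_im]
    ring
  simp only [hsNormSq, Matrix.sub_apply, h, Finset.sum_add_distrib, Finset.sum_sub_distrib,
    Matrix.trace, Matrix.diag_apply, Matrix.mul_apply, Matrix.conjTranspose_apply, Complex.re_sum,
    ← Finset.mul_sum]
  rw [Finset.sum_comm (f := fun i j => (star (B i j) * A i j).re)]

theorem hsNormSq_eq_trace (A : M4) : hsNormSq A = (A.conjTranspose * A).trace.re := by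
  have h := hsNormSq_sub A A
  have h0 : hsNormSq (A - A) = 0 := by simp [hsNormSq]
  linarith

/-- Second order lower bound around the negative spectral projection of `cliff N`: here `A` is a
diagonal block of a density matrix and `b` the square norm of the rest of its rows. -/
theorem hsNormSq_add_le_trace_cliff_mul {N : E4} (hN : ‖N‖ = 1) (A : M4) (b : ℝ)
    (hA : hsNormSq A + b ≤ A.trace.re) :
    hsNormSq (A - (spinState N + (1 / 2 : ℂ) • (1 : M4))) + b ≤
      (cliff N * (A - (spinState N + (1 / 2 : ℂ) • (1 : M4)))).trace.re := by
  set P : M4 := spinState N + (1 / 2 : ℂ) • (1 : M4) with hP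
  have hproj : IsStarProjection P := spinState_isStarProjection hN
  have hPH : P.conjTranspose = P := hproj.2
  -- With `cliff N = 1 - 2P` the right side minus the left side is exactly `tr A - |A|² - b`, so the
  -- hypothesis is all that is needed.
  have hc : cliff N = 1 - (2 : ℂ) • P := by
    rw [hP, spinState]
    module
  clear_value P
  have hPP : hsNormSq P = P.trace.re := by
    rw [hsNormSq_eq_trace, hPH, hproj.1.eq]
  rw [hsNormSq_sub, hPH, hPP, hc]
  have e : (1 - (2 : ℂ) • P) * (A - P) = A + P - (2 : ℂ) • (P * A) := by
    rw [sub_mul, one_mul, smul_mul_assoc, mul_sub, hproj.1.eq]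
    module
  have e2 : ((cliff N) * (A - P)).trace.re = A.trace.re + P.trace.re - 2 * (P * A).trace.re := by
    rw [hc, e, Matrix.trace_sub, Matrix.trace_add, Matrix.trace_smul]
    simp
  rw [← hc, e2]
  linarith

/-! ### Operator norms of symbols and of Fourier multipliers -/

theorem opNorm_nonneg {n : Type} [Fintype n] [DecidableEq n] (A : Matrix n n ℂ) : 0 ≤ opNorm A :=
  norm_nonneg _

/-- A uniform bound of the operator norm of Clifford matrices. -/
theorem exists_opNorm_spinState_le : ∃ C : ℝ, 0 ≤ C ∧ ∀ v : E4, opNorm (spinState v) ≤ C * ‖v‖ := by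
  let T : E4 →ₗ[ℝ] (EuclideanSpace ℂ (Fin 4) →L[ℂ] EuclideanSpace ℂ (Fin 4)) :=
    { toFun := fun v => Matrix.toEuclideanCLM (n := Fin 4) (𝕜 := ℂ) (spinState v)
      map_add' := fun v w => by simp [spinState]
      map_smul' := fun c v => by
        have e : spinState (c • v) = (c : ℂ) • spinState v := by
          simp only [spinState, map_smul]
          rw [smul_comm]; rfl
        rw [e, map_smul]; rfl }
  let T' := LinearMap.toContinuousLinearMap T
  exact ⟨‖T'‖, ContinuousLinearMap.opNorm_nonneg T', fun v => T'.le_opNorm v⟩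

/-- The operator norm of a Fourier multiplier is bounded by the supremum of its symbol. -/
theorem opNorm_fourierMultiplier_le {L Λ : ℝ} (g : momenta L Λ → M4) {r : ℝ} (hr : 0 ≤ r)
    (hg : ∀ k, opNorm (g k) ≤ r) : opNorm (fourierMultiplier g) ≤ r := by
  refine ContinuousLinearMap.opNorm_le_bound _ hr fun v => ?_
  have hk : ∀ k, ∀ w : Fin 4 → ℂ, ∑ σ, ‖(g k).mulVec w σ‖ ^ 2 ≤ r ^ 2 * ∑ σ, ‖w σ‖ ^ 2 := by
    intro k w
    have h1 := (Matrix.toEuclideanCLM (n := Fin 4) (𝕜 := ℂ) (g k)).le_opNorm (WithLp.toLp 2 w)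
    have h2 := h1.trans (mul_le_mul_of_nonneg_right (hg k) (norm_nonneg _))
    have h3 := pow_le_pow_left₀ (norm_nonneg _) h2 2
    rw [mul_pow, EuclideanSpace.norm_sq_eq, EuclideanSpace.norm_sq_eq] at h3
    simpa using h3
  refine le_of_sq_le_sq ?_ (by positivity)
  rw [mul_pow, EuclideanSpace.norm_sq_eq, EuclideanSpace.norm_sq_eq, Fintype.sum_prod_type_right,
    Fintype.sum_prod_type_right, Finset.mul_sum]
  refine Finset.sum_le_sum fun k _ => ?_
  refine le_trans (le_of_eq (Finset.sum_congr rfl fun σ _ => ?_)) (hk k fun τ => v (τ, k))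
  congr 2
  simp only [fourierMultiplier, Matrix.ofLp_toEuclideanCLM, Matrix.mulVec, dotProduct,
    Fintype.sum_prod_type_right, Matrix.blockDiagonal_apply]
  rw [Finset.sum_eq_single k]
  · simp
  · intro l _ hl
    simp [Ne.symm hl]
  · simp

/-! ### The self-consistent equation -/

/-- Normalization is Lipschitz away from the origin. -/
theorem norm_normalize_sub_le {E : Type*} [NormedAddCommGroup E] [InnerProductSpace ℝ E] {x y : E}
    {r : ℝ} (hr : 0 < r) (hx : r ≤ ‖x‖) (hy : r ≤ ‖y‖) :
    ‖‖x‖⁻¹ • x - ‖y‖⁻¹ • y‖ ≤ r⁻¹ * ‖x - y‖ := by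
  have hx0 : 0 < ‖x‖ := hr.trans_le hx
  have hy0 : 0 < ‖y‖ := hr.trans_le hy
  refine le_of_sq_le_sq ?_ (by positivity)
  rw [mul_pow, @norm_sub_sq_real, @norm_sub_sq_real, norm_smul, norm_smul, inner_smul_left,
    inner_smul_right, norm_inv, norm_inv, norm_norm, norm_norm, inv_mul_cancel₀ hx0.ne',
    inv_mul_cancel₀ hy0.ne']
  have hc := real_inner_le_norm x y
  set a := ‖x‖
  set b := ‖y‖
  set c := inner ℝ x y
  simp only [conj_trivial]
  -- Multiplied by `ab`, the squared distance of the unit vectors becomes `2ab - 2c`, which is at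
  -- most `a² + b² - 2c = |x - y|²`.
  have h1 : (1 : ℝ) ^ 2 - 2 * (a⁻¹ * (b⁻¹ * c)) + 1 ^ 2 = (a * b)⁻¹ * (2 * (a * b) - 2 * c) := by
    field_simp
    ring
  rw [h1]
  have h2 : (a * b)⁻¹ ≤ r⁻¹ ^ 2 := by
    rw [inv_pow]
    refine inv_anti₀ (by positivity) ?_
    nlinarith
  refine mul_le_mul h2 ?_ (by linarith) (by positivity)
  nlinarith [sq_nonneg (a - b)]

/-- The `j`-th coordinate as a continuous linear map. -/
def coordCLM (j : Fin 4) : E4 →L[ℝ] ℝ := EuclideanSpace.proj j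

/-- Sign change of the `i`-th coordinate. -/
def IsReflected (i : Fin 3) (v w : E4) : Prop :=
  ∀ j, w j = if j = i.castSucc then -v j else v j

/-- The data of a self-consistent equation: a nonnegative kernel which is invariant under the
coordinate reflections and larger on the same side of the reflection hyperplanes, and a weight `h`
for the Schur test. -/
structure IsMeanField {Ω : Type*} [TopologicalSpace Ω] [MeasurableSpace Ω] (μ : Measure Ω)
    (K : Ω → Ω → ℝ) (X : Ω → E4) (r : Fin 3 → Ω → Ω) (h : Ω → ℝ) (θ m c C : ℝ) : Prop where
  m_pos : 0 < m
  c_pos : 0 < c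
  θ_nonneg : 0 ≤ θ
  X_cont : Continuous X
  X_ge : ∀ p, m ≤ X p 3
  X_r : ∀ i p, IsReflected i (X p) (X (r i p))
  r_invol : ∀ i p, r i (r i p) = p
  integral_r : ∀ i (f : Ω → ℝ), ∫ q, f (r i q) ∂μ = ∫ q, f q ∂μ
  K_nonneg : ∀ p q, 0 ≤ K p q
  K_r : ∀ i p q, K (r i p) (r i q) = K p q
  K_le : ∀ i p, ∀ᵐ q ∂μ,
    (0 ≤ X p (Fin.castSucc i) * X q (Fin.castSucc i) → K p (r i q) ≤ K p q) ∧
    (X p (Fin.castSucc i) * X q (Fin.castSucc i) ≤ 0 → K p q ≤ K p (r i q))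
  pot_cont : ∀ (g : Ω → E4) (M : ℝ), Continuous g → (∀ p, ‖g p‖ ≤ M) →
    Continuous fun p => ∫ q, K p q • g q ∂μ
  smul_int : ∀ (g : Ω → E4) (M : ℝ), Continuous g → (∀ p, ‖g p‖ ≤ M) → ∀ p,
    Integrable (fun q => K p q • g q) μ
  h_cont : Continuous h
  h_ge : ∀ p, c ≤ h p
  h_le : ∀ p, h p ≤ C
  schur_int : ∀ p, Integrable (fun q => K p q * h q) μ
  schur : ∀ p, ∫ q, K p q * h q ∂μ ≤ θ * ‖X p‖ * h p

namespace IsMeanField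

variable {Ω : Type*} [TopologicalSpace Ω] [MeasurableSpace Ω] {μ : Measure Ω}
  {K : Ω → Ω → ℝ} {X : Ω → E4} {r : Fin 3 → Ω → Ω} {h : Ω → ℝ} {θ m c C : ℝ}

/-- The mean field generated by `N`. -/
def field (μ : Measure Ω) (K : Ω → Ω → ℝ) (X : Ω → E4) (N : Ω → E4) (p : Ω) : E4 :=
  X p + ∫ q, K p q • N q ∂μ

/-- The invariant cone of the self-consistent equation. -/
structure Cone (X : Ω → E4) (r : Fin 3 → Ω → Ω) (N : Ω → E4) : Prop where
  cont : Continuous N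
  le_one : ∀ p, ‖N p‖ ≤ 1
  refl : ∀ i p, IsReflected i (N p) (N (r i p))
  sign : ∀ j p, 0 ≤ X p j * N p j

theorem coord_integral (H : IsMeanField μ K X r h θ m c C) {N : Ω → E4} (hN : Cone X r N) (p : Ω)
    (j : Fin 4) : (∫ q, K p q • N q ∂μ) j = ∫ q, K p q * N q j ∂μ := by
  have h1 := (coordCLM j).integral_comp_comm
    (H.smul_int N 1 hN.cont hN.le_one p)
  exact h1.symm

/-- For a spatial coordinate, `N_i` is odd under the reflection `r i`, so folding the integral
replaces `K p q` by `(K p q - K p (r i q)) / 2`. That difference has the sign of `X p i * X q i`,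
and `N q i` has the sign of `X q i`, so the product with `X p i` is nonnegative. For the mass
coordinate everything in sight is nonnegative. -/
theorem sign_integral (H : IsMeanField μ K X r h θ m c C) {N : Ω → E4} (hN : Cone X r N) (p : Ω)
    (j : Fin 4) : 0 ≤ X p j * (∫ q, K p q • N q ∂μ) j := by
  rw [H.coord_integral hN]
  have hint : Integrable (fun q => K p q * N q j) μ := by
    exact (coordCLM j).integrable_comp (H.smul_int N 1 hN.cont hN.le_one p)
  rcases Fin.eq_castSucc_or_eq_last j with ⟨i, rfl⟩ | rfl
  · have hrN : ∀ q, N (r i q) i.castSucc = -N q i.castSucc := fun q => by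
      simpa using hN.refl i q i.castSucc
    have h1 : ∫ q, K p q * N q i.castSucc ∂μ = -∫ q, K p (r i q) * N q i.castSucc ∂μ := by
      rw [← H.integral_r i, ← integral_neg]
      refine integral_congr_ae (ae_of_all _ fun q => ?_)
      simp only [hrN]
      ring
    have hint2 : Integrable (fun q => K p (r i q) * N q i.castSucc) μ := by
      have h3 : (fun q => K p (r i q) * N q i.castSucc) =
          fun q => K (r i p) q * N q i.castSucc := by
        funext q
        rw [← H.K_r i p (r i q), H.r_invol]
      rw [h3]
      exact (coordCLM i.castSucc).integrable_comp (H.smul_int N 1 hN.cont hN.le_one (r i p))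
    have h2 : 2 * (X p i.castSucc * ∫ q, K p q * N q i.castSucc ∂μ) =
        ∫ q, X p i.castSucc * ((K p q - K p (r i q)) * N q i.castSucc) ∂μ := by
      rw [integral_const_mul]
      simp only [sub_mul]
      rw [integral_sub hint hint2]
      linear_combination (X p i.castSucc) * h1
    have h4 : 0 ≤ ∫ q, X p i.castSucc * ((K p q - K p (r i q)) * N q i.castSucc) ∂μ := by
      refine integral_nonneg_of_ae ?_
      filter_upwards [H.K_le i p] with q hq
      obtain ⟨hK1, hK2⟩ := hq
      have hs := hN.sign i.castSucc q
      simp only [Pi.zero_apply]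
      generalize X p i.castSucc = x at *
      generalize X q i.castSucc = y at *
      generalize N q i.castSucc = n at *
      rcases lt_trichotomy y 0 with hy | hy | hy
      · have hn : n ≤ 0 := by by_contra! hn; nlinarith
        rcases le_total x 0 with hx | hx
        · exact mul_nonneg_of_nonpos_of_nonpos hx
            (mul_nonpos_of_nonneg_of_nonpos (by linarith [hK1 (by nlinarith)]) hn)
        · exact mul_nonneg hx (mul_nonneg_of_nonpos_of_nonpos (by linarith [hK2 (by nlinarith)]) hn)
      -- On the reflection plane the sign of `N q i` is not controlled, but both kernel comparisons
      -- apply and force equality.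
      · have hd : K p q - K p (r i q) = 0 := by
          linarith [hK1 (by simp [hy]), hK2 (by simp [hy])]
        simp [hd]
      · have hn : 0 ≤ n := by by_contra! hn; nlinarith
        rcases le_total x 0 with hx | hx
        · exact mul_nonneg_of_nonpos_of_nonpos hx
            (mul_nonpos_of_nonpos_of_nonneg (by linarith [hK2 (by nlinarith)]) hn)
        · exact mul_nonneg hx (mul_nonneg (by linarith [hK1 (by nlinarith)]) hn)
    linarith
  · have hX : 0 < X p (Fin.last 3) := H.m_pos.trans_le (H.X_ge p)
    refine mul_nonneg hX.le (integral_nonneg fun q => mul_nonneg (H.K_nonneg p q) ?_)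
    have hq : 0 < X q (Fin.last 3) := H.m_pos.trans_le (H.X_ge q)
    exact nonneg_of_mul_nonneg_right (hN.sign (Fin.last 3) q) hq

theorem sign_field (H : IsMeanField μ K X r h θ m c C) {N : Ω → E4} (hN : Cone X r N) (p : Ω)
    (j : Fin 4) : X p j ^ 2 ≤ X p j * field μ K X N p j := by
  have h1 := H.sign_integral hN p j
  rw [field, PiLp.add_apply]
  nlinarith

/-- This is the purpose of the cone: in each coordinate the potential pushes in the direction of
`X`, so it can only lengthen it. The resulting lower bound by `|X|` makes the normalization
Lipschitz with a constant that matches the Schur bound. -/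
theorem norm_le_norm_field (H : IsMeanField μ K X r h θ m c C) {N : Ω → E4} (hN : Cone X r N)
    (p : Ω) : ‖X p‖ ≤ ‖field μ K X N p‖ := by
  rw [EuclideanSpace.norm_eq, EuclideanSpace.norm_eq]
  refine Real.sqrt_le_sqrt (Finset.sum_le_sum fun j _ => ?_)
  rw [Real.norm_eq_abs, Real.norm_eq_abs, sq_abs, sq_abs]
  have h1 := H.sign_field hN p j
  nlinarith [sq_nonneg (X p j - field μ K X N p j)]

theorem le_norm_X (H : IsMeanField μ K X r h θ m c C) (p : Ω) : m ≤ ‖X p‖ := by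
  have h1 := PiLp.norm_apply_le (X p) 3
  exact (H.X_ge p).trans ((le_abs_self _).trans h1)

theorem field_pos (H : IsMeanField μ K X r h θ m c C) {N : Ω → E4} (hN : Cone X r N) (p : Ω) :
    0 < ‖field μ K X N p‖ :=
  H.m_pos.trans_le ((H.le_norm_X p).trans (H.norm_le_norm_field hN p))

theorem continuous_field (H : IsMeanField μ K X r h θ m c C) {N : Ω → E4} (hN : Cone X r N) :
    Continuous (field μ K X N) :=
  H.X_cont.add (H.pot_cont N 1 hN.cont hN.le_one)

theorem field_refl (H : IsMeanField μ K X r h θ m c C) {N : Ω → E4} (hN : Cone X r N) (i : Fin 3)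
    (p : Ω) : IsReflected i (field μ K X N p) (field μ K X N (r i p)) := by
  intro j
  rw [field, field, PiLp.add_apply, PiLp.add_apply, H.X_r i p j, H.coord_integral hN,
    H.coord_integral hN]
  have h1 : ∫ q, K (r i p) q * N q j ∂μ = ∫ q, K p q * N (r i q) j ∂μ := by
    rw [← H.integral_r i]
    simp only [H.K_r]
  rw [h1]
  have h2 := fun q => hN.refl i q j
  simp only [h2]
  split_ifs with hj
  · simp only [mul_neg, integral_neg]
    ring
  · rfl

/-- Invariance of the cone: division by a positive, reflection-invariant scalar changes neither
signs nor parities. -/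
theorem cone_normalize (H : IsMeanField μ K X r h θ m c C) {N : Ω → E4} (hN : Cone X r N) :
    Cone X r fun p => ‖field μ K X N p‖⁻¹ • field μ K X N p where
  cont := ((H.continuous_field hN).norm.inv₀ fun p => (H.field_pos hN p).ne').smul
    (H.continuous_field hN)
  le_one p := by
    rw [norm_smul, norm_inv, norm_norm, inv_mul_cancel₀ (H.field_pos hN p).ne']
  refl i p := by
    have h1 := H.field_refl hN i p
    have h2 : ‖field μ K X N (r i p)‖ = ‖field μ K X N p‖ := by
      rw [EuclideanSpace.norm_eq, EuclideanSpace.norm_eq]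
      congr 1
      refine Finset.sum_congr rfl fun j _ => ?_
      rw [h1 j]
      split_ifs <;> simp
    intro j
    simp only [PiLp.smul_apply, smul_eq_mul, h2, h1 j]
    split_ifs <;> ring
  sign j p := by
    have h1 := H.sign_field hN p j
    have h2 := H.field_pos hN p
    simp only [PiLp.smul_apply, smul_eq_mul]
    rw [mul_left_comm]
    exact mul_nonneg (by positivity) ((sq_nonneg _).trans h1)

/-- The self-consistent map is a contraction in the weighted supremum norm. -/
theorem normalize_sub_le (H : IsMeanField μ K X r h θ m c C) {N N' : Ω → E4} (hN : Cone X r N)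
    (hN' : Cone X r N') {d : ℝ} (hd : ∀ p, ‖N p - N' p‖ ≤ d * h p) (p : Ω) :
    ‖‖field μ K X N p‖⁻¹ • field μ K X N p - ‖field μ K X N' p‖⁻¹ • field μ K X N' p‖ ≤
      θ * d * h p := by
  have hX : 0 < ‖X p‖ := H.m_pos.trans_le (H.le_norm_X p)
  -- The Lipschitz constant used is `|X p|⁻¹` rather than `m⁻¹`; it cancels the factor `|X p|` of
  -- the Schur bound and leaves exactly `θ`.
  refine (norm_normalize_sub_le hX (H.norm_le_norm_field hN p)
    (H.norm_le_norm_field hN' p)).trans ?_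
  have h1 : field μ K X N p - field μ K X N' p = ∫ q, K p q • (N q - N' q) ∂μ := by
    simp only [field, smul_sub]
    rw [integral_sub (H.smul_int N 1 hN.cont hN.le_one p)
      (H.smul_int N' 1 hN'.cont hN'.le_one p)]
    abel
  have hd0 : 0 ≤ d := by
    have h2 := (norm_nonneg _).trans (hd p)
    exact nonneg_of_mul_nonneg_left h2 (H.c_pos.trans_le (H.h_ge p))
  have h2 : ‖∫ q, K p q • (N q - N' q) ∂μ‖ ≤ ∫ q, d * (K p q * h q) ∂μ := by
    refine norm_integral_le_of_norm_le ((H.schur_int p).const_mul d) (ae_of_all _ fun q => ?_)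
    rw [norm_smul, Real.norm_of_nonneg (H.K_nonneg p q)]
    nlinarith [mul_le_mul_of_nonneg_left (hd q) (H.K_nonneg p q)]
  rw [integral_const_mul] at h2
  rw [h1, inv_mul_le_iff₀ hX]
  refine h2.trans ((mul_le_mul_of_nonneg_left (H.schur p) hd0).trans (le_of_eq ?_))
  ring

/-- Existence of a solution of the self-consistent equation. -/
theorem exists_solution (H : IsMeanField μ K X r h θ m c C) (hθ : θ < 1) :
    ∃ N : Ω → E4, Cone X r N ∧ ∀ p, N p = ‖field μ K X N p‖⁻¹ • field μ K X N p := by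
  have hh : ∀ p, 0 < h p := fun p => H.c_pos.trans_le (H.h_ge p)
  -- The unknown is `g = N / h`: its sup norm is the weighted norm of `N` in which the map
  -- contracts.
  let S : Set (BoundedContinuousFunction Ω E4) := {g | Cone X r fun p => h p • g p}
  have hScl : IsClosed S := by
    have hS : S = {g : BoundedContinuousFunction Ω E4 | ∀ p, ‖h p • g p‖ ≤ 1} ∩
        ({g | ∀ i p j, (h (r i p) • g (r i p)) j =
          if j = i.castSucc then -(h p • g p) j else (h p • g p) j} ∩
        {g | ∀ j p, 0 ≤ X p j * (h p • g p) j}) := by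
      ext g
      exact ⟨fun hg => ⟨hg.le_one, hg.refl, hg.sign⟩,
        fun hg => ⟨H.h_cont.smul g.continuous, hg.1, hg.2.1, hg.2.2⟩⟩
    have hev : ∀ p, Continuous fun g : BoundedContinuousFunction Ω E4 => g p := fun p =>
      (BoundedContinuousFunction.evalCLM ℝ p).continuous
    have hev' : ∀ p j, Continuous fun g : BoundedContinuousFunction Ω E4 => (h p • g p) j :=
      fun p j => by
        have := hev p
        fun_prop
    rw [hS]
    refine IsClosed.inter ?_ (IsClosed.inter ?_ ?_)
    · simp only [Set.ofPred_forall]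
      exact isClosed_iInter fun p => isClosed_le (by have := hev p; fun_prop) continuous_const
    · simp only [Set.ofPred_forall]
      refine isClosed_iInter fun i => isClosed_iInter fun p => isClosed_iInter fun j => ?_
      refine isClosed_eq (hev' _ _) ?_
      split_ifs
      · exact (hev' _ _).neg
      · exact hev' _ _
    · simp only [Set.ofPred_forall]
      refine isClosed_iInter fun j => isClosed_iInter fun p => ?_
      exact isClosed_le continuous_const ((hev' p j).const_mul _)
  have : CompleteSpace S := hScl.completeSpace_coe
  have h0 : (0 : BoundedContinuousFunction Ω E4) ∈ S := by
    refine ⟨by simpa using continuous_const, by simp, fun i p j => by simp, by simp⟩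
  have : Nonempty S := ⟨⟨0, h0⟩⟩
  let Φ₀ : S → Ω → E4 := fun g p => (h p)⁻¹ •
    (‖field μ K X (fun q => h q • g.1 q) p‖⁻¹ • field μ K X (fun q => h q • g.1 q) p)
  have hΦc : ∀ g : S, Continuous (Φ₀ g) := fun g =>
    (H.h_cont.inv₀ fun p => (hh p).ne').smul (H.cone_normalize g.2).cont
  have hΦb : ∀ (g : S) p, ‖Φ₀ g p‖ ≤ c⁻¹ := by
    intro g p
    simp only [Φ₀]
    rw [norm_smul, norm_inv, Real.norm_of_nonneg (hh p).le]
    calc (h p)⁻¹ * _ ≤ c⁻¹ * 1 := mul_le_mul (inv_anti₀ H.c_pos (H.h_ge p))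
          ((H.cone_normalize g.2).le_one p) (norm_nonneg _) (by have := H.c_pos; positivity)
      _ = c⁻¹ := mul_one _
  let Φ : S → S := fun g => ⟨BoundedContinuousFunction.ofNormedAddCommGroup (Φ₀ g) (hΦc g) c⁻¹
    (hΦb g), by
      have h1 := H.cone_normalize g.2
      have h2 : (fun p => h p • BoundedContinuousFunction.ofNormedAddCommGroup (Φ₀ g) (hΦc g) c⁻¹
          (hΦb g) p) = fun p => ‖field μ K X (fun q => h q • g.1 q) p‖⁻¹ •
            field μ K X (fun q => h q • g.1 q) p := by
        funext p
        simp only [BoundedContinuousFunction.coe_ofNormedAddCommGroup, Φ₀]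
        rw [smul_inv_smul₀ (hh p).ne']
      simp only [S, Set.mem_ofPred_eq]
      rw [h2]
      exact h1⟩
  have hcontr : ContractingWith ⟨θ, H.θ_nonneg⟩ Φ := by
    refine ⟨by exact_mod_cast hθ, LipschitzWith.of_dist_le_mul fun g g' => ?_⟩
    rw [Subtype.dist_eq, Subtype.dist_eq]
    refine (BoundedContinuousFunction.dist_le (mul_nonneg H.θ_nonneg dist_nonneg)).2 fun p => ?_
    simp only [Φ, BoundedContinuousFunction.coe_ofNormedAddCommGroup, Φ₀]
    rw [dist_eq_norm, ← smul_sub, norm_smul, norm_inv, Real.norm_of_nonneg (hh p).le,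
      inv_mul_le_iff₀ (hh p), mul_comm (h p)]
    refine H.normalize_sub_le g.2 g'.2 (fun q => ?_) p
    rw [← smul_sub, norm_smul, Real.norm_of_nonneg (hh q).le, mul_comm, ← dist_eq_norm]
    exact mul_le_mul_of_nonneg_right (BoundedContinuousFunction.dist_coe_le_dist q) (hh q).le
  set g := ContractingWith.fixedPoint Φ hcontr with hg
  have hfix : Φ g = g := ContractingWith.fixedPoint_isFixedPt hcontr
  refine ⟨fun p => h p • g.1 p, g.2, fun p => ?_⟩
  have h1 : (Φ g).1 p = g.1 p := by rw [hfix]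
  have h2 : Φ₀ g p = g.1 p := h1
  simp only
  rw [← h2]
  simp only [Φ₀]
  rw [smul_inv_smul₀ (hh p).ne']

end IsMeanField

/-! ### The Schur integral -/

/-- Feynman's parametrization; `s / (b (s a + (1 - s) b))` is an antiderivative of the integrand. -/
theorem lintegral_feynman {a b : ℝ} (ha : 0 < a) (hb : 0 < b) :
    ENNReal.ofReal (1 / (a * b)) =
      ∫⁻ s in Set.Ioo (0 : ℝ) 1, ENNReal.ofReal (1 / (s * a + (1 - s) * b) ^ 2) := by
  have hpos : ∀ s ∈ Set.Icc (0 : ℝ) 1, 0 < s * a + (1 - s) * b := by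
    rintro s ⟨h0, h1⟩
    rcases h0.eq_or_lt with rfl | h0
    · simpa using hb
    · have : 0 ≤ (1 - s) * b := mul_nonneg (by linarith) hb.le
      positivity
  have hcont : ContinuousOn (fun s : ℝ => 1 / (s * a + (1 - s) * b) ^ 2) (Set.Icc 0 1) :=
    continuousOn_const.div (by fun_prop) fun s hs => by have := hpos s hs; positivity
  have hderiv : ∀ s ∈ Set.uIcc (0 : ℝ) 1, HasDerivAt
      (fun s : ℝ => s / (b * (s * a + (1 - s) * b))) (1 / (s * a + (1 - s) * b) ^ 2) s := by
    intro s hs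
    rw [Set.uIcc_of_le zero_le_one] at hs
    have h1 := (hpos s hs).ne'
    have h2 : HasDerivAt (fun s : ℝ => b * (s * a + (1 - s) * b)) (b * (a - b)) s := by
      have := (((hasDerivAt_id s).mul_const a).add
        (((hasDerivAt_const s (1 : ℝ)).sub (hasDerivAt_id s)).mul_const b)).const_mul b
      refine this.congr_deriv ?_
      ring
    refine ((hasDerivAt_id s).div h2 (mul_ne_zero hb.ne' h1)).congr_deriv ?_
    simp only [id]
    field_simp
    ring
  have hint := intervalIntegral.integral_eq_sub_of_hasDerivAt hderiv
    ((hcont.mono (by rw [Set.uIcc_of_le zero_le_one])).intervalIntegrable)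
  have hI : IntegrableOn (fun s : ℝ => 1 / (s * a + (1 - s) * b) ^ 2) (Set.Ioo 0 1) :=
    (hcont.integrableOn_Icc).mono_set Set.Ioo_subset_Icc_self
  rw [← ofReal_integral_eq_lintegral_ofReal hI (ae_of_all _ fun s => by positivity),
    ← integral_Ioc_eq_integral_Ioo, ← intervalIntegral.integral_of_le zero_le_one, hint]
  congr 1
  field_simp
  ring

/-- The beta integral `B(1/2, 1/2)`, computed with the antiderivative `arcsin (2 s - 1)`. -/
theorem lintegral_inv_sqrt_mul_one_sub_le :
    ∫⁻ s in Set.Ioo (0 : ℝ) 1, ENNReal.ofReal (1 / √(s * (1 - s))) ≤ ENNReal.ofReal Real.pi := by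
  have hcont : ContinuousOn (fun s : ℝ => Real.arcsin (2 * s - 1)) (Set.Icc 0 1) :=
    (Real.continuous_arcsin.comp (by fun_prop)).continuousOn
  have hderiv : ∀ s ∈ Set.Ioo (0 : ℝ) 1, HasDerivAt (fun s : ℝ => Real.arcsin (2 * s - 1))
      (1 / √(s * (1 - s))) s := by
    rintro s ⟨h0, h1⟩
    have h2 : HasDerivAt (fun s : ℝ => 2 * s - 1) 2 s := by
      simpa using ((hasDerivAt_id s).const_mul 2).sub_const 1
    have h3 := (Real.hasDerivAt_arcsin (x := 2 * s - 1) (by linarith) (by linarith)).comp s h2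
    refine h3.congr_deriv ?_
    have h4 : 1 - (2 * s - 1) ^ 2 = 2 ^ 2 * (s * (1 - s)) := by ring
    rw [h4, Real.sqrt_mul (by positivity), Real.sqrt_sq (by norm_num)]
    have : 0 < √(s * (1 - s)) := Real.sqrt_pos.2 (mul_pos h0 (by linarith))
    field_simp
  have hI := intervalIntegral.integrableOn_deriv_of_nonneg hcont hderiv
    (fun s _ => by positivity)
  rw [← ofReal_integral_eq_lintegral_ofReal (hI.mono_set Set.Ioo_subset_Ioc_self)
    (ae_of_all _ fun s => by positivity), ← integral_Ioc_eq_integral_Ioo,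
    ← intervalIntegral.integral_of_le zero_le_one,
    intervalIntegral.integral_eq_sub_of_hasDerivAt_of_le zero_le_one hcont hderiv
      ((intervalIntegrable_iff_integrableOn_Ioc_of_le zero_le_one).2 hI)]
  refine ENNReal.ofReal_le_ofReal (le_of_eq ?_)
  norm_num

/-- Polar coordinates reduce it to `4π ∫ y² / (y² + M²)² dy`, whose radial integral is `π / (4M)` by
an explicit antiderivative. -/
theorem lintegral_inv_sq_add_sq (c : E3) {M : ℝ} (hM : 0 < M) :
    ∫⁻ q : E3, ENNReal.ofReal (1 / (‖q - c‖ ^ 2 + M ^ 2) ^ 2) =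
      ENNReal.ofReal (Real.pi ^ 2 / M) := by
  have hd : Module.finrank ℝ E3 = 3 := by simp
  have hderiv : ∀ y ∈ Set.Ici (0 : ℝ), HasDerivAt
      (fun y : ℝ => (Real.arctan (y / M) / M - y / (y ^ 2 + M ^ 2)) / 2)
      (y ^ 2 * (1 / (y ^ 2 + M ^ 2) ^ 2)) y := by
    intro y _
    have h0 : y ^ 2 + M ^ 2 ≠ 0 := by positivity
    have h1 := ((Real.hasDerivAt_arctan (y / M)).comp y ((hasDerivAt_id y).div_const M)).div_const M
    have h2 : HasDerivAt (fun y : ℝ => y ^ 2 + M ^ 2) (2 * y) y := by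
      simpa using (hasDerivAt_pow 2 y).add_const (M ^ 2)
    have h3 := (h1.sub ((hasDerivAt_id y).div h2 h0)).div_const 2
    refine h3.congr_deriv ?_
    simp only [id]
    have h4 : 1 + (y / M) ^ 2 ≠ 0 := by positivity
    field_simp
    ring
  have hlim : Tendsto (fun y : ℝ => (Real.arctan (y / M) / M - y / (y ^ 2 + M ^ 2)) / 2) atTop
      (𝓝 ((Real.pi / 2 / M - 0) / 2)) := by
    refine Tendsto.div_const (Tendsto.sub (Tendsto.div_const ?_ M) ?_) 2
    · exact (tendsto_nhds_of_tendsto_nhdsWithin Real.tendsto_arctan_atTop).comp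
        (tendsto_id.atTop_div_const hM)
    · refine squeeze_zero' (eventually_ge_atTop 0 |>.mono fun y hy => by positivity)
        (eventually_gt_atTop 0 |>.mono fun y hy => ?_) tendsto_inv_atTop_zero
      rw [div_le_iff₀ (by positivity)]
      field_simp
      nlinarith [sq_nonneg M]
  have hnn : ∀ y ∈ Set.Ioi (0 : ℝ), 0 ≤ y ^ 2 * (1 / (y ^ 2 + M ^ 2) ^ 2) := fun y _ => by
    positivity
  have hI := integrableOn_Ioi_deriv_of_nonneg' hderiv hnn hlim
  have hint := integral_Ioi_of_hasDerivAt_of_nonneg' hderiv hnn hlim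
  have hI3 : Integrable (fun q : E3 => 1 / (‖q‖ ^ 2 + M ^ 2) ^ 2) :=
    (integrable_fun_norm_addHaar (E := E3) (F := ℝ) volume
      (f := fun y => 1 / (y ^ 2 + M ^ 2) ^ 2)).2 (by rw [hd]; simpa using hI)
  have h3 := integral_fun_norm_addHaar (E := E3) (F := ℝ) volume
    (fun y => 1 / (y ^ 2 + M ^ 2) ^ 2)
  rw [lintegral_sub_right_eq_self (fun q : E3 => ENNReal.ofReal (1 / (‖q‖ ^ 2 + M ^ 2) ^ 2)) c,
    ← ofReal_integral_eq_lintegral_ofReal hI3 (ae_of_all _ fun s => by positivity), h3, hd]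
  congr 1
  simp only [smul_eq_mul, Nat.add_one_sub_one, nsmul_eq_mul]
  rw [hint, Measure.real, EuclideanSpace.volume_ball_fin_three]
  simp
  rw [ENNReal.toReal_ofReal (by positivity)]
  field_simp
  ring

/-- The Schur integral: `∫ dq / (|p - q|² (|q|² + m²)) ≤ π³ / √(|p|² + m²)`. -/
theorem lintegral_schur_le (p : E3) {m : ℝ} (hm : 0 < m) :
    ∫⁻ q : E3, ENNReal.ofReal (1 / (‖p - q‖ ^ 2 * (‖q‖ ^ 2 + m ^ 2))) ≤
      ENNReal.ofReal (Real.pi ^ 3 / √(‖p‖ ^ 2 + m ^ 2)) := by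
  have hF : Measurable fun z : E3 × ℝ => ENNReal.ofReal
      (1 / (z.2 * ‖p - z.1‖ ^ 2 + (1 - z.2) * (‖z.1‖ ^ 2 + m ^ 2)) ^ 2) := by fun_prop
  calc ∫⁻ q : E3, ENNReal.ofReal (1 / (‖p - q‖ ^ 2 * (‖q‖ ^ 2 + m ^ 2)))
      ≤ ∫⁻ q : E3, ∫⁻ s in Set.Ioo (0 : ℝ) 1, ENNReal.ofReal
          (1 / (s * ‖p - q‖ ^ 2 + (1 - s) * (‖q‖ ^ 2 + m ^ 2)) ^ 2) := by
        refine lintegral_mono fun q => ?_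
        -- At `q = p` the left integrand is `1 / 0 = 0`, so no exceptional null set has to be
        -- removed.
        rcases eq_or_ne p q with rfl | hpq
        · simp
        · have : 0 < ‖p - q‖ := norm_pos_iff.2 (sub_ne_zero.2 hpq)
          exact (lintegral_feynman (by positivity) (by positivity)).le
    _ = ∫⁻ s in Set.Ioo (0 : ℝ) 1, ∫⁻ q : E3, ENNReal.ofReal
          (1 / (s * ‖p - q‖ ^ 2 + (1 - s) * (‖q‖ ^ 2 + m ^ 2)) ^ 2) :=
        lintegral_lintegral_swap hF.aemeasurable
    _ ≤ ∫⁻ s in Set.Ioo (0 : ℝ) 1, ENNReal.ofReal (Real.pi ^ 2 / √(‖p‖ ^ 2 + m ^ 2)) *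
          ENNReal.ofReal (1 / √(s * (1 - s))) := by
        refine setLIntegral_mono (by fun_prop) fun s hs => ?_
        obtain ⟨h0, h1⟩ := hs
        have h1' : 0 < 1 - s := by linarith
        have hM : 0 < (1 - s) * (s * ‖p‖ ^ 2 + m ^ 2) := by positivity
        -- Completing the square in `q` about `s p`, after which the integral over `q` is explicit.
        have e : ∀ q : E3, s * ‖p - q‖ ^ 2 + (1 - s) * (‖q‖ ^ 2 + m ^ 2) =
            ‖q - s • p‖ ^ 2 + √((1 - s) * (s * ‖p‖ ^ 2 + m ^ 2)) ^ 2 := by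
          intro q
          rw [Real.sq_sqrt hM.le, @norm_sub_sq_real, @norm_sub_sq_real, norm_smul,
            inner_smul_right, real_inner_comm, mul_pow, Real.norm_eq_abs, sq_abs]
          ring
        simp only [e]
        rw [lintegral_inv_sq_add_sq _ (Real.sqrt_pos.2 hM), ← ENNReal.ofReal_mul (by positivity)]
        refine ENNReal.ofReal_le_ofReal ?_
        rw [div_mul_div_comm, mul_one, ← Real.sqrt_mul (by positivity)]
        -- The only loss: `s |p|² + m²` is replaced by the smaller `s (|p|² + m²)`, so that the
        -- dependence on `s` separates from that on `p`.
        refine div_le_div_of_nonneg_left (by positivity) (Real.sqrt_pos.2 (by positivity))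
          (Real.sqrt_le_sqrt ?_)
        have : 0 ≤ (1 - s) * ((1 - s) * m ^ 2) := by positivity
        nlinarith
    _ ≤ ENNReal.ofReal (Real.pi ^ 2 / √(‖p‖ ^ 2 + m ^ 2)) * ENNReal.ofReal Real.pi := by
        rw [lintegral_const_mul _ (by fun_prop)]
        gcongr
        exact lintegral_inv_sqrt_mul_one_sub_le
    _ = ENNReal.ofReal (Real.pi ^ 3 / √(‖p‖ ^ 2 + m ^ 2)) := by
        rw [← ENNReal.ofReal_mul (by positivity)]
        congr 1
        ring

/-! ### The kernel `|z|⁻²` -/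

/-- The function `|z|⁻²`. -/
def invSq (z : E3) : ℝ := (‖z‖ ^ 2)⁻¹

theorem invSq_nonneg (z : E3) : 0 ≤ invSq z := by unfold invSq; positivity

theorem measurable_invSq : Measurable invSq := by unfold invSq; fun_prop

theorem invSq_neg (z : E3) : invSq (-z) = invSq z := by simp [invSq]

theorem invSq_sub_comm (p q : E3) : invSq (p - q) = invSq (q - p) := by
  rw [← invSq_neg, neg_sub]

theorem lintegral_schur_mul_le (p : E3) {m : ℝ} (hm : 0 < m) :
    ∫⁻ q : E3, ENNReal.ofReal (invSq (p - q) * (‖q‖ ^ 2 + m ^ 2)⁻¹) ≤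
      ENNReal.ofReal (Real.pi ^ 3 / √(‖p‖ ^ 2 + m ^ 2)) := by
  have h := lintegral_schur_le p hm
  simp only [one_div, mul_inv] at h
  exact h

theorem integrable_schur (p : E3) {m : ℝ} (hm : 0 < m) :
    Integrable fun q : E3 => invSq (p - q) * (‖q‖ ^ 2 + m ^ 2)⁻¹ := by
  refine ⟨Measurable.aestronglyMeasurable
    (by have := measurable_invSq; fun_prop), ?_⟩
  rw [hasFiniteIntegral_iff_ofReal
    (ae_of_all _ fun q => mul_nonneg (invSq_nonneg _) (by positivity))]
  exact (lintegral_schur_mul_le p hm).trans_lt ENNReal.ofReal_lt_top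

theorem integral_schur_le (p : E3) {m : ℝ} (hm : 0 < m) (s : Set E3) :
    ∫ q in s, invSq (p - q) * (‖q‖ ^ 2 + m ^ 2)⁻¹ ≤ Real.pi ^ 3 / √(‖p‖ ^ 2 + m ^ 2) := by
  have hn : ∀ q : E3, 0 ≤ invSq (p - q) * (‖q‖ ^ 2 + m ^ 2)⁻¹ := fun q =>
    mul_nonneg (invSq_nonneg _) (by positivity)
  refine (setIntegral_le_integral (integrable_schur p hm) (ae_of_all _ hn)).trans ?_
  rw [integral_eq_lintegral_of_nonneg_ae (ae_of_all _ hn)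
    (integrable_schur p hm).aestronglyMeasurable]
  exact ENNReal.toReal_le_of_le_ofReal (by positivity) (lintegral_schur_mul_le p hm)

/-- On a bounded set the factor `(|q|² + 1)⁻¹` is bounded below, so the Schur integral with mass one
also controls the bare kernel, uniformly in `p`. -/
theorem invSq_le_schur (p : E3) {R : ℝ} {q : E3} (hq : q ∈ Metric.ball (0 : E3) R) :
    invSq (p - q) ≤ (R ^ 2 + 1) * (invSq (p - q) * (‖q‖ ^ 2 + 1 ^ 2)⁻¹) := by
  have h1 : ‖q‖ < R := by simpa using hq
  have h2 : ‖q‖ ^ 2 ≤ R ^ 2 := pow_le_pow_left₀ (norm_nonneg _) h1.le 2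
  have h3 : 1 ≤ (R ^ 2 + 1) * (‖q‖ ^ 2 + 1 ^ 2)⁻¹ := by
    rw [← div_eq_mul_inv, le_div_iff₀ (by positivity)]
    linarith
  nlinarith [invSq_nonneg (p - q)]

theorem integrableOn_invSq (p : E3) (R : ℝ) :
    IntegrableOn (fun q : E3 => invSq (p - q)) (Metric.ball 0 R) := by
  refine Integrable.mono' ((integrable_schur p one_pos).integrableOn.const_mul (R ^ 2 + 1))
    (Measurable.aestronglyMeasurable (by have := measurable_invSq; fun_prop)) ?_
  filter_upwards [ae_restrict_mem measurableSet_ball] with q hq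
  rw [Real.norm_of_nonneg (invSq_nonneg _)]
  exact invSq_le_schur p hq

theorem integral_invSq_le (p : E3) (R : ℝ) :
    ∫ q in Metric.ball (0 : E3) R, invSq (p - q) ≤ (R ^ 2 + 1) * Real.pi ^ 3 := by
  have h1 : ∫ q in Metric.ball (0 : E3) R, invSq (p - q) ≤
      ∫ q in Metric.ball (0 : E3) R, (R ^ 2 + 1) * (invSq (p - q) * (‖q‖ ^ 2 + 1 ^ 2)⁻¹) :=
    setIntegral_mono_on (integrableOn_invSq p R)
      ((integrable_schur p one_pos).integrableOn.const_mul (R ^ 2 + 1)) measurableSet_ball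
      fun q hq => invSq_le_schur p hq
  rw [integral_const_mul] at h1
  refine h1.trans (mul_le_mul_of_nonneg_left ?_ (by positivity))
  refine (integral_schur_le p one_pos _).trans (div_le_self (by positivity) ?_)
  rw [Real.one_le_sqrt]
  nlinarith [sq_nonneg ‖p‖]

theorem integral_invSq_ball {δ : ℝ} (hδ : 0 ≤ δ) :
    ∫ z in Metric.ball (0 : E3) δ, invSq z = 4 * Real.pi * δ := by
  have hd : Module.finrank ℝ E3 = 3 := by simp
  have h1 := integral_fun_norm_addHaar (E := E3) (F := ℝ) volume
    (fun y => (Set.Iio δ).indicator (fun y => (y ^ 2)⁻¹) y)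
  have h2 : ∫ x : E3, (Set.Iio δ).indicator (fun y => (y ^ 2)⁻¹) ‖x‖ =
      ∫ z in Metric.ball (0 : E3) δ, invSq z := by
    rw [← integral_indicator measurableSet_ball]
    refine integral_congr_ae (ae_of_all _ fun z => ?_)
    simp [Set.indicator, invSq]
  have h3 : ∫ y in Set.Ioi (0 : ℝ), y ^ (3 - 1) •
      (Set.Iio δ).indicator (fun y => (y ^ 2)⁻¹) y = δ := by
    have : ∀ y ∈ Set.Ioi (0 : ℝ), y ^ (3 - 1) • (Set.Iio δ).indicator (fun y => (y ^ 2)⁻¹) y =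
        (Set.Iio δ).indicator (fun _ => (1 : ℝ)) y := by
      intro y hy
      have hy0 : y ≠ 0 := (Set.mem_Ioi.1 hy).ne'
      by_cases h : y ∈ Set.Iio δ
      · simp [Set.indicator_of_mem h, hy0]
      · simp [Set.indicator_of_notMem h]
    rw [setIntegral_congr_fun measurableSet_Ioi this, setIntegral_indicator measurableSet_Iio]
    simp [Set.Ioi_inter_Iio, hδ]
  rw [← h2, h1, hd, h3, Measure.real, EuclideanSpace.volume_ball_fin_three]
  simp only [ENNReal.ofReal_one, one_pow, one_mul, smul_eq_mul, nsmul_eq_mul]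
  rw [ENNReal.toReal_ofReal (by positivity)]
  push_cast
  ring

/-- The singular part of the kernel has mass `O(δ)` uniformly in its centre. This isolates the
singularity in the continuity of potentials and in the uniform convergence of their Riemann sums. -/
theorem setIntegral_near_invSq_le (p : E3) {δ : ℝ} (hδ : 0 ≤ δ) (s : Set E3) :
    IntegrableOn (fun q => (Metric.ball p δ).indicator (fun q => invSq (p - q)) q) s ∧
    ∫ q in s, (Metric.ball p δ).indicator (fun q => invSq (p - q)) q ≤ 4 * Real.pi * δ := by
  have e : (fun q : E3 => (Metric.ball p δ).indicator (fun q => invSq (p - q)) q) =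
      fun q : E3 => (Metric.ball (0 : E3) δ).indicator invSq (p - q) := by
    funext q
    simp [Set.indicator, dist_eq_norm, norm_sub_rev q p]
  have hI : Integrable ((Metric.ball (0 : E3) δ).indicator invSq) := by
    rw [integrable_indicator_iff measurableSet_ball]
    have h := integrableOn_invSq 0 δ
    simpa only [zero_sub, invSq_neg] using h
  have hI2 : Integrable (fun q : E3 => (Metric.ball (0 : E3) δ).indicator invSq (p - q)) :=
    hI.comp_sub_left p
  rw [e]
  refine ⟨hI2.integrableOn, (setIntegral_le_integral hI2 (ae_of_all _ fun q =>
    Set.indicator_nonneg (fun z _ => invSq_nonneg z) _)).trans (le_of_eq ?_)⟩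
  rw [integral_sub_left_eq_self (fun z => (Metric.ball (0 : E3) δ).indicator invSq z),
    integral_indicator measurableSet_ball, integral_invSq_ball hδ]

instance instIsFiniteMeasureBall (Λ : ℝ) :
    IsFiniteMeasure ((volume : Measure E3).restrict (Metric.ball 0 Λ)) :=
  ⟨by rw [Measure.restrict_apply_univ]; exact measure_ball_lt_top⟩

section Potential

variable {F : Type*} [NormedAddCommGroup F] [NormedSpace ℝ F]

theorem integrableOn_invSq_smul {Λ M : ℝ} {ψ : E3 → F}
    (hψ : AEStronglyMeasurable ψ (volume.restrict (Metric.ball 0 Λ)))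
    (hM : ∀ᵐ q ∂volume.restrict (Metric.ball (0 : E3) Λ), ‖ψ q‖ ≤ M) (p : E3) :
    IntegrableOn (fun q => invSq (p - q) • ψ q) (Metric.ball 0 Λ) := by
  refine Integrable.mono' ((integrableOn_invSq p Λ).const_mul M)
    ((integrableOn_invSq p Λ).aestronglyMeasurable.smul hψ) ?_
  filter_upwards [hM] with q hq
  rw [norm_smul, Real.norm_of_nonneg (invSq_nonneg _), mul_comm]
  exact mul_le_mul_of_nonneg_right hq (invSq_nonneg _)

/-- Potentials of bounded functions are continuous. -/
theorem continuous_potential {Λ M : ℝ} {ψ : E3 → F}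
    (hψ : AEStronglyMeasurable ψ (volume.restrict (Metric.ball 0 Λ)))
    (hM : ∀ᵐ q ∂volume.restrict (Metric.ball (0 : E3) Λ), ‖ψ q‖ ≤ M) :
    Continuous fun p : E3 => ∫ q in Metric.ball (0 : E3) Λ, invSq (p - q) • ψ q := by
  refine continuous_of_uniform_approx_of_continuous fun u hu => ?_
  obtain ⟨ε, hε, hεu⟩ := Metric.mem_uniformity_dist.1 hu
  have hM' : 0 < |M| + 1 := by positivity
  -- Chosen so that the mass `4πδ` of the kernel near its singularity, times the bound of `ψ`, is `ε
  -- / 2`. The kernel `κ` below is truncated at distance `δ`: it is bounded, continuous, and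
  -- unchanged outside that ball.
  set δ : ℝ := ε / (2 * (4 * Real.pi * (|M| + 1))) with hδ
  have hδ0 : 0 < δ := by positivity
  let κ : E3 → ℝ := fun z => ((max ‖z‖ δ) ^ 2)⁻¹
  have hκpos : ∀ z : E3, 0 < max ‖z‖ δ := fun z => lt_max_of_lt_right hδ0
  have hκc : Continuous κ := by
    refine Continuous.inv₀ (by fun_prop) fun z => ?_
    have := hκpos z
    positivity
  have hκb : ∀ z : E3, ‖κ z‖ ≤ (δ ^ 2)⁻¹ := by
    intro z
    rw [Real.norm_of_nonneg (by positivity)]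
    exact inv_anti₀ (by positivity) (pow_le_pow_left₀ hδ0.le (le_max_right _ _) 2)
  have hψI : IntegrableOn ψ (Metric.ball 0 Λ) :=
    Integrable.mono' (integrable_const M) hψ hM
  have hκI : ∀ p, IntegrableOn (fun q => κ (p - q) • ψ q) (Metric.ball 0 Λ) := fun p =>
    Integrable.bdd_smul (φ := fun q => κ (p - q)) hψI ((δ ^ 2)⁻¹)
      (Continuous.aestronglyMeasurable (by fun_prop)) (ae_of_all _ fun q => hκb _)
  refine ⟨fun p => ∫ q in Metric.ball (0 : E3) Λ, κ (p - q) • ψ q, ?_, fun p => hεu ?_⟩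
  · refine continuous_of_dominated (bound := fun q => (δ ^ 2)⁻¹ * ‖ψ q‖)
      (fun p => (hκI p).aestronglyMeasurable) (fun p => ae_of_all _ fun q => ?_)
      (hψI.norm.const_mul _) (ae_of_all _ fun q => by fun_prop)
    rw [norm_smul]
    exact mul_le_mul_of_nonneg_right (hκb _) (norm_nonneg _)
  · rw [dist_eq_norm, ← integral_sub (integrableOn_invSq_smul hψ hM p) (hκI p)]
    have hnear := setIntegral_near_invSq_le p hδ0.le (Metric.ball 0 Λ)
    have hle : ‖∫ q in Metric.ball (0 : E3) Λ, (invSq (p - q) • ψ q - κ (p - q) • ψ q)‖ ≤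
        ∫ q in Metric.ball (0 : E3) Λ,
          (|M| + 1) * (Metric.ball p δ).indicator (fun q => invSq (p - q)) q := by
      refine norm_integral_le_of_norm_le (hnear.1.const_mul _) ?_
      have hne : ∀ᵐ q ∂volume.restrict (Metric.ball (0 : E3) Λ), q ≠ p :=
        ae_restrict_of_ae (compl_mem_ae_iff.2 (measure_singleton p))
      filter_upwards [hM, hne] with q hq hqne
      rw [← sub_smul, norm_smul]
      have hMM : ‖ψ q‖ ≤ |M| + 1 := hq.trans ((le_abs_self M).trans (by linarith))
      rw [mul_comm]
      refine mul_le_mul hMM ?_ (norm_nonneg _) hM'.le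
      by_cases hqp : q ∈ Metric.ball p δ
      · rw [Set.indicator_of_mem hqp, Real.norm_eq_abs, abs_le]
        have h0 : p - q ≠ 0 := sub_ne_zero.2 hqne.symm
        have h1 : κ (p - q) ≤ invSq (p - q) :=
          inv_anti₀ (by have := norm_pos_iff.2 h0; positivity)
            (pow_le_pow_left₀ (norm_nonneg _) (le_max_left _ _) 2)
        have h2 : 0 ≤ κ (p - q) := by positivity
        constructor <;> linarith
      · have h1 : δ ≤ ‖p - q‖ := by
          simpa [dist_eq_norm, norm_sub_rev q p] using hqp
        rw [Set.indicator_of_notMem hqp]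
        simp [κ, invSq, max_eq_left h1]
    refine hle.trans_lt ?_
    rw [integral_const_mul]
    calc (|M| + 1) * _ ≤ (|M| + 1) * (4 * Real.pi * δ) :=
          mul_le_mul_of_nonneg_left hnear.2 hM'.le
      _ = ε / 2 := by rw [hδ]; field_simp
      _ < ε := by linarith

end Potential

/-! ### Riemann sums over the dual lattice -/

theorem cell_eq_preimage (L : ℝ) : cell L = (MeasurableEquiv.toLp 2 (Fin 3 → ℝ)).symm ⁻¹'
    Set.univ.pi fun _ => Set.Ico (-(L / 2)) (L / 2) := by
  ext x
  simp [cell]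

theorem measurableSet_cell (L : ℝ) : MeasurableSet (cell L) := by
  rw [cell_eq_preimage]
  exact (MeasurableEquiv.measurable _) (MeasurableSet.univ_pi fun _ => measurableSet_Ico)

theorem volume_cell {L : ℝ} (hL : 0 ≤ L) : volume (cell L) = ENNReal.ofReal (L ^ 3) := by
  rw [cell_eq_preimage,
    (EuclideanSpace.volume_preserving_symm_measurableEquiv_toLp (Fin 3)).measure_preimage_equiv,
    Real.volume_pi_Ico]
  simp [ENNReal.ofReal_pow hL]

/-- The point of the lattice `a ℤ³` in whose cell `q` lies. -/
def latticeRound (a : ℝ) (q : E3) : E3 := latticePoint a fun i => ⌊q i / a + 1 / 2⌋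

theorem measurable_latticeRound (a : ℝ) : Measurable (latticeRound a) := by
  unfold latticeRound latticePoint
  refine (PiLp.continuous_toLp 2 (fun _ : Fin 3 => ℝ)).measurable.comp
    (measurable_pi_lambda _ fun i => ?_)
  have h : Measurable fun q : E3 => ⌊q i / a + 1 / 2⌋ := Int.measurable_floor.comp (by fun_prop)
  have h2 : Measurable fun n : ℤ => (n : ℝ) := measurable_from_top
  exact (h2.comp h).const_mul a

theorem latticePoint_apply (a : ℝ) (n : Fin 3 → ℤ) (i : Fin 3) : latticePoint a n i = a * n i := rfl

theorem latticePoint_injective {a : ℝ} (ha : a ≠ 0) : Function.Injective (latticePoint a) := by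
  intro n n' h
  funext i
  have h2 : latticePoint a n i = latticePoint a n' i := by rw [h]
  rw [latticePoint_apply, latticePoint_apply] at h2
  exact_mod_cast mul_left_cancel₀ ha h2

theorem latticePoint_add (a : ℝ) (n n' : Fin 3 → ℤ) :
    latticePoint a (n + n') = latticePoint a n + latticePoint a n' := by
  ext i
  simp [latticePoint_apply, mul_add]

theorem latticePoint_neg (a : ℝ) (n : Fin 3 → ℤ) : latticePoint a (-n) = -latticePoint a n := by
  ext i
  simp [latticePoint_apply]

theorem latticePoint_sub (a : ℝ) (n n' : Fin 3 → ℤ) :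
    latticePoint a (n - n') = latticePoint a n - latticePoint a n' := by
  rw [sub_eq_add_neg, latticePoint_add, latticePoint_neg, ← sub_eq_add_neg]

theorem latticePoint_zero (a : ℝ) : latticePoint a 0 = 0 := by
  ext i
  simp [latticePoint_apply]

theorem latticeRound_eq_iff {a : ℝ} (ha : 0 < a) (q : E3) (n : Fin 3 → ℤ) :
    latticeRound a q = latticePoint a n ↔ q - latticePoint a n ∈ cell a := by
  rw [latticeRound, (latticePoint_injective ha.ne').eq_iff]
  simp only [cell, funext_iff, Set.mem_ofPred_eq, Set.mem_Ico, PiLp.sub_apply, latticePoint_apply,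
    Int.floor_eq_iff]
  refine forall_congr' fun i => and_congr ?_ ?_
  · rw [← sub_le_iff_le_add, le_div_iff₀ ha]
    constructor <;> intro h <;> linarith
  · rw [← lt_sub_iff_add_lt, div_lt_iff₀ ha]
    constructor <;> intro h <;> linarith

theorem latticeRound_add_latticePoint {a : ℝ} (ha : 0 < a) (q : E3) (n : Fin 3 → ℤ) :
    latticeRound a (q + latticePoint a n) = latticeRound a q + latticePoint a n := by
  have h1 : latticeRound a q = latticePoint a fun i => ⌊q i / a + 1 / 2⌋ := rfl
  rw [h1, ← latticePoint_add, latticeRound_eq_iff ha, latticePoint_add, add_sub_add_right_eq_sub,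
    ← latticeRound_eq_iff ha]
  rfl

/-- Each coordinate moves by at most `a / 2`, hence the point by at most `√3 a / 2`. -/
theorem norm_latticeRound_sub_le {a : ℝ} (ha : 0 < a) (q : E3) : ‖latticeRound a q - q‖ ≤ a := by
  have h := (latticeRound_eq_iff ha q (fun i => ⌊q i / a + 1 / 2⌋)).1 rfl
  rw [norm_sub_rev]
  set z := q - latticePoint a (fun i => ⌊q i / a + 1 / 2⌋) with hz
  have h2 : ∀ i, ‖z i‖ ^ 2 ≤ (a / 2) ^ 2 := fun i => by
    rw [Real.norm_eq_abs, sq_abs]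
    exact sq_le_sq' (h i).1 (h i).2.le
  have h3 : ‖z‖ ^ 2 ≤ a ^ 2 := by
    rw [EuclideanSpace.norm_sq_eq, Fin.sum_univ_three]
    nlinarith [h2 0, h2 1, h2 2, sq_nonneg a]
  exact le_of_sq_le_sq h3 ha.le

theorem le_norm_latticePoint {a : ℝ} (ha : 0 < a) {n : Fin 3 → ℤ} (hn : n ≠ 0) :
    a ≤ ‖latticePoint a n‖ := by
  obtain ⟨i, hi⟩ := Function.ne_iff.1 hn
  refine le_trans ?_ (PiLp.norm_apply_le (latticePoint a n) i)
  rw [latticePoint_apply, norm_mul, Real.norm_of_nonneg ha.le]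
  refine le_mul_of_one_le_right ha.le ?_
  rw [Real.norm_eq_abs]
  exact_mod_cast Int.one_le_abs hi

theorem tendsto_latticeRound {l : Filter ℝ} {a : ℝ → ℝ} (ha : Tendsto a l (𝓝 0))
    (ha0 : ∀ᶠ L in l, 0 < a L) (q : E3) : Tendsto (fun L => latticeRound (a L) q) l (𝓝 q) := by
  rw [tendsto_iff_norm_sub_tendsto_zero]
  exact squeeze_zero' (Eventually.of_forall fun _ => norm_nonneg _)
    (ha0.mono fun L hL => norm_latticeRound_sub_le hL q) ha

theorem eventually_dualLattice : (Tendsto (fun L : ℝ => 2 * Real.pi / L) atTop (𝓝 0)) ∧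
    ∀ᶠ L : ℝ in atTop, 0 < L ∧ 0 < 2 * Real.pi / L ∧ 2 * Real.pi / L ≤ 1 := by
  have h : Tendsto (fun L : ℝ => 2 * Real.pi / L) atTop (𝓝 0) :=
    tendsto_const_nhds.div_atTop tendsto_id
  refine ⟨h, ?_⟩
  filter_upwards [eventually_gt_atTop 0, h.eventually (eventually_le_nhds zero_lt_one)] with L h1 h2
  exact ⟨h1, by positivity, h2⟩

/-- The kernel `|z|⁻²` is the `L¹` limit of its step functions. -/
theorem tendsto_integral_invSq_latticeRound (R : ℝ) :
    (∀ᶠ L : ℝ in atTop, IntegrableOn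
      (fun z => invSq (latticeRound (2 * Real.pi / L) z)) (Metric.ball 0 R)) ∧
    Tendsto (fun L : ℝ => ∫ z in Metric.ball (0 : E3) R,
      ‖invSq (latticeRound (2 * Real.pi / L) z) - invSq z‖) atTop (𝓝 0) := by
  obtain ⟨ha, ha0⟩ := eventually_dualLattice
  have hI : IntegrableOn invSq (Metric.ball (0 : E3) R) := by
    have h := integrableOn_invSq 0 R
    simpa only [zero_sub, invSq_neg] using h
  have hmeas : ∀ L : ℝ, Measurable fun z => invSq (latticeRound (2 * Real.pi / L) z) := fun L =>
    measurable_invSq.comp (measurable_latticeRound _)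
  have hdom : ∀ a : ℝ, 0 < a → ∀ z, invSq (latticeRound a z) ≤ 4 * invSq z := by
    intro a ha z
    -- Near the origin the step function takes the default value `invSq 0 = 0`. Elsewhere the
    -- rounded point has norm at least `a` and lies within `a` of `z`, so `|z|` is at most twice its
    -- norm.
    by_cases hn : (fun i => ⌊z i / a + 1 / 2⌋) = (0 : Fin 3 → ℤ)
    · have h0 : latticeRound a z = 0 := by rw [latticeRound, hn, latticePoint_zero]
      rw [h0]
      simp [invSq]
    · have h1 : a ≤ ‖latticeRound a z‖ := le_norm_latticePoint ha hn
      have h2 := norm_latticeRound_sub_le ha z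
      have h3 : ‖z‖ ≤ 2 * ‖latticeRound a z‖ := by
        have h4 := norm_sub_norm_le z (latticeRound a z)
        rw [norm_sub_rev] at h4
        linarith
      rcases eq_or_ne z 0 with rfl | hz
      · exfalso
        apply hn
        funext i
        simp
        norm_num
      · have hz' := norm_pos_iff.2 hz
        have hl : 0 < ‖latticeRound a z‖ := ha.trans_le h1
        unfold invSq
        rw [← div_eq_mul_inv, le_div_iff₀ (by positivity), inv_mul_le_iff₀ (by positivity)]
        nlinarith
  refine ⟨ha0.mono fun L hL => Integrable.mono' (hI.const_mul 4)
    (hmeas L).aestronglyMeasurable (ae_of_all _ fun z => ?_), ?_⟩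
  · rw [Real.norm_of_nonneg (invSq_nonneg _)]
    exact hdom _ hL.2.1 z
  · have hlim := tendsto_integral_filter_of_dominated_convergence
      (μ := (volume : Measure E3).restrict (Metric.ball 0 R)) (l := (atTop : Filter ℝ))
      (F := fun L z => ‖invSq (latticeRound (2 * Real.pi / L) z) - invSq z‖)
      (f := fun _ => (0 : ℝ)) (fun z => 5 * invSq z)
      (Eventually.of_forall fun L => ((hmeas L).sub measurable_invSq).norm.aestronglyMeasurable)
      ?_ (hI.const_mul 5) ?_
    · simpa using hlim
    · filter_upwards [ha0] with L hL
      refine ae_of_all _ fun z => ?_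
      rw [norm_norm, Real.norm_eq_abs, abs_le]
      have h1 := hdom _ hL.2.1 z
      have h2 := invSq_nonneg z
      have h3 := invSq_nonneg (latticeRound (2 * Real.pi / L) z)
      constructor <;> linarith
    · have hne : ∀ᵐ z ∂(volume : Measure E3).restrict (Metric.ball 0 R), z ≠ 0 :=
        ae_restrict_of_ae (compl_mem_ae_iff.2 (measure_singleton 0))
      filter_upwards [hne] with z hz
      have hc : ContinuousAt invSq z := by
        unfold invSq
        exact ContinuousAt.inv₀ (by fun_prop) (by simpa using hz)
      have h1 := ((hc.tendsto.comp (tendsto_latticeRound ha (ha0.mono fun L hL => hL.2.1)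
        z)).sub_const (invSq z)).norm
      simpa using h1

section RiemannSum

variable {F : Type*} [NormedAddCommGroup F] [NormedSpace ℝ F]

omit [NormedSpace ℝ F] in
/-- The step function of a function on the momenta. -/
theorem indicator_latticeRound_eq_sum (L Λ : ℝ) (G : E3 → F) (q : E3) :
    (Metric.ball (0 : E3) Λ).indicator G (latticeRound (2 * Real.pi / L) q) =
      ∑ k : momenta L Λ,
        {q | latticeRound (2 * Real.pi / L) q = k}.indicator (fun _ => G k) q := by
  classical
  by_cases h : latticeRound (2 * Real.pi / L) q ∈ Metric.ball (0 : E3) Λ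
  · have hk : latticeRound (2 * Real.pi / L) q ∈ momenta L Λ := ⟨⟨_, rfl⟩, h⟩
    rw [Set.indicator_of_mem h, Finset.sum_eq_single ⟨_, hk⟩]
    · simp
    · intro l _ hl
      refine Set.indicator_of_notMem (fun h2 => hl ?_) _
      exact Subtype.ext h2.symm
    · simp
  · rw [Set.indicator_of_notMem h]
    refine (Finset.sum_eq_zero fun l _ => Set.indicator_of_notMem (fun h2 => h ?_) _).symm
    have h3 : latticeRound (2 * Real.pi / L) q = l := h2
    rw [h3]
    exact l.2.2

theorem measurableSet_latticeRound_eq (a : ℝ) (k : E3) :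
    MeasurableSet {q | latticeRound a q = k} :=
  measurable_latticeRound a (measurableSet_singleton k)

theorem volume_latticeRound_eq {L Λ : ℝ} (hL : 0 < L) (k : momenta L Λ) :
    volume {q | latticeRound (2 * Real.pi / L) q = k} =
      ENNReal.ofReal ((2 * Real.pi / L) ^ 3) := by
  have ha : 0 < 2 * Real.pi / L := by positivity
  obtain ⟨⟨n, hn⟩, -⟩ := k.2
  have e : {q | latticeRound (2 * Real.pi / L) q = k} =
      (fun q => q - latticePoint (2 * Real.pi / L) n) ⁻¹' cell (2 * Real.pi / L) := by
    ext q
    rw [Set.mem_ofPred_eq, ← hn, latticeRound_eq_iff ha]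
    rfl
  rw [e, ← volume_cell ha.le]
  simp only [sub_eq_add_neg]
  exact measure_preimage_add_right volume _ _

omit [NormedSpace ℝ F] in
theorem integrable_indicator_latticeRound {L : ℝ} (hL : 0 < L) (Λ : ℝ) (G : E3 → F) :
    Integrable fun q =>
      (Metric.ball (0 : E3) Λ).indicator G (latticeRound (2 * Real.pi / L) q) := by
  simp only [indicator_latticeRound_eq_sum]
  refine integrable_finsetSum _ fun k _ => ?_
  rw [integrable_indicator_iff (measurableSet_latticeRound_eq _ _)]
  refine integrableOn_const ?_
  rw [volume_latticeRound_eq hL]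
  exact ENNReal.ofReal_ne_top

/-- A sum over the momenta is exactly the integral of a step function, as each lattice cell has
volume `(2π/L)³`. Limits of such sums become limits under an integral over a fixed space. -/
theorem integral_indicator_latticeRound [CompleteSpace F] {L : ℝ} (hL : 0 < L) (Λ : ℝ)
    (G : E3 → F) :
    ∫ q, (Metric.ball (0 : E3) Λ).indicator G (latticeRound (2 * Real.pi / L) q) =
      (2 * Real.pi / L) ^ 3 • ∑ k : momenta L Λ, G k := by
  simp only [indicator_latticeRound_eq_sum]
  rw [integral_finsetSum, Finset.smul_sum]
  · refine Finset.sum_congr rfl fun k _ => ?_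
    rw [integral_indicator_const _ (measurableSet_latticeRound_eq _ _), Measure.real,
      volume_latticeRound_eq hL, ENNReal.toReal_ofReal (by positivity)]
  · intro k _
    rw [integrable_indicator_iff (measurableSet_latticeRound_eq _ _)]
    refine integrableOn_const ?_
    rw [volume_latticeRound_eq hL]
    exact ENNReal.ofReal_ne_top

omit [NormedSpace ℝ F] in
/-- The step functions of a bounded function which is continuous on the ball converge in `L¹`. -/
theorem tendsto_integral_norm_latticeRound_sub {Λ M : ℝ} {ψ : E3 → F}
    (hψ : ContinuousOn ψ (Metric.ball 0 Λ)) (hM : ∀ q ∈ Metric.ball (0 : E3) Λ, ‖ψ q‖ ≤ M) :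
    Tendsto (fun L : ℝ => ∫ q, ‖(Metric.ball (0 : E3) Λ).indicator ψ
        (latticeRound (2 * Real.pi / L) q) - (Metric.ball (0 : E3) Λ).indicator ψ q‖)
      atTop (𝓝 0) := by
  obtain ⟨ha, ha0⟩ := eventually_dualLattice
  have hMabs : ∀ q, ‖(Metric.ball (0 : E3) Λ).indicator ψ q‖ ≤ |M| := fun q => by
    by_cases h : q ∈ Metric.ball (0 : E3) Λ
    · rw [Set.indicator_of_mem h]; exact (hM q h).trans (le_abs_self M)
    · rw [Set.indicator_of_notMem h]; simp
  have hlim := tendsto_integral_filter_of_dominated_convergence (μ := (volume : Measure E3))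
    (l := (atTop : Filter ℝ))
    (F := fun L q => ‖(Metric.ball (0 : E3) Λ).indicator ψ
        (latticeRound (2 * Real.pi / L) q) - (Metric.ball (0 : E3) Λ).indicator ψ q‖)
    (f := fun _ => (0 : ℝ))
    -- For large `L` rounding moves points by at most one, so the difference vanishes outside the
    -- enlarged ball.
    ((Metric.ball (0 : E3) (Λ + 1)).indicator fun _ => 2 * |M|) ?_ ?_ ?_ ?_
  · simpa using hlim
  · filter_upwards [ha0] with L hL
    exact ((integrable_indicator_latticeRound hL.1 Λ ψ).aestronglyMeasurable.sub
      ((aestronglyMeasurable_indicator_iff measurableSet_ball).2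
        (hψ.aestronglyMeasurable measurableSet_ball))).norm
  · filter_upwards [ha0] with L hL
    refine ae_of_all _ fun q => ?_
    rw [norm_norm]
    by_cases hq : q ∈ Metric.ball (0 : E3) (Λ + 1)
    · rw [Set.indicator_of_mem hq]
      have h1 := hMabs (latticeRound (2 * Real.pi / L) q)
      have h2 := hMabs q
      exact (norm_sub_le _ _).trans (by linarith)
    · rw [Set.indicator_of_notMem hq]
      have h1 : Λ + 1 ≤ ‖q‖ := by simpa using hq
      have h2 : q ∉ Metric.ball (0 : E3) Λ := by simp; linarith
      have h3 : latticeRound (2 * Real.pi / L) q ∉ Metric.ball (0 : E3) Λ := by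
        have h4 := norm_latticeRound_sub_le hL.2.1 q
        have h5 := norm_sub_norm_le q (latticeRound (2 * Real.pi / L) q)
        rw [norm_sub_rev] at h5
        simp only [Metric.mem_ball, dist_zero_right, not_lt]
        linarith [hL.2.2]
      rw [Set.indicator_of_notMem h2, Set.indicator_of_notMem h3]
      simp
  · rw [integrable_indicator_iff measurableSet_ball]
    exact integrableOn_const measure_ball_lt_top.ne
  -- Off the sphere, which is null, the extension of `ψ` by zero is continuous and the step
  -- functions converge pointwise.
  · have hs : ∀ᵐ q : E3, q ∉ Metric.sphere (0 : E3) Λ := by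
      rcases eq_or_ne Λ 0 with rfl | hΛ
      · rw [Metric.sphere_zero]
        exact compl_mem_ae_iff.2 (measure_singleton (0 : E3))
      · exact compl_mem_ae_iff.2 (Measure.addHaar_sphere_of_ne_zero _ _ hΛ)
    filter_upwards [hs] with q hq
    have ht := tendsto_latticeRound ha (ha0.mono fun L hL => hL.2.1) q
    have hc : ContinuousAt ((Metric.ball (0 : E3) Λ).indicator ψ) q := by
      rcases lt_trichotomy ‖q‖ Λ with h | h | h
      · have hmem : Metric.ball (0 : E3) Λ ∈ 𝓝 q := Metric.isOpen_ball.mem_nhds (by simpa using h)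
        refine (hψ.continuousAt hmem).congr ?_
        filter_upwards [hmem] with x hx
        rw [Set.indicator_of_mem hx]
      · exact absurd (by simpa using h) hq
      · have hmem : (Metric.closedBall (0 : E3) Λ)ᶜ ∈ 𝓝 q :=
          Metric.isClosed_closedBall.isOpen_compl.mem_nhds (by simpa using h)
        refine (continuousAt_const (y := (0 : F))).congr ?_
        filter_upwards [hmem] with x hx
        rw [Set.indicator_of_notMem fun h2 => hx (Metric.ball_subset_closedBall h2)]
    have h1 := ((hc.tendsto.comp ht).sub_const ((Metric.ball (0 : E3) Λ).indicator ψ q)).norm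
    simpa using h1

/-- Riemann sums converge. -/
theorem tendsto_riemannSum [CompleteSpace F] {Λ M : ℝ} {ψ : E3 → F}
    (hψ : ContinuousOn ψ (Metric.ball 0 Λ)) (hM : ∀ q ∈ Metric.ball (0 : E3) Λ, ‖ψ q‖ ≤ M) :
    Tendsto (fun L : ℝ => (2 * Real.pi / L) ^ 3 • ∑ k : momenta L Λ, ψ k) atTop
      (𝓝 (∫ q in Metric.ball (0 : E3) Λ, ψ q)) := by
  rw [tendsto_iff_norm_sub_tendsto_zero]
  obtain ⟨ha, ha0⟩ := eventually_dualLattice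
  have hψI : IntegrableOn ψ (Metric.ball 0 Λ) := Integrable.mono' (integrable_const M)
    (hψ.aestronglyMeasurable measurableSet_ball)
    ((ae_restrict_mem measurableSet_ball).mono fun q hq => hM q hq)
  refine squeeze_zero' (Eventually.of_forall fun _ => norm_nonneg _) ?_
    (tendsto_integral_norm_latticeRound_sub hψ hM)
  filter_upwards [ha0] with L hL
  rw [← integral_indicator_latticeRound hL.1, ← integral_indicator measurableSet_ball,
    ← integral_sub (integrable_indicator_latticeRound hL.1 Λ ψ)
      ((integrable_indicator_iff measurableSet_ball).2 hψI)]
  exact norm_integral_le_integral_norm _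

/-- Riemann sums of potentials converge uniformly on the momenta. -/
theorem eventually_riemannSum_potential [CompleteSpace F] {Λ M : ℝ} {ψ : E3 → F}
    (hψ : ContinuousOn ψ (Metric.ball 0 Λ)) (hM : ∀ q ∈ Metric.ball (0 : E3) Λ, ‖ψ q‖ ≤ M)
    {ε : ℝ} (hε : 0 < ε) :
    ∀ᶠ L : ℝ in atTop, ∀ k : momenta L Λ,
      ‖(2 * Real.pi / L) ^ 3 • ∑ l : momenta L Λ, invSq ((k : E3) - l) • ψ l -
        ∫ q in Metric.ball (0 : E3) Λ, invSq ((k : E3) - q) • ψ q‖ ≤ ε := by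
  obtain ⟨-, ha0⟩ := eventually_dualLattice
  -- Two points of the ball differ by less than `2Λ`; the extra one absorbs the displacement by
  -- rounding.
  obtain ⟨hκI, hκ⟩ := tendsto_integral_invSq_latticeRound (2 * Λ + 1)
  set B : Set E3 := Metric.ball 0 Λ with hB
  have hψm := hψ.aestronglyMeasurable measurableSet_ball (μ := volume)
  have hMae : ∀ᵐ q ∂(volume : Measure E3).restrict B, ‖ψ q‖ ≤ M :=
    (ae_restrict_mem measurableSet_ball).mono fun q hq => hM q hq
  have hψI : IntegrableOn ψ B := Integrable.mono' (integrable_const M) hψm hMae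
  have hM1 : 0 < |M| + 1 := by positivity
  -- The near part contributes `2 (|M| + 1) * 4πδ = ε / 3`; the two other errors are made smaller
  -- than `ε / 3` by taking `L` large.
  set δ : ℝ := ε / (6 * ((|M| + 1) * (4 * Real.pi))) with hδ
  have hδ0 : 0 < δ := by positivity
  have hψb : ∀ q : E3, ‖B.indicator ψ q‖ ≤ |M| + 1 := fun q => by
    by_cases h : q ∈ B
    · rw [Set.indicator_of_mem h]; exact (hM q h).trans ((le_abs_self M).trans (by linarith))
    · rw [Set.indicator_of_notMem h]; simpa using hM1.le
  have e1 := (hκ.const_mul (|M| + 1)).eventually_lt_const (u := ε / 3) (by simpa using hε)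
  have e2 := ((tendsto_integral_norm_latticeRound_sub hψ hM).const_mul ((δ ^ 2)⁻¹)).eventually_lt_const
    (u := ε / 3) (by simpa using hε)
  filter_upwards [ha0, hκI, e1, e2] with L hL hκIL h1 h2 k
  set a : ℝ := 2 * Real.pi / L with ha
  obtain ⟨⟨n, hn⟩, hkB⟩ := k.2
  set k₀ : E3 := k.1 with hk₀
  have hn' : latticePoint a n = k₀ := hn
  -- Rounding commutes with lattice translations, so the error in the kernel is a translate by `k₀`
  -- of one fixed function. This is the source of uniformity in the momentum.
  have hround : ∀ q, latticeRound a (q - k₀) = latticeRound a q - k₀ := fun q => by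
    rw [← hn', sub_eq_add_neg, ← latticePoint_neg, latticeRound_add_latticePoint hL.2.1,
      latticePoint_neg, ← sub_eq_add_neg]
  have hS : a ^ 3 • ∑ l : momenta L Λ, invSq (k₀ - l) • ψ l =
      ∫ q, B.indicator (fun q => invSq (k₀ - q) • ψ q) (latticeRound a q) :=
    (integral_indicator_latticeRound hL.1 Λ fun q => invSq (k₀ - q) • ψ q).symm
  have hT : ∫ q in B, invSq (k₀ - q) • ψ q = ∫ q, B.indicator (fun q => invSq (k₀ - q) • ψ q) q :=
    (integral_indicator measurableSet_ball).symm
  have hIS := integrable_indicator_latticeRound hL.1 Λ fun q => invSq (k₀ - q) • ψ q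
  have hIT : Integrable (B.indicator (fun q => invSq (k₀ - q) • ψ q)) :=
    (integrable_indicator_iff measurableSet_ball).2 (integrableOn_invSq_smul hψm hMae k₀)
  have hIψ : Integrable fun q => ‖B.indicator ψ (latticeRound a q) - B.indicator ψ q‖ :=
    ((integrable_indicator_latticeRound hL.1 Λ ψ).sub
      ((integrable_indicator_iff measurableSet_ball).2 hψI)).norm
  let g : E3 → ℝ := (Metric.ball (0 : E3) (2 * Λ + 1)).indicator
    fun z => ‖invSq (latticeRound a z) - invSq z‖
  have hgI : Integrable g := by
    rw [integrable_indicator_iff measurableSet_ball]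
    have hI : IntegrableOn invSq (Metric.ball (0 : E3) (2 * Λ + 1)) := by
      have h := integrableOn_invSq 0 (2 * Λ + 1)
      simpa only [zero_sub, invSq_neg] using h
    exact (hκIL.sub hI).norm
  -- near part of the second difference, with singular kernel
  let u : E3 → ℝ := (Metric.ball k₀ δ).indicator fun q => invSq (k₀ - q)
  have hu := setIntegral_near_invSq_le k₀ hδ0.le Set.univ
  rw [setIntegral_univ, integrableOn_univ] at hu
  have hpt : ∀ q, ‖B.indicator (fun q => invSq (k₀ - q) • ψ q) (latticeRound a q) -
      B.indicator (fun q => invSq (k₀ - q) • ψ q) q‖ ≤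
      (|M| + 1) * g (q - k₀) + (2 * (|M| + 1) * u q +
        (δ ^ 2)⁻¹ * ‖B.indicator ψ (latticeRound a q) - B.indicator ψ q‖) := by
    intro q
    -- The error of the kernel multiplies the step function of `ψ`; the error of `ψ` multiplies the
    -- exact kernel, which is then split at distance `δ` from the singularity.
    have hsplit : B.indicator (fun q => invSq (k₀ - q) • ψ q) (latticeRound a q) -
        B.indicator (fun q => invSq (k₀ - q) • ψ q) q =
        (invSq (latticeRound a q - k₀) - invSq (q - k₀)) • B.indicator ψ (latticeRound a q) +
          invSq (q - k₀) • (B.indicator ψ (latticeRound a q) - B.indicator ψ q) := by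
      rw [Set.indicator_smul_apply, Set.indicator_smul_apply, invSq_sub_comm k₀,
        invSq_sub_comm k₀]
      module
    rw [hsplit]
    refine (norm_add_le _ _).trans (add_le_add ?_ ?_)
    · rw [norm_smul]
      by_cases hq : latticeRound a q ∈ B
      · have hmem : q - k₀ ∈ Metric.ball (0 : E3) (2 * Λ + 1) := by
          have h3 := norm_latticeRound_sub_le hL.2.1 q
          have h4 : ‖latticeRound a q‖ < Λ := by simpa [hB] using hq
          have h5 : ‖k₀‖ < Λ := by simpa using hkB
          have h6 : q - k₀ = latticeRound a q - (latticeRound a q - q) - k₀ := by abel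
          rw [mem_ball_zero_iff, h6]
          have h7 := norm_sub_le (latticeRound a q - (latticeRound a q - q)) k₀
          have h8 := norm_sub_le (latticeRound a q) (latticeRound a q - q)
          linarith [hL.2.2]
        simp only [g]
        rw [Set.indicator_of_mem hmem, hround, mul_comm]
        exact mul_le_mul_of_nonneg_right (hψb _) (norm_nonneg _)
      · rw [Set.indicator_of_notMem hq, norm_zero, mul_zero]
        exact mul_nonneg hM1.le (Set.indicator_nonneg (fun _ _ => norm_nonneg _) _)
    · rw [norm_smul, Real.norm_of_nonneg (invSq_nonneg _)]
      have h3 : ‖B.indicator ψ (latticeRound a q) - B.indicator ψ q‖ ≤ 2 * (|M| + 1) :=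
        (norm_sub_le _ _).trans (by linarith [hψb q, hψb (latticeRound a q)])
      by_cases hq : q ∈ Metric.ball k₀ δ
      · simp only [u]
        rw [Set.indicator_of_mem hq, invSq_sub_comm k₀, mul_comm (2 * (|M| + 1))]
        have h4 := mul_le_mul_of_nonneg_left h3 (invSq_nonneg (q - k₀))
        have h5 : 0 ≤ (δ ^ 2)⁻¹ * ‖B.indicator ψ (latticeRound a q) - B.indicator ψ q‖ := by
          positivity
        linarith
      · simp only [u]
        rw [Set.indicator_of_notMem hq, mul_zero, zero_add]
        refine mul_le_mul_of_nonneg_right ?_ (norm_nonneg _)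
        have h4 : δ ≤ ‖q - k₀‖ := by simpa [dist_eq_norm] using hq
        exact inv_anti₀ (by positivity) (pow_le_pow_left₀ hδ0.le h4 2)
  rw [hS, hT, ← integral_sub hIS hIT]
  have hI1 : Integrable fun q => (|M| + 1) * g (q - k₀) := (hgI.comp_sub_right k₀).const_mul _
  have hI2 : Integrable fun q => 2 * (|M| + 1) * u q := hu.1.const_mul _
  have hI3 := hIψ.const_mul ((δ ^ 2)⁻¹)
  refine (norm_integral_le_of_norm_le (hI1.add (hI2.add hI3)) (ae_of_all _ hpt)).trans ?_
  have hsum : ∫ q, ((fun q => (|M| + 1) * g (q - k₀)) + ((fun q => 2 * (|M| + 1) * u q) +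
        fun q => (δ ^ 2)⁻¹ * ‖B.indicator ψ (latticeRound a q) - B.indicator ψ q‖)) q =
      (|M| + 1) * (∫ z in Metric.ball (0 : E3) (2 * Λ + 1),
        ‖invSq (latticeRound a z) - invSq z‖) + (2 * (|M| + 1) * (∫ q, u q) +
        (δ ^ 2)⁻¹ * ∫ q, ‖B.indicator ψ (latticeRound a q) - B.indicator ψ q‖) := by
    rw [integral_add' hI1 (hI2.add hI3), integral_add' hI2 hI3, integral_const_mul,
      integral_const_mul, integral_const_mul, integral_sub_right_eq_self g,
      integral_indicator measurableSet_ball]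
  rw [hsum]
  have h4 : 2 * (|M| + 1) * ∫ q, u q ≤ ε / 3 := by
    refine (mul_le_mul_of_nonneg_left hu.2 (by positivity)).trans (le_of_eq ?_)
    rw [hδ]
    field_simp
    norm_num
  linarith

end RiemannSum

/-! ### The self-consistent equation in the whole space -/

/-- The reflection of the `i`-th coordinate. -/
def reflect (i : Fin 3) : E3 ≃ₗᵢ[ℝ] E3 :=
  LinearIsometryEquiv.piLpCongrRight 2 fun j =>
    if j = i then LinearIsometryEquiv.neg ℝ else LinearIsometryEquiv.refl ℝ ℝ

theorem reflect_apply (i : Fin 3) (q : E3) (j : Fin 3) :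
    reflect i q j = if j = i then -q j else q j := by
  simp only [reflect, LinearIsometryEquiv.piLpCongrRight_apply]
  split_ifs <;> rfl

theorem reflect_reflect (i : Fin 3) (q : E3) : reflect i (reflect i q) = q := by
  ext j
  simp only [reflect_apply]
  split_ifs <;> simp

theorem diracVec_reflect (m : ℝ) (i : Fin 3) (p : E3) :
    IsReflected i (diracVec m p) (diracVec m (reflect i p)) := by
  intro j
  fin_cases i <;> fin_cases j <;> simp [diracVec, reflect_apply]

theorem diracVec_castSucc (m : ℝ) (p : E3) (i : Fin 3) : diracVec m p i.castSucc = p i := by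
  fin_cases i <;> simp [diracVec]

theorem continuous_diracVec (m : ℝ) : Continuous (diracVec m) := by
  unfold diracVec
  refine (PiLp.continuous_toLp 2 (fun _ : Fin 4 => ℝ)).comp (continuous_pi fun j => ?_)
  fin_cases j <;> simp <;> fun_prop

theorem norm_diracVec (m : ℝ) (p : E3) : ‖diracVec m p‖ = √(‖p‖ ^ 2 + m ^ 2) := by
  rw [EuclideanSpace.norm_eq, EuclideanSpace.norm_sq_eq]
  simp [diracVec, Fin.sum_univ_four, Fin.sum_univ_three]

/-- The weight of the Schur test. -/
def weight (Λ m : ℝ) (q : E3) : ℝ := (min (‖q‖ ^ 2) (Λ ^ 2) + m ^ 2)⁻¹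

/-- Inside the ball the truncation in `weight` is inactive and the weight is `|X|⁻²`. Outside it
keeps the weight bounded below, as required because the mean-field equation is posed at every point
of the space. -/
theorem weight_of_mem {Λ m : ℝ} {q : E3} (hq : q ∈ Metric.ball (0 : E3) Λ) :
    weight Λ m q = (‖q‖ ^ 2 + m ^ 2)⁻¹ := by
  have h1 : ‖q‖ < Λ := by simpa using hq
  rw [weight, min_eq_left (pow_le_pow_left₀ (norm_nonneg _) h1.le 2)]

theorem weight_denom_pos (Λ : ℝ) {m : ℝ} (hm : 0 < m) (q : E3) :
    0 < min (‖q‖ ^ 2) (Λ ^ 2) + m ^ 2 := by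
  have : 0 ≤ min (‖q‖ ^ 2) (Λ ^ 2) := le_min (by positivity) (by positivity)
  positivity

theorem weight_pos (Λ : ℝ) {m : ℝ} (hm : 0 < m) (q : E3) : 0 < weight Λ m q :=
  inv_pos.2 (weight_denom_pos Λ hm q)

theorem weight_ge (Λ : ℝ) {m : ℝ} (hm : 0 < m) (q : E3) : (Λ ^ 2 + m ^ 2)⁻¹ ≤ weight Λ m q :=
  inv_anti₀ (weight_denom_pos Λ hm q) (by linarith [min_le_right (‖q‖ ^ 2) (Λ ^ 2)])

theorem weight_le (Λ : ℝ) {m : ℝ} (hm : 0 < m) (q : E3) : weight Λ m q ≤ (m ^ 2)⁻¹ :=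
  inv_anti₀ (by positivity) (by
    have : 0 ≤ min (‖q‖ ^ 2) (Λ ^ 2) := le_min (by positivity) (by positivity)
    linarith)

theorem continuous_weight (Λ : ℝ) {m : ℝ} (hm : 0 < m) : Continuous (weight Λ m) :=
  Continuous.inv₀ (by fun_prop) fun q => (weight_denom_pos Λ hm q).ne'

/-- Converts the Schur bound, which decays like `|X|⁻¹`, into the form `|X| h`. It is an equality in
the ball, and truncation only enlarges the right side elsewhere. -/
theorem inv_norm_diracVec_le (Λ : ℝ) {m : ℝ} (hm : 0 < m) (p : E3) :
    ‖diracVec m p‖⁻¹ ≤ ‖diracVec m p‖ * weight Λ m p := by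
  have h0 : 0 < ‖p‖ ^ 2 + m ^ 2 := by positivity
  have h1 : 0 < ‖diracVec m p‖ := by rw [norm_diracVec]; exact Real.sqrt_pos.2 h0
  rw [inv_le_iff_one_le_mul₀' h1, ← mul_assoc, ← pow_two, norm_diracVec, Real.sq_sqrt h0.le, weight,
    ← div_eq_mul_inv, one_le_div (weight_denom_pos Λ hm p)]
  linarith [min_le_left (‖p‖ ^ 2) (Λ ^ 2)]

/-- `|p - r q|² - |p - q|² = 4 p_i q_i`. Distinct points are needed because `invSq 0 = 0` would
reverse the comparison. -/
theorem invSq_sub_reflect {i : Fin 3} {p q : E3} (hpq : p ≠ q) (h : 0 ≤ p i * q i) :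
    invSq (p - reflect i q) ≤ invSq (p - q) := by
  have h0 : 0 < ‖p - q‖ := norm_pos_iff.2 (sub_ne_zero.2 hpq)
  refine inv_anti₀ (by positivity) ?_
  rw [EuclideanSpace.norm_sq_eq, EuclideanSpace.norm_sq_eq]
  refine Finset.sum_le_sum fun j _ => ?_
  simp only [PiLp.sub_apply, reflect_apply, Real.norm_eq_abs, sq_abs]
  split_ifs with hj
  · subst hj
    nlinarith
  · exact le_rfl

theorem setIntegral_reflect (i : Fin 3) (Λ : ℝ) (f : E3 → ℝ) :
    ∫ q in Metric.ball (0 : E3) Λ, f (reflect i q) = ∫ q in Metric.ball (0 : E3) Λ, f q := by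
  have h := (reflect i).measurePreserving.setIntegral_preimage_emb
    (reflect i).toHomeomorph.measurableEmbedding f (Metric.ball 0 Λ)
  rwa [LinearIsometryEquiv.preimage_ball, map_zero] at h

/-- The contraction factor is the kernel constant times the Schur constant, `α / (4π²) * π³ = α π /
4`. Only the measure is restricted to the ball; `p` ranges over the whole space, which makes the
solution continuous everywhere. -/
theorem isMeanField_ball {α Λ m : ℝ} (hα : 0 ≤ α) (hm : 0 < m) (hΛ : 0 < Λ) :
    IsMeanField (volume.restrict (Metric.ball (0 : E3) Λ))
      (fun p q => α / (4 * Real.pi ^ 2) * invSq (p - q)) (diracVec m) (fun i => reflect i)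
      (weight Λ m) (α * Real.pi / 4) m (Λ ^ 2 + m ^ 2)⁻¹ (m ^ 2)⁻¹ where
  m_pos := hm
  c_pos := by positivity
  θ_nonneg := by positivity
  X_cont := continuous_diracVec m
  X_ge p := by simp [diracVec]
  X_r i p := diracVec_reflect m i p
  r_invol i p := reflect_reflect i p
  integral_r i f := setIntegral_reflect i Λ f
  K_nonneg p q := mul_nonneg (by positivity) (invSq_nonneg _)
  K_r i p q := by
    rw [← map_sub, invSq, LinearIsometryEquiv.norm_map, invSq]
  K_le i p := by
    -- The two points where a kernel takes its default value at the singularity are discarded.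
    have hne : ∀ᵐ q ∂(volume : Measure E3).restrict (Metric.ball 0 Λ), q ≠ p ∧ q ≠ reflect i p :=
      ae_restrict_of_ae (Filter.Eventually.and (compl_mem_ae_iff.2 (measure_singleton p))
        (compl_mem_ae_iff.2 (measure_singleton (reflect i p))))
    filter_upwards [hne] with q hq
    have ha : 0 ≤ α / (4 * Real.pi ^ 2) := by positivity
    rw [diracVec_castSucc, diracVec_castSucc]
    refine ⟨fun h => mul_le_mul_of_nonneg_left (invSq_sub_reflect hq.1.symm h) ha,
      fun h => mul_le_mul_of_nonneg_left ?_ ha⟩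
    have h1 := invSq_sub_reflect (i := i) (p := p) (q := reflect i q)
      (fun h2 => hq.2 (by rw [h2, reflect_reflect])) (by simp [reflect_apply]; linarith)
    rwa [reflect_reflect] at h1
  pot_cont g M hg hM := by
    simp only [mul_smul, integral_smul]
    exact (continuous_const (y := α / (4 * Real.pi ^ 2))).smul
      (continuous_potential hg.aestronglyMeasurable (ae_of_all _ hM))
  smul_int g M hg hM p := by
    simp only [mul_smul]
    exact Integrable.fun_smul _
      (integrableOn_invSq_smul hg.aestronglyMeasurable (ae_of_all _ hM) p)
  h_cont := continuous_weight Λ hm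
  h_ge := weight_ge Λ hm
  h_le := weight_le Λ hm
  schur_int p := by
    simp only [mul_assoc]
    refine Integrable.const_mul ?_ _
    simpa only [smul_eq_mul, IntegrableOn] using integrableOn_invSq_smul (ψ := weight Λ m) (M := (m ^ 2)⁻¹)
      (continuous_weight Λ hm).aestronglyMeasurable (ae_of_all _ fun q => by
        rw [Real.norm_of_nonneg (weight_pos Λ hm q).le]; exact weight_le Λ hm q) p
  schur p := by
    have h1 : ∫ q in Metric.ball (0 : E3) Λ, α / (4 * Real.pi ^ 2) * invSq (p - q) * weight Λ m q =
        α / (4 * Real.pi ^ 2) *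
          ∫ q in Metric.ball (0 : E3) Λ, invSq (p - q) * (‖q‖ ^ 2 + m ^ 2)⁻¹ := by
      rw [← integral_const_mul]
      refine setIntegral_congr_fun measurableSet_ball fun q hq => ?_
      simp only [weight_of_mem hq, mul_assoc]
    rw [h1]
    calc _ ≤ α / (4 * Real.pi ^ 2) * (Real.pi ^ 3 / √(‖p‖ ^ 2 + m ^ 2)) :=
          mul_le_mul_of_nonneg_left (integral_schur_le p hm _) (by positivity)
      _ = α * Real.pi / 4 * ‖diracVec m p‖⁻¹ := by
          rw [norm_diracVec]
          have : 0 < √(‖p‖ ^ 2 + m ^ 2) := Real.sqrt_pos.2 (by positivity)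
          field_simp
      _ ≤ α * Real.pi / 4 * ‖diracVec m p‖ * weight Λ m p := by
          rw [mul_assoc (α * Real.pi / 4)]
          exact mul_le_mul_of_nonneg_left (inv_norm_diracVec_le Λ hm p) (by positivity)

/-! ### The minimizer in the whole space -/

theorem norm_entry_le_of_state {n : Type*} [Fintype n] [DecidableEq n] {A : Matrix n n ℂ}
    (h1 : (A + (1 / 2 : ℂ) • (1 : Matrix n n ℂ)).PosSemidef)
    (h2 : ((1 / 2 : ℂ) • (1 : Matrix n n ℂ) - A).PosSemidef) (i : n) :
    ∑ j, ‖(A + (1 / 2 : ℂ) • (1 : Matrix n n ℂ)) i j‖ ^ 2 ≤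
      ((A + (1 / 2 : ℂ) • (1 : Matrix n n ℂ)) i i).re := by
  refine sum_norm_sq_row_le h1 ?_ i
  have e : 1 - (A + (1 / 2 : ℂ) • (1 : Matrix n n ℂ)) = (1 / 2 : ℂ) • (1 : Matrix n n ℂ) - A := by
    module
  rwa [e]

theorem hsNormSq_le_of_state {A : M4} (h1 : (A + (1 / 2 : ℂ) • (1 : M4)).PosSemidef)
    (h2 : ((1 / 2 : ℂ) • (1 : M4) - A).PosSemidef) :
    hsNormSq (A + (1 / 2 : ℂ) • (1 : M4)) ≤ 4 := by
  set R := A + (1 / 2 : ℂ) • (1 : M4) with hR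
  have h := norm_entry_le_of_state h1 h2
  rw [← hR] at h
  have hd : ∀ i, (R i i).re ≤ 1 := by
    intro i
    have h3 : ‖R i i‖ ^ 2 ≤ ∑ j, ‖R i j‖ ^ 2 :=
      Finset.single_le_sum (f := fun j => ‖R i j‖ ^ 2) (fun j _ => sq_nonneg _) (Finset.mem_univ i)
    have h4 := Complex.re_le_norm (R i i)
    nlinarith [h i, norm_nonneg (R i i)]
  calc hsNormSq R ≤ ∑ _i : Fin 4, (1 : ℝ) := Finset.sum_le_sum fun i _ => (h i).trans (hd i)
    _ = 4 := by simp

theorem hsNormSq_sub_le (A B : M4) : hsNormSq (A - B) ≤ 2 * hsNormSq A + 2 * hsNormSq B := by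
  have h : ∀ a b : ℂ, ‖a - b‖ ^ 2 ≤ 2 * ‖a‖ ^ 2 + 2 * ‖b‖ ^ 2 := fun a b => by
    have := norm_sub_le a b
    nlinarith [sq_nonneg (‖a‖ - ‖b‖), norm_nonneg (a - b)]
  simp only [hsNormSq, Finset.mul_sum, ← Finset.sum_add_distrib]
  exact Finset.sum_le_sum fun _ _ => Finset.sum_le_sum fun _ _ => h _ _

theorem abs_trace_mul_re_le (A B : M4) {t : ℝ} (ht : 0 < t) :
    |(A * B).trace.re| ≤ (t * hsNormSq A + t⁻¹ * hsNormSq B) / 2 := by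
  have h : ∀ a b : ℂ, |(a * b).re| ≤ (t * ‖a‖ ^ 2 + t⁻¹ * ‖b‖ ^ 2) / 2 := by
    intro a b
    refine (Complex.abs_re_le_norm _).trans ?_
    rw [norm_mul]
    have h1 : (t * ‖a‖ ^ 2 + t⁻¹ * ‖b‖ ^ 2) / 2 - ‖a‖ * ‖b‖ = t⁻¹ * (t * ‖a‖ - ‖b‖) ^ 2 / 2 := by
      field_simp
      ring
    have h2 : 0 ≤ t⁻¹ * (t * ‖a‖ - ‖b‖) ^ 2 / 2 := by positivity
    linarith
  have e : hsNormSq B = ∑ σ, ∑ τ, ‖B τ σ‖ ^ 2 := Finset.sum_comm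
  rw [e]
  simp only [hsNormSq, Matrix.trace, Matrix.diag_apply, Matrix.mul_apply, Complex.re_sum,
    Finset.mul_sum, ← Finset.sum_add_distrib, Finset.sum_div]
  refine (Finset.abs_sum_le_sum_abs _ _).trans (Finset.sum_le_sum fun σ _ => ?_)
  exact (Finset.abs_sum_le_sum_abs _ _).trans (Finset.sum_le_sum fun τ _ => h _ _)

theorem integrable_invSq_prod (Λ : ℝ) : Integrable (fun z : E3 × E3 => invSq (z.1 - z.2))
    ((volume.restrict (Metric.ball 0 Λ)).prod (volume.restrict (Metric.ball 0 Λ))) := by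
  have hm : Measurable fun z : E3 × E3 => invSq (z.1 - z.2) := by
    have := measurable_invSq
    fun_prop
  rw [integrable_prod_iff hm.aestronglyMeasurable]
  refine ⟨ae_of_all _ fun p => integrableOn_invSq p Λ, ?_⟩
  refine Integrable.mono' (integrable_const ((Λ ^ 2 + 1) * Real.pi ^ 3))
    hm.norm.aestronglyMeasurable.integral_prod_right' (ae_of_all _ fun p => ?_)
  simp only [Real.norm_of_nonneg (invSq_nonneg _)]
  rw [Real.norm_of_nonneg (integral_nonneg fun q => invSq_nonneg _)]
  exact integral_invSq_le p Λ

/-! ### Integrability and Schur's test for the exchange energy -/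

section Pairing

variable {Λ M M' : ℝ} {f g : E3 → M4}

theorem aestronglyMeasurable_hsNormSq {μ : Measure E3} (hf : AEStronglyMeasurable f μ) :
    AEStronglyMeasurable (fun p => hsNormSq (f p)) μ := by
  have h : Continuous hsNormSq := by unfold hsNormSq; fun_prop
  exact h.comp_aestronglyMeasurable hf

/-- The exchange integrand of two bounded symbols is integrable. -/
theorem integrable_exchange
    (hf : AEStronglyMeasurable f (volume.restrict (Metric.ball 0 Λ)))
    (hg : AEStronglyMeasurable g (volume.restrict (Metric.ball 0 Λ)))
    (hfM : ∀ᵐ p ∂volume.restrict (Metric.ball (0 : E3) Λ), hsNormSq (f p) ≤ M)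
    (hgM : ∀ᵐ p ∂volume.restrict (Metric.ball (0 : E3) Λ), hsNormSq (g p) ≤ M') :
    Integrable (fun z : E3 × E3 => (f z.1 * g z.2).trace.re * invSq (z.1 - z.2))
      ((volume.restrict (Metric.ball 0 Λ)).prod (volume.restrict (Metric.ball 0 Λ))) := by
  have hc : Continuous fun z : M4 × M4 => (z.1 * z.2).trace.re := by
    simp only [Matrix.trace, Matrix.diag_apply, Matrix.mul_apply]
    fun_prop
  have hm : AEStronglyMeasurable (fun z : E3 × E3 => (f z.1 * g z.2).trace.re)
      ((volume.restrict (Metric.ball 0 Λ)).prod (volume.restrict (Metric.ball 0 Λ))) := by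
    have h1 : AEStronglyMeasurable (fun z : E3 × E3 => (f z.1, g z.2))
        ((volume.restrict (Metric.ball 0 Λ)).prod (volume.restrict (Metric.ball 0 Λ))) :=
      hf.comp_fst.prodMk hg.comp_snd
    have h2 := hc.comp_aestronglyMeasurable h1
    exact h2
  refine (integrable_invSq_prod Λ).bdd_mul (c := (M + M') / 2) hm ?_
  have h1 := Measure.quasiMeasurePreserving_fst (μ := volume.restrict (Metric.ball (0 : E3) Λ))
    (ν := volume.restrict (Metric.ball (0 : E3) Λ)) |>.ae hfM
  have h2 := Measure.quasiMeasurePreserving_snd (μ := volume.restrict (Metric.ball (0 : E3) Λ))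
    (ν := volume.restrict (Metric.ball (0 : E3) Λ)) |>.ae hgM
  filter_upwards [h1, h2] with z hz1 hz2
  have h3 := abs_trace_mul_re_le (f z.1) (g z.2) one_pos
  rw [Real.norm_eq_abs]
  refine h3.trans ?_
  rw [inv_one]
  linarith

/-- Schur's test for the exchange energy. -/
theorem exchange_le {α m : ℝ} (hα : 0 ≤ α) (hm : 0 < m) (hΛ : 0 < Λ)
    (hf : AEStronglyMeasurable f (volume.restrict (Metric.ball 0 Λ)))
    (hfM : ∀ᵐ p ∂volume.restrict (Metric.ball (0 : E3) Λ), hsNormSq (f p) ≤ M) :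
    α / (4 * Real.pi ^ 2) * ∫ z : E3 × E3, (f z.1 * f z.2).trace.re * invSq (z.1 - z.2)
      ∂(volume.restrict (Metric.ball 0 Λ)).prod (volume.restrict (Metric.ball 0 Λ)) ≤
    α * Real.pi / 4 * ∫ p in Metric.ball (0 : E3) Λ, ‖diracVec m p‖ * hsNormSq (f p) := by
  set ν : Measure E3 := volume.restrict (Metric.ball 0 Λ) with hν
  have H := isMeanField_ball hα hm hΛ
  have hh := continuous_weight Λ hm
  have hw : Continuous fun z : E3 × E3 => weight Λ m z.2 / weight Λ m z.1 :=
    (hh.comp continuous_snd).div (hh.comp continuous_fst) fun z => (weight_pos Λ hm z.1).ne'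
  have hwb : ∀ z : E3 × E3, weight Λ m z.2 / weight Λ m z.1 ≤ (m ^ 2)⁻¹ * (Λ ^ 2 + m ^ 2) := by
    intro z
    rw [div_eq_mul_inv]
    refine mul_le_mul (weight_le Λ hm _) ?_ (inv_pos.2 (weight_pos Λ hm _)).le (by positivity)
    rw [inv_le_comm₀ (weight_pos Λ hm _) (by positivity)]
    exact weight_ge Λ hm _
  -- the first half of the Schur bound; the other one is its reflection
  let G : E3 × E3 → ℝ := fun z =>
    (hsNormSq (f z.1) * (weight Λ m z.2 / weight Λ m z.1)) * invSq (z.1 - z.2)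
  have hGI : Integrable G (ν.prod ν) := by
    refine (integrable_invSq_prod Λ).bdd_mul (c := M * ((m ^ 2)⁻¹ * (Λ ^ 2 + m ^ 2)))
      ((aestronglyMeasurable_hsNormSq hf).comp_fst.mul hw.aestronglyMeasurable) ?_
    have h1 := Measure.quasiMeasurePreserving_fst (μ := ν) (ν := ν) |>.ae hfM
    filter_upwards [h1] with z hz
    have h0 : 0 ≤ weight Λ m z.2 / weight Λ m z.1 :=
      div_nonneg (weight_pos Λ hm _).le (weight_pos Λ hm _).le
    rw [Real.norm_of_nonneg (mul_nonneg (hsNormSq_nonneg _) h0)]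
    exact mul_le_mul hz (hwb z) h0 ((hsNormSq_nonneg _).trans hz)
  have hGIs : Integrable (fun z => G z.swap) (ν.prod ν) := hGI.swap
  have hGs : ∫ z, G z.swap ∂ν.prod ν = ∫ z, G z ∂ν.prod ν := integral_prod_swap G
  have h1 : ∫ z : E3 × E3, (f z.1 * f z.2).trace.re * invSq (z.1 - z.2) ∂ν.prod ν ≤
      ∫ z, (G z + G z.swap) / 2 ∂ν.prod ν := by
    refine integral_mono (integrable_exchange hf hf hfM hfM)
      ((hGI.add hGIs).div_const 2) fun z => ?_
    -- Young's inequality with the ratio of weights as parameter; its two halves are exchanged by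
    -- swapping the variables.
    have h0 : 0 < weight Λ m z.2 / weight Λ m z.1 :=
      div_pos (weight_pos Λ hm _) (weight_pos Λ hm _)
    have h2 := (le_abs_self _).trans (abs_trace_mul_re_le (f z.1) (f z.2) h0)
    have h3 := mul_le_mul_of_nonneg_right h2 (invSq_nonneg (z.1 - z.2))
    refine h3.trans (le_of_eq ?_)
    simp only [G, Prod.fst_swap, Prod.snd_swap, invSq_sub_comm z.2 z.1, inv_div]
    ring
  have h2 : ∫ z, (G z + G z.swap) / 2 ∂ν.prod ν = ∫ z, G z ∂ν.prod ν := by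
    rw [integral_div, integral_add hGI hGIs, hGs]
    ring
  rw [h2] at h1
  rw [integral_prod _ hGI] at h1
  have hXb : ∀ᵐ p ∂ν, ‖‖diracVec m p‖ * hsNormSq (f p)‖ ≤ √(Λ ^ 2 + m ^ 2) * M := by
    filter_upwards [ae_restrict_mem measurableSet_ball, hfM] with p hp hpM
    rw [Real.norm_of_nonneg (mul_nonneg (norm_nonneg _) (hsNormSq_nonneg _)), norm_diracVec]
    have h3 : ‖p‖ < Λ := by simpa using hp
    refine mul_le_mul (Real.sqrt_le_sqrt ?_) hpM (hsNormSq_nonneg _) (Real.sqrt_nonneg _)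
    have := pow_le_pow_left₀ (norm_nonneg _) h3.le 2
    linarith
  have hXI : Integrable (fun p => ‖diracVec m p‖ * hsNormSq (f p)) ν :=
    Integrable.mono' (integrable_const _)
      ((continuous_diracVec m).norm.aestronglyMeasurable.mul (aestronglyMeasurable_hsNormSq hf)) hXb
  calc _ ≤ α / (4 * Real.pi ^ 2) * ∫ p, ∫ q, G (p, q) ∂ν ∂ν :=
        mul_le_mul_of_nonneg_left h1 (by positivity)
    _ = ∫ p, α / (4 * Real.pi ^ 2) * ∫ q, G (p, q) ∂ν ∂ν := (integral_const_mul _ _).symm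
    _ ≤ ∫ p, α * Real.pi / 4 * (‖diracVec m p‖ * hsNormSq (f p)) ∂ν := by
        refine integral_mono (hGI.integral_prod_left.const_mul _) (hXI.const_mul _) fun p => ?_
        have h3 := H.schur p
        have hwp := weight_pos Λ hm p
        have e : α / (4 * Real.pi ^ 2) * ∫ q, G (p, q) ∂ν = hsNormSq (f p) / weight Λ m p *
            ∫ q, α / (4 * Real.pi ^ 2) * invSq (p - q) * weight Λ m q ∂ν := by
          rw [← integral_const_mul, ← integral_const_mul]
          refine integral_congr_ae (ae_of_all _ fun q => ?_)
          simp only [G]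
          ring
        simp only
        rw [e]
        refine (mul_le_mul_of_nonneg_left h3
          (div_nonneg (hsNormSq_nonneg _) hwp.le)).trans (le_of_eq ?_)
        field_simp
    _ = _ := integral_const_mul _ _

end Pairing

/-! ### Pairings with Clifford matrices and the second order expansion -/

/-- The functional `v ↦ Re tr (A cliff v)`. -/
def cliffPairing (A : M4) : E4 →L[ℝ] ℝ := LinearMap.toContinuousLinearMap
  { toFun := fun v => (A * cliff v).trace.re
    map_add' := fun v w => by simp [mul_add, Matrix.trace_add]
    map_smul' := fun c v => by simp [Matrix.trace_smul] }

theorem cliffPairing_apply (A : M4) (v : E4) : cliffPairing A v = (A * cliff v).trace.re := rfl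

theorem trace_mul_spinState (A : M4) (v : E4) :
    (A * spinState v).trace.re = -(1 / 2) * cliffPairing A v := by
  rw [cliffPairing_apply, spinState, mul_smul_comm, Matrix.trace_smul, smul_eq_mul,
    Complex.mul_re]
  simp

theorem trace_spinState_mul (v w : E4) :
    (spinState v * spinState w).trace.re = inner ℝ v w := by
  rw [trace_mul_spinState, cliffPairing_apply, spinState, smul_mul_assoc, Matrix.trace_smul,
    trace_cliff_mul, smul_eq_mul, Complex.mul_re]
  simp
  ring

theorem hsNormSq_spinState (v : E4) : hsNormSq (spinState v) = ‖v‖ ^ 2 := by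
  rw [hsNormSq_eq_trace, (spinState_isHermitian v).eq, trace_spinState_mul,
    real_inner_self_eq_norm_sq]

theorem continuous_spinState : Continuous spinState := by
  have h : spinState = fun v => (-(1 / 2) : ℂ) • LinearMap.toContinuousLinearMap cliff v := rfl
  rw [h]
  exact (LinearMap.toContinuousLinearMap cliff).continuous.const_smul (-(1 / 2) : ℂ)

instance instPseudoMetrizableSpaceM4 : TopologicalSpace.PseudoMetrizableSpace M4 :=
  inferInstanceAs (TopologicalSpace.PseudoMetrizableSpace (Fin 4 → Fin 4 → ℂ))

section

variable {α Λ m : ℝ} {f g : E3 → M4} {M : ℝ}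

theorem integrable_trace_D0 (hf : AEStronglyMeasurable f (volume.restrict (Metric.ball 0 Λ)))
    (hfM : ∀ᵐ p ∂volume.restrict (Metric.ball (0 : E3) Λ), hsNormSq (f p) ≤ M) {v : E3 → E4}
    (hv : Continuous v) {C : ℝ} (hC : ∀ p ∈ Metric.ball (0 : E3) Λ, ‖v p‖ ≤ C) :
    IntegrableOn (fun p => cliffPairing (f p) (v p)) (Metric.ball 0 Λ) := by
  have hc : Continuous fun z : M4 × M4 => (z.1 * z.2).trace.re := by
    simp only [Matrix.trace, Matrix.diag_apply, Matrix.mul_apply]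
    fun_prop
  have hcl : Continuous fun p => cliff (v p) :=
    (LinearMap.toContinuousLinearMap cliff).continuous.comp hv
  have h1 : AEStronglyMeasurable (fun p => (f p, cliff (v p)))
      (volume.restrict (Metric.ball 0 Λ)) := hf.prodMk hcl.aestronglyMeasurable
  have h2 := hc.comp_aestronglyMeasurable h1
  refine Integrable.mono' (integrable_const ((M + 4 * C ^ 2) / 2)) h2 ?_
  filter_upwards [hfM, ae_restrict_mem measurableSet_ball] with p hp hpB
  have h3 := abs_trace_mul_re_le (f p) (cliff (v p)) one_pos
  have h4 : hsNormSq (cliff (v p)) = 4 * ‖v p‖ ^ 2 := by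
    rw [hsNormSq_eq_trace, (cliff_isHermitian _).eq, trace_cliff_mul, real_inner_self_eq_norm_sq,
      Complex.ofReal_re]
  rw [h4, inv_one] at h3
  have h5 := pow_le_pow_left₀ (norm_nonneg _) (hC p hpB) 2
  rw [Real.norm_eq_abs, cliffPairing_apply]
  linarith

/-- Factoring out `(2π)⁻³` from `(2π)⁻⁵` leaves `1 / (4π²)`, the constant of the mean-field kernel,
and the iterated exchange integral becomes one over the product. -/
theorem energyPerVolume_eq (hf : AEStronglyMeasurable f (volume.restrict (Metric.ball 0 Λ)))
    (hfM : ∀ᵐ p ∂volume.restrict (Metric.ball (0 : E3) Λ), hsNormSq (f p) ≤ M) :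
    energyPerVolume α m Λ f = ((2 * Real.pi) ^ 3)⁻¹ *
      ((∫ p in Metric.ball (0 : E3) Λ, cliffPairing (f p) (diracVec m p)) -
        α / (4 * Real.pi ^ 2) * ∫ z : E3 × E3, (f z.1 * f z.2).trace.re * invSq (z.1 - z.2)
          ∂(volume.restrict (Metric.ball 0 Λ)).prod (volume.restrict (Metric.ball 0 Λ))) := by
  rw [integral_prod _ (integrable_exchange hf hf hfM hfM), energyPerVolume, mul_sub]
  congr 1
  · congr 1
    refine integral_congr_ae (ae_of_all _ fun p => ?_)
    simp only
    rw [cliffPairing_apply, Matrix.trace_mul_comm, D0_eq_cliff]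
  · simp only [div_eq_mul_inv, invSq]
    rw [← mul_assoc]
    congr 1
    field_simp
    norm_num

/-- Second order expansion of the energy per volume at a solution of the self-consistent
equation. -/
theorem energyPerVolume_sub_ge (hα : 0 ≤ α) (hm : 0 < m) (hΛ : 0 < Λ) {N : E3 → E4}
    (hN : IsMeanField.Cone (diracVec m) (fun i => reflect i) N)
    (hfix : ∀ p, N p = ‖IsMeanField.field (volume.restrict (Metric.ball 0 Λ))
      (fun p q => α / (4 * Real.pi ^ 2) * invSq (p - q)) (diracVec m) N p‖⁻¹ •
        IsMeanField.field (volume.restrict (Metric.ball 0 Λ))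
      (fun p q => α / (4 * Real.pi ^ 2) * invSq (p - q)) (diracVec m) N p)
    (hg : g ∈ freeStates Λ) :
    IntegrableOn (fun p => ‖diracVec m p‖ * hsNormSq (g p - spinState (N p))) (Metric.ball 0 Λ) ∧
    ((2 * Real.pi) ^ 3)⁻¹ * ((1 - α * Real.pi / 4) * ∫ p in Metric.ball (0 : E3) Λ,
        ‖diracVec m p‖ * hsNormSq (g p - spinState (N p))) ≤
      energyPerVolume α m Λ g - energyPerVolume α m Λ (fun p => spinState (N p)) := by
  have H := isMeanField_ball hα hm hΛ
  set ν : Measure E3 := volume.restrict (Metric.ball 0 Λ) with hν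
  set K : E3 → E3 → ℝ := fun p q => α / (4 * Real.pi ^ 2) * invSq (p - q) with hK
  set Y := IsMeanField.field ν K (diracVec m) N with hY
  have hYpos := H.field_pos hN
  have hN1 : ∀ p, ‖N p‖ = 1 := fun p => by
    rw [hfix p, norm_smul, norm_inv, norm_norm, inv_mul_cancel₀ (hYpos p).ne']
  have hYN : ∀ p, Y p = ‖Y p‖ • N p := fun p => by
    rw [hfix p, smul_inv_smul₀ (hYpos p).ne']
  have hYc : Continuous Y := H.continuous_field hN
  let f : E3 → M4 := fun p => spinState (N p)
  have hfc : Continuous f := continuous_spinState.comp hN.cont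
  have hfm : AEStronglyMeasurable f ν := hfc.aestronglyMeasurable
  have hfM : ∀ᵐ p ∂ν, hsNormSq (f p) ≤ 1 := ae_of_all _ fun p => by
    simp only [f]
    rw [hsNormSq_spinState, hN1 p]
    norm_num
  have hhalf : hsNormSq ((1 / 2 : ℂ) • (1 : M4)) = 1 := by
    simp [hsNormSq, Matrix.smul_apply, Matrix.one_apply, Fin.sum_univ_four]
    norm_num
  obtain ⟨hgm, hgs⟩ := hg
  -- The numerical bounds here and below serve integrability only.
  have hgM : ∀ᵐ p ∂ν, hsNormSq (g p) ≤ 10 := by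
    filter_upwards [hgs] with p hp
    have h1 := hsNormSq_le_of_state hp.2.1 hp.2.2
    have h2 := hsNormSq_sub_le (g p + (1 / 2 : ℂ) • (1 : M4)) ((1 / 2 : ℂ) • (1 : M4))
    rw [add_sub_cancel_right, hhalf] at h2
    linarith
  let Q : E3 → M4 := fun p => g p - f p
  have hQm : AEStronglyMeasurable Q ν := hgm.sub hfm
  have hQM : ∀ᵐ p ∂ν, hsNormSq (Q p) ≤ 22 := by
    filter_upwards [hgM, hfM] with p h1 h2
    have h3 := hsNormSq_sub_le (g p) (f p)
    simp only [Q]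
    linarith
  -- pointwise lower bound
  have hlow : ∀ᵐ p ∂ν, ‖diracVec m p‖ * hsNormSq (Q p) ≤ cliffPairing (Q p) (Y p) := by
    filter_upwards [hgs] with p hp
    have h1 := hsNormSq_add_le_trace_cliff_mul (hN1 p) (g p + (1 / 2 : ℂ) • (1 : M4)) 0 (by
      rw [add_zero]
      have h2 := norm_entry_le_of_state hp.2.1 hp.2.2
      simp only [hsNormSq, Matrix.trace, Matrix.diag_apply, Complex.re_sum]
      exact Finset.sum_le_sum fun i _ => h2 i)
    rw [add_sub_add_right_eq_sub, add_zero, Matrix.trace_mul_comm] at h1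
    have h3 : hsNormSq (Q p) ≤ cliffPairing (Q p) (N p) := h1
    rw [hYN p, map_smul, smul_eq_mul]
    exact mul_le_mul (H.norm_le_norm_field hN p) h3 (hsNormSq_nonneg _) (norm_nonneg _)
  have hXb : ∀ p ∈ Metric.ball (0 : E3) Λ, ‖diracVec m p‖ ≤ √(Λ ^ 2 + m ^ 2) := by
    intro p hp
    have h3 : ‖p‖ < Λ := by simpa using hp
    rw [norm_diracVec]
    have := pow_le_pow_left₀ (norm_nonneg _) h3.le 2
    exact Real.sqrt_le_sqrt (by linarith)
  have hYb : ∃ C, ∀ p ∈ Metric.ball (0 : E3) Λ, ‖Y p‖ ≤ C := by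
    obtain ⟨C, hC⟩ := (isCompact_closedBall (0 : E3) Λ).exists_bound_of_continuousOn
      hYc.continuousOn
    exact ⟨C, fun p hp => hC p (Metric.ball_subset_closedBall hp)⟩
  obtain ⟨CY, hCY⟩ := hYb
  have hXI : IntegrableOn (fun p => ‖diracVec m p‖ * hsNormSq (Q p)) (Metric.ball 0 Λ) := by
    refine Integrable.mono' (integrable_const (√(Λ ^ 2 + m ^ 2) * 22))
      ((continuous_diracVec m).norm.aestronglyMeasurable.mul (aestronglyMeasurable_hsNormSq hQm)) ?_
    filter_upwards [ae_restrict_mem measurableSet_ball, hQM] with p hp hpM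
    rw [Real.norm_of_nonneg (mul_nonneg (norm_nonneg _) (hsNormSq_nonneg _))]
    exact mul_le_mul (hXb p hp) hpM (hsNormSq_nonneg _) (Real.sqrt_nonneg _)
  refine ⟨hXI, ?_⟩
  have hIQY : IntegrableOn (fun p => cliffPairing (Q p) (Y p)) (Metric.ball 0 Λ) :=
    integrable_trace_D0 hQm hQM hYc hCY
  have hIQX := integrable_trace_D0 hQm hQM (continuous_diracVec m) hXb
  have hIfX := integrable_trace_D0 hfm hfM (continuous_diracVec m) hXb
  -- expansion of the exchange term
  have eQQ := integrable_exchange hQm hQm hQM hQM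
  have eQf := integrable_exchange hQm hfm hQM hfM
  have eff := integrable_exchange hfm hfm hfM hfM
  have efQ : ∫ z : E3 × E3, (f z.1 * Q z.2).trace.re * invSq (z.1 - z.2) ∂ν.prod ν =
      ∫ z : E3 × E3, (Q z.1 * f z.2).trace.re * invSq (z.1 - z.2) ∂ν.prod ν := by
    rw [← integral_prod_swap]
    refine integral_congr_ae (ae_of_all _ fun z => ?_)
    simp only [Prod.fst_swap, Prod.snd_swap]
    rw [Matrix.trace_mul_comm, invSq_sub_comm]
  have efQI := integrable_exchange hfm hQm hfM hQM
  have hexp : ∫ z : E3 × E3, (g z.1 * g z.2).trace.re * invSq (z.1 - z.2) ∂ν.prod ν =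
      (∫ z : E3 × E3, (f z.1 * f z.2).trace.re * invSq (z.1 - z.2) ∂ν.prod ν) +
      2 * (∫ z : E3 × E3, (Q z.1 * f z.2).trace.re * invSq (z.1 - z.2) ∂ν.prod ν) +
      ∫ z : E3 × E3, (Q z.1 * Q z.2).trace.re * invSq (z.1 - z.2) ∂ν.prod ν := by
    have h1 : ∀ z : E3 × E3, (g z.1 * g z.2).trace.re * invSq (z.1 - z.2) =
        ((f z.1 * f z.2).trace.re * invSq (z.1 - z.2) +
          (f z.1 * Q z.2).trace.re * invSq (z.1 - z.2)) +
        ((Q z.1 * f z.2).trace.re * invSq (z.1 - z.2) +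
          (Q z.1 * Q z.2).trace.re * invSq (z.1 - z.2)) := by
      intro z
      have h2 : g z.1 * g z.2 = f z.1 * f z.2 + f z.1 * Q z.2 + (Q z.1 * f z.2 + Q z.1 * Q z.2) := by
        simp only [Q]
        noncomm_ring
      rw [h2]
      simp only [Matrix.trace_add, Complex.add_re]
      ring
    simp only [h1]
    rw [integral_add (eff.fun_add efQI) (eQf.fun_add eQQ), integral_add eff efQI, integral_add eQf eQQ, efQ]
    ring
  -- The cross term of the exchange energy is `-(1/2)` times the pairing with the potential `Y - X`.
  -- Doubled and subtracted, it completes the pairing with `X` to the pairing with `Y`.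
  have hcross : α / (4 * Real.pi ^ 2) *
      ∫ z : E3 × E3, (Q z.1 * f z.2).trace.re * invSq (z.1 - z.2) ∂ν.prod ν =
      -(1 / 2) * ∫ p, cliffPairing (Q p) (Y p - diracVec m p) ∂ν := by
    rw [integral_prod _ eQf, ← integral_const_mul, ← integral_const_mul]
    refine integral_congr_ae (ae_of_all _ fun p => ?_)
    simp only [hY, IsMeanField.field, add_sub_cancel_left]
    rw [← (cliffPairing (Q p)).integral_comp_comm (H.smul_int N 1 hN.cont hN.le_one p),
      ← integral_const_mul, ← integral_const_mul]
    refine integral_congr_ae (ae_of_all _ fun q => ?_)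
    simp only [f, trace_mul_spinState, map_smul, smul_eq_mul, hK]
    ring
  have hlinY : ∫ p, cliffPairing (Q p) (Y p - diracVec m p) ∂ν =
      ∫ p, cliffPairing (Q p) (Y p) ∂ν - ∫ p, cliffPairing (Q p) (diracVec m p) ∂ν := by
    simp only [map_sub]
    exact integral_sub hIQY hIQX
  have hlin : ∫ p, cliffPairing (g p) (diracVec m p) ∂ν =
      ∫ p, cliffPairing (f p) (diracVec m p) ∂ν + ∫ p, cliffPairing (Q p) (diracVec m p) ∂ν := by
    rw [← integral_add hIfX hIQX]
    refine integral_congr_ae (ae_of_all _ fun p => ?_)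
    simp only [cliffPairing_apply, Q, sub_mul, Matrix.trace_sub, Complex.sub_re]
    ring
  have hex := exchange_le hα hm hΛ hQm hQM
  rw [← hν] at hex
  have hlow2 := integral_mono_ae hXI hIQY hlow
  rw [energyPerVolume_eq hgm hgM, energyPerVolume_eq (f := fun p => spinState (N p)) hfm hfM,
    ← mul_sub]
  refine mul_le_mul_of_nonneg_left ?_ (by positivity)
  rw [← hν, hexp, hlin]
  rw [hlinY] at hcross
  have hlow3 : ∫ p, ‖diracVec m p‖ * hsNormSq (Q p) ∂ν ≤ ∫ p, cliffPairing (Q p) (Y p) ∂ν := hlow2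
  simp only [Q, f] at *
  linarith

/-- Since `1 - θ > 0`, the expansion gives minimality. At another minimizer the weighted square
distance must have zero integral, and `|X| ≥ m` turns this into equality almost everywhere. -/
theorem isFreeVacuum_of_solution (hα : 0 ≤ α) (hα1 : α < 4 / Real.pi) (hm : 0 < m) (hΛ : 0 < Λ)
    {N : E3 → E4}
    (hN : IsMeanField.Cone (diracVec m) (fun i => reflect i) N)
    (hfix : ∀ p, N p = ‖IsMeanField.field (volume.restrict (Metric.ball 0 Λ))
      (fun p q => α / (4 * Real.pi ^ 2) * invSq (p - q)) (diracVec m) N p‖⁻¹ •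
        IsMeanField.field (volume.restrict (Metric.ball 0 Λ))
      (fun p q => α / (4 * Real.pi ^ 2) * invSq (p - q)) (diracVec m) N p) :
    IsFreeVacuum α m Λ fun p => spinState (N p) := by
  have H := isMeanField_ball hα hm hΛ
  have hN1 : ∀ p, ‖N p‖ = 1 := fun p => by
    rw [hfix p, norm_smul, norm_inv, norm_norm, inv_mul_cancel₀ (H.field_pos hN p).ne']
  have hθ : 0 < 1 - α * Real.pi / 4 := by
    rw [lt_div_iff₀ Real.pi_pos] at hα1
    linarith
  have hc : 0 < ((2 * Real.pi) ^ 3)⁻¹ := by positivity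
  have hnn : ∀ g : E3 → M4, 0 ≤ ∫ p in Metric.ball (0 : E3) Λ,
      ‖diracVec m p‖ * hsNormSq (g p - spinState (N p)) := fun g =>
    integral_nonneg fun p => mul_nonneg (norm_nonneg _) (hsNormSq_nonneg _)
  have hcont : Continuous fun p => spinState (N p) := continuous_spinState.comp hN.cont
  have hmem : (fun p => spinState (N p)) ∈ freeStates Λ := by
    refine ⟨hcont.aestronglyMeasurable, ae_of_all _ fun p => ?_⟩
    have h := state_of_isStarProjection (spinState_isStarProjection (hN1 p))
    rwa [add_sub_cancel_right] at h
  refine ⟨hmem, hcont.continuousOn, fun g hg => ?_, fun g hg hmin => ?_⟩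
  · have h := (energyPerVolume_sub_ge hα hm hΛ hN hfix hg).2
    have h2 : 0 ≤ ((2 * Real.pi) ^ 3)⁻¹ * ((1 - α * Real.pi / 4) *
        ∫ p in Metric.ball (0 : E3) Λ, ‖diracVec m p‖ * hsNormSq (g p - spinState (N p))) :=
      mul_nonneg hc.le (mul_nonneg hθ.le (hnn g))
    exact sub_nonneg.1 (h2.trans h)
  · obtain ⟨hI, h⟩ := energyPerVolume_sub_ge hα hm hΛ hN hfix hg
    have h1 : energyPerVolume α m Λ g ≤ energyPerVolume α m Λ (fun p => spinState (N p)) :=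
      hmin hmem
    have h2 : ∫ p in Metric.ball (0 : E3) Λ,
        ‖diracVec m p‖ * hsNormSq (g p - spinState (N p)) = 0 := by
      refine le_antisymm ?_ (hnn g)
      by_contra! hpos
      have := mul_pos hc (mul_pos hθ hpos)
      linarith
    rw [integral_eq_zero_iff_of_nonneg (fun p => mul_nonneg (norm_nonneg _) (hsNormSq_nonneg _))
      hI] at h2
    filter_upwards [h2] with p hp
    have hX : 0 < ‖diracVec m p‖ := H.m_pos.trans_le (H.le_norm_X p)
    have h3 : hsNormSq (g p - spinState (N p)) = 0 :=
      (mul_eq_zero.1 hp).resolve_left hX.ne'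
    ext σ τ
    rw [hsNormSq, Finset.sum_eq_zero_iff_of_nonneg
      (fun _ _ => Finset.sum_nonneg fun _ _ => sq_nonneg _)] at h3
    have h4 := h3 σ (Finset.mem_univ _)
    rw [Finset.sum_eq_zero_iff_of_nonneg (fun _ _ => sq_nonneg _)] at h4
    have h5 := h4 τ (Finset.mem_univ _)
    simpa [sub_eq_zero] using h5

end

/-! ### Periodic functions and plane waves -/

section Periodic

variable {F : Type*} [NormedAddCommGroup F]

/-- `f` is periodic with respect to `L ℤ³`. -/
def LatticePeriodic {X : Type*} (L : ℝ) (f : E3 → X) : Prop :=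
  ∀ (n : Fin 3 → ℤ) (x : E3), f (x + latticePoint L n) = f x

/-- The lattice `L ℤ³`. -/
def lattice (L : ℝ) : AddSubgroup E3 :=
  (AddMonoidHom.mk' (latticePoint L) (latticePoint_add L)).range

instance instCountableLattice (L : ℝ) : Countable (lattice L) :=
  (Set.countable_range (latticePoint L)).to_subtype

theorem existsUnique_sub_mem_cell {L : ℝ} (hL : 0 < L) (y : E3) :
    ∃! g : lattice L, y - g ∈ cell L := by
  refine ⟨⟨latticeRound L y, _, rfl⟩, (latticeRound_eq_iff hL y _).1 rfl, ?_⟩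
  rintro ⟨_, n, rfl⟩ h
  exact Subtype.ext ((latticeRound_eq_iff hL y n).2 h).symm

/-- Translates of the cell are again fundamental domains, so integrals of periodic functions over
the cell are translation invariant. The reflected cells below play the same role for `y ↦ x - y` in
convolutions. -/
theorem isAddFundamentalDomain_translate {L : ℝ} (hL : 0 < L) (v : E3) :
    IsAddFundamentalDomain (lattice L) ((fun y => y - v) ⁻¹' cell L) := by
  refine IsAddFundamentalDomain.mk'
    ((measurable_id.sub_const v) (measurableSet_cell L)).nullMeasurableSet fun x => ?_
  obtain ⟨g, hg, hu⟩ := existsUnique_sub_mem_cell hL (x - v)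
  refine ⟨-g, ?_, fun g' hg' => ?_⟩
  · have h : ((-g : lattice L) +ᵥ x) - v = x - v - g := by
      rw [AddSubgroup.vadd_def, vadd_eq_add]; push_cast; abel
    simpa only [Set.mem_preimage, h] using hg
  · have h : (g' +ᵥ x) - v = x - v - (-g' : lattice L) := by
      rw [AddSubgroup.vadd_def, vadd_eq_add]; push_cast; abel
    rw [← hu (-g') (by simpa only [Set.mem_preimage, h] using hg'), neg_neg]

theorem isAddFundamentalDomain_reflect {L : ℝ} (hL : 0 < L) (v : E3) :
    IsAddFundamentalDomain (lattice L) ((fun y => v - y) ⁻¹' cell L) := by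
  refine IsAddFundamentalDomain.mk'
    ((measurable_id.const_sub v) (measurableSet_cell L)).nullMeasurableSet fun x => ?_
  have h : ∀ g : lattice L, v - (g +ᵥ x) = v - x - g := fun g => by
    rw [AddSubgroup.vadd_def, vadd_eq_add]; abel
  simp only [Set.mem_preimage, h]
  exact existsUnique_sub_mem_cell hL (v - x)

theorem isAddFundamentalDomain_cell {L : ℝ} (hL : 0 < L) :
    IsAddFundamentalDomain (lattice L) (cell L) := by
  simpa using isAddFundamentalDomain_translate hL 0

theorem LatticePeriodic.vadd {X : Type*} {L : ℝ} {f : E3 → X} (hf : LatticePeriodic L f)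
    (g : lattice L) (x : E3) : f (g +ᵥ x) = f x := by
  obtain ⟨_, n, rfl⟩ := g
  rw [AddSubgroup.vadd_def, vadd_eq_add, add_comm]
  exact hf n x

theorem LatticePeriodic.setIntegral_add [NormedSpace ℝ F] {L : ℝ} (hL : 0 < L) {f : E3 → F}
    (hf : LatticePeriodic L f) (v : E3) : ∫ x in cell L, f (x + v) = ∫ x in cell L, f x := by
  rw [(isAddFundamentalDomain_cell hL).setIntegral_eq (isAddFundamentalDomain_translate hL v)
    hf.vadd, ← (measurePreserving_add_right volume v).setIntegral_preimage_emb
    (measurableEmbedding_addRight v) f]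
  simp [Set.preimage_preimage]

theorem LatticePeriodic.setIntegral_sub [NormedSpace ℝ F] {L : ℝ} (hL : 0 < L) {f : E3 → F}
    (hf : LatticePeriodic L f) (v : E3) : ∫ x in cell L, f (v - x) = ∫ x in cell L, f x := by
  rw [(isAddFundamentalDomain_cell hL).setIntegral_eq (isAddFundamentalDomain_reflect hL v)
    hf.vadd, ← (Measure.measurePreserving_sub_left volume v).setIntegral_preimage_emb
    (MeasurableEquiv.subLeft v).measurableEmbedding f]
  simp [Set.preimage_preimage]

theorem LatticePeriodic.integrableOn_add {L : ℝ} (hL : 0 < L) {f : E3 → F}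
    (hf : LatticePeriodic L f) (h : IntegrableOn f (cell L)) (v : E3) :
    IntegrableOn (fun x => f (x + v)) (cell L) := by
  have h1 := ((isAddFundamentalDomain_cell hL).integrableOn_iff (f := f)
    (isAddFundamentalDomain_translate hL v) hf.vadd).1 h
  rw [← MeasurePreserving.integrableOn_comp_preimage (measurePreserving_add_right volume v)
    (measurableEmbedding_addRight v)] at h1
  simpa [Set.preimage_preimage, Function.comp_def] using h1

theorem LatticePeriodic.integrableOn_sub {L : ℝ} (hL : 0 < L) {f : E3 → F}
    (hf : LatticePeriodic L f) (h : IntegrableOn f (cell L)) (v : E3) :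
    IntegrableOn (fun x => f (v - x)) (cell L) := by
  have h1 := ((isAddFundamentalDomain_cell hL).integrableOn_iff (f := f)
    (isAddFundamentalDomain_reflect hL v) hf.vadd).1 h
  rw [← MeasurePreserving.integrableOn_comp_preimage (Measure.measurePreserving_sub_left volume v)
    (MeasurableEquiv.subLeft v).measurableEmbedding] at h1
  simpa [Set.preimage_preimage, Function.comp_def] using h1

theorem LatticePeriodic.sub_latticePoint {X : Type*} {L : ℝ} {f : E3 → X}
    (hf : LatticePeriodic L f) (n : Fin 3 → ℤ) (x : E3) : f (x - latticePoint L n) = f x := by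
  rw [sub_eq_add_neg, ← latticePoint_neg, hf]

theorem isCompact_closedCell (L : ℝ) :
    IsCompact {x : E3 | ∀ i, x i ∈ Set.Icc (-(L / 2)) (L / 2)} := by
  have h : {x : E3 | ∀ i, x i ∈ Set.Icc (-(L / 2)) (L / 2)} =
      (PiLp.homeomorph 2 (fun _ : Fin 3 => ℝ)) ⁻¹'
        (Set.univ.pi fun _ => Set.Icc (-(L / 2)) (L / 2)) := by
    ext x
    simp only [Set.mem_ofPred_eq, Set.mem_preimage, Set.mem_univ_pi]
    rfl
  rw [h, Homeomorph.isCompact_preimage]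
  exact isCompact_univ_pi fun _ => isCompact_Icc

theorem cell_subset_closedCell (L : ℝ) :
    cell L ⊆ {x : E3 | ∀ i, x i ∈ Set.Icc (-(L / 2)) (L / 2)} :=
  fun _ hx i => Set.Ico_subset_Icc_self (hx i)

theorem closedCell_ae_eq_cell (L : ℝ) :
    ({x : E3 | ∀ i, x i ∈ Set.Icc (-(L / 2)) (L / 2)} : Set E3) =ᵐ[volume] cell L := by
  have h : {x : E3 | ∀ i, x i ∈ Set.Icc (-(L / 2)) (L / 2)} =
      (MeasurableEquiv.toLp 2 (Fin 3 → ℝ)).symm ⁻¹'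
        (Set.univ.pi fun _ => Set.Icc (-(L / 2)) (L / 2)) := by
    ext x
    simp only [Set.mem_ofPred_eq, Set.mem_preimage, Set.mem_univ_pi]
    rfl
  rw [h, cell_eq_preimage]
  refine (EuclideanSpace.volume_preserving_symm_measurableEquiv_toLp
    (Fin 3)).quasiMeasurePreserving.preimage_ae_eq ?_
  rw [Set.pi_univ_Icc]
  exact (Measure.univ_pi_Ico_ae_eq_Icc (μ := fun _ => volume) (f := fun _ => -(L / 2))
        (g := fun _ => L / 2)).symm

theorem exists_mem_cell {L : ℝ} (hL : 0 < L) (x : E3) :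
    ∃ n : Fin 3 → ℤ, x + latticePoint L n ∈ cell L := by
  obtain ⟨⟨_, n, rfl⟩, h, -⟩ := existsUnique_sub_mem_cell hL x
  refine ⟨-n, ?_⟩
  rwa [latticePoint_neg, ← sub_eq_add_neg]

theorem LatticePeriodic.exists_bound {L : ℝ} (hL : 0 < L) {f : E3 → F}
    (hf : LatticePeriodic L f) (hc : Continuous f) : ∃ C, ∀ x, ‖f x‖ ≤ C := by
  obtain ⟨C, hC⟩ := (isCompact_closedCell L).exists_bound_of_continuousOn hc.continuousOn
  refine ⟨C, fun x => ?_⟩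
  obtain ⟨n, hn⟩ := exists_mem_cell hL x
  rw [← hf n x]
  exact hC _ (cell_subset_closedCell L hn)

instance instIsFiniteMeasureCell (L : ℝ) : IsFiniteMeasure (volume.restrict (cell L)) :=
  isFiniteMeasure_restrict.2 ((measure_mono (cell_subset_closedCell L)).trans_lt
    (isCompact_closedCell L).measure_lt_top).ne

theorem _root_.Continuous.integrableOn_cell {f : E3 → F} (hf : Continuous f) (L : ℝ) :
    IntegrableOn f (cell L) :=
  (hf.continuousOn.integrableOn_compact (isCompact_closedCell L)).mono_set
    (cell_subset_closedCell L)

end Periodic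

/-- The plane wave `exp(i k·x)`. -/
def wave (k x : E3) : ℂ := Complex.exp (Complex.I * (inner ℝ k x : ℝ))

theorem wave_add_right (k x y : E3) : wave k (x + y) = wave k x * wave k y := by
  simp only [wave]
  rw [← Complex.exp_add, inner_add_right]
  push_cast
  ring_nf

theorem wave_add_left (k l x : E3) : wave (k + l) x = wave k x * wave l x := by
  simp only [wave]
  rw [← Complex.exp_add, inner_add_left]
  push_cast
  ring_nf

theorem wave_zero_left (x : E3) : wave 0 x = 1 := by simp [wave]

theorem wave_zero_right (k : E3) : wave k 0 = 1 := by simp [wave]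

theorem norm_wave (k x : E3) : ‖wave k x‖ = 1 := by
  rw [wave, mul_comm, Complex.norm_exp_ofReal_mul_I]

theorem star_wave (k x : E3) : star (wave k x) = wave (-k) x := by
  rw [wave, wave, Complex.star_def, ← Complex.exp_conj, map_mul, Complex.conj_I,
    Complex.conj_ofReal, inner_neg_left]
  push_cast
  ring_nf

theorem wave_neg_right (k x : E3) : wave k (-x) = wave (-k) x := by
  rw [wave, wave, inner_neg_left, inner_neg_right]

theorem wave_sub_right (k x y : E3) : wave k (x - y) = wave k x * wave (-k) y := by
  rw [sub_eq_add_neg, wave_add_right, wave_neg_right]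

theorem continuous_wave (k : E3) : Continuous (wave k) := by
  unfold wave
  fun_prop

theorem inner_latticePoint (a : ℝ) (n : Fin 3 → ℤ) (x : E3) :
    inner ℝ (latticePoint a n) x = ∑ i, a * n i * x i := by
  rw [PiLp.inner_apply]
  refine Finset.sum_congr rfl fun i _ => ?_
  rw [latticePoint_apply, real_inner_eq_re_inner]
  simp [mul_comm]

theorem wave_latticePeriodic {L : ℝ} (hL : L ≠ 0) (n : Fin 3 → ℤ) :
    LatticePeriodic L (wave (latticePoint (2 * Real.pi / L) n)) := by
  intro m x
  rw [wave_add_right]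
  convert mul_one _ using 2
  rw [wave, Complex.exp_eq_one_iff]
  refine ⟨∑ i, n i * m i, ?_⟩
  rw [inner_latticePoint]
  have h : (∑ i, 2 * Real.pi / L * n i * latticePoint L m i) =
      2 * Real.pi * ((∑ i, n i * m i : ℤ) : ℝ) := by
    push_cast
    rw [Finset.mul_sum]
    refine Finset.sum_congr rfl fun i _ => ?_
    rw [latticePoint_apply]
    field_simp
  rw [h]
  push_cast
  ring

theorem integral_wave {L : ℝ} (hL : 0 < L) (n : Fin 3 → ℤ) :
    ∫ x in cell L, wave (latticePoint (2 * Real.pi / L) n) x =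
      if n = 0 then ((L ^ 3 : ℝ) : ℂ) else 0 := by
  split_ifs with hn
  · subst hn
    simp only [latticePoint_zero, wave_zero_left, integral_const, MeasurableSet.univ,
      measureReal_restrict_apply, Set.univ_inter]
    rw [measureReal_def, volume_cell hL.le, ENNReal.toReal_ofReal (by positivity)]
    simp
  · have ha : 0 < 2 * Real.pi / L := by positivity
    set k := latticePoint (2 * Real.pi / L) n with hk
    have hk0 : ‖k‖ ≠ 0 := (ha.trans_le (le_norm_latticePoint ha hn)).ne'
    -- Translation by `π k / |k|²` multiplies the wave by `exp (iπ) = -1`, so the integral equals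
    -- its negative.
    have h := (wave_latticePeriodic hL.ne' n).setIntegral_add hL ((Real.pi / ‖k‖ ^ 2) • k)
    have h2 : wave k ((Real.pi / ‖k‖ ^ 2) • k) = -1 := by
      rw [wave, inner_smul_right, real_inner_self_eq_norm_sq, div_mul_cancel₀ _ (pow_ne_zero 2 hk0),
        mul_comm, Complex.exp_pi_mul_I]
    rw [← hk] at h
    simp only [wave_add_right, h2, mul_neg, mul_one, integral_neg] at h
    exact self_eq_neg.1 h.symm

theorem norm_wave_mul_le (k x : E3) (z : ℂ) : ‖z * wave k x‖ = ‖z‖ := by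
  rw [norm_mul, norm_wave, mul_one]

theorem integrable_mul_wave {μ : Measure E3} {f : E3 → ℂ} (hf : Integrable f μ) (k : E3) :
    Integrable (fun x => f x * wave k x) μ :=
  hf.mul_bdd (c := 1) (continuous_wave k).aestronglyMeasurable
    (Eventually.of_forall fun x => (norm_wave k x).le)

/-! ### Functions with vanishing Fourier coefficients -/

/-- The submonoid of plane waves on the torus. -/
def waves (L : ℝ) : Submonoid (E3 → ℂ) where
  carrier := Set.range fun n => wave (latticePoint (2 * Real.pi / L) n)
  one_mem' := ⟨0, by ext x; simp [latticePoint_zero, wave_zero_left]⟩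
  mul_mem' := by
    rintro _ _ ⟨n, rfl⟩ ⟨m, rfl⟩
    refine ⟨n + m, ?_⟩
    ext x
    simp [latticePoint_add, wave_add_left]

/-- Plane waves are closed under products, so the algebra they generate is their linear span and
linearity suffices. -/
theorem integral_mul_eq_zero_of_mem_adjoin {L : ℝ} {u : E3 → ℂ} (hu : IntegrableOn u (cell L))
    (h0 : ∀ n, ∫ x in cell L, u x * wave (latticePoint (2 * Real.pi / L) n) x = 0)
    {p : E3 → ℂ} (hp : p ∈ Algebra.adjoin ℂ (waves L : Set (E3 → ℂ))) :
    ∫ x in cell L, u x * p x = 0 := by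
  have hp2 : p ∈ Submodule.span ℂ (waves L : Set (E3 → ℂ)) := by
    rw [← Subalgebra.mem_toSubmodule, Algebra.adjoin_eq_span, Submonoid.closure_eq] at hp
    exact hp
  suffices h : IntegrableOn (fun x => u x * p x) (cell L) ∧ ∫ x in cell L, u x * p x = 0 from h.2
  induction hp2 using Submodule.span_induction with
  | mem x h =>
    obtain ⟨n, rfl⟩ := h
    exact ⟨integrable_mul_wave hu _, h0 n⟩
  | zero => simp
  | add x y hx hy h1 h2 =>
    replace h1 := h1 (by
      rw [← Subalgebra.mem_toSubmodule, Algebra.adjoin_eq_span, Submonoid.closure_eq]; exact hx)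
    replace h2 := h2 (by
      rw [← Subalgebra.mem_toSubmodule, Algebra.adjoin_eq_span, Submonoid.closure_eq]; exact hy)
    simp only [Pi.add_apply, mul_add]
    exact ⟨h1.1.add h2.1, by rw [integral_add h1.1 h2.1, h1.2, h2.2, add_zero]⟩
  | smul c x hx h1 =>
    replace h1 := h1 (by
      rw [← Subalgebra.mem_toSubmodule, Algebra.adjoin_eq_span, Submonoid.closure_eq]; exact hx)
    simp only [Pi.smul_apply, smul_eq_mul, mul_left_comm _ c]
    exact ⟨h1.1.const_mul c, by rw [integral_const_mul, h1.2, mul_zero]⟩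

/-- A trigonometric polynomial with values in `[0,1]` that is equal to one only on the lattice. -/
def bump (L : ℝ) (x : E3) : ℝ := ∏ i, (1 + Real.cos (2 * Real.pi / L * x i)) / 2

theorem bump_mem_adjoin (L : ℝ) :
    (fun x => (bump L x : ℂ)) ∈ Algebra.adjoin ℂ (waves L : Set (E3 → ℂ)) := by
  have h : (fun x => (bump L x : ℂ)) = ∏ i : Fin 3, ((1 / 2 : ℂ) • (1 : E3 → ℂ) +
      (1 / 4 : ℂ) • wave (latticePoint (2 * Real.pi / L) (Pi.single i 1)) +
      (1 / 4 : ℂ) • wave (latticePoint (2 * Real.pi / L) (-Pi.single i 1))) := by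
    ext x
    rw [bump, Finset.prod_apply]
    push_cast
    refine Finset.prod_congr rfl fun i _ => ?_
    have h1 : inner ℝ (latticePoint (2 * Real.pi / L) (Pi.single i 1)) x =
        2 * Real.pi / L * x i := by
      rw [inner_latticePoint, Finset.sum_eq_single i]
      · simp
      · intro j _ hj
        simp [hj]
      · simp
    simp only [Pi.add_apply, Pi.smul_apply, Pi.one_apply, smul_eq_mul, latticePoint_neg]
    rw [← wave_neg_right, wave, wave, inner_neg_right, h1]
    have h2 := Complex.two_cos (2 * Real.pi / L * x i)
    push_cast
    rw [show Complex.cos (2 * Real.pi / L * x i) = (2 * Complex.cos (2 * Real.pi / L * x i)) / 2 by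
      ring, h2]
    ring_nf
  rw [h]
  have hw : ∀ n, wave (latticePoint (2 * Real.pi / L) n) ∈
      Algebra.adjoin ℂ (waves L : Set (E3 → ℂ)) := fun n =>
    Algebra.subset_adjoin ⟨n, rfl⟩
  exact Subalgebra.prod_mem _ fun i _ => add_mem (add_mem (Subalgebra.smul_mem _ (one_mem _) _)
    (Subalgebra.smul_mem _ (hw _) _)) (Subalgebra.smul_mem _ (hw _) _)

theorem continuous_bump (L : ℝ) : Continuous (bump L) := by
  unfold bump
  fun_prop

theorem bump_nonneg (L : ℝ) (x : E3) : 0 ≤ bump L x :=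
  Finset.prod_nonneg fun i _ => by linarith [Real.neg_one_le_cos (2 * Real.pi / L * x i)]

theorem bump_zero (L : ℝ) : bump L 0 = 1 := by simp [bump]

theorem bump_lt_one {L : ℝ} (hL : 0 < L) {x : E3} (hx : ∀ i, x i ∈ Set.Icc (-(L / 2)) (L / 2))
    (h0 : x ≠ 0) : bump L x < 1 := by
  obtain ⟨i, hi⟩ : ∃ i, x i ≠ 0 := by
    by_contra! h
    exact h0 (by ext i; simp [h])
  have h1 : ∀ j, (1 + Real.cos (2 * Real.pi / L * x j)) / 2 ≤ 1 := fun j => by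
    linarith [Real.cos_le_one (2 * Real.pi / L * x j)]
  have h2 : ∀ j, 0 ≤ (1 + Real.cos (2 * Real.pi / L * x j)) / 2 := fun j => by
    linarith [Real.neg_one_le_cos (2 * Real.pi / L * x j)]
  have h3 : (1 + Real.cos (2 * Real.pi / L * x i)) / 2 < 1 := by
    have h4 : |2 * Real.pi / L * x i| ≤ Real.pi := by
      rw [abs_mul, abs_of_pos (by positivity), div_mul_eq_mul_div, div_le_iff₀ hL]
      have := abs_le.2 (hx i)
      nlinarith [Real.pi_pos]
    have h5 : Real.cos (2 * Real.pi / L * x i) ≠ 1 := by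
      intro h
      rw [Real.cos_eq_one_iff_of_lt_of_lt (by linarith [abs_le.1 h4, Real.pi_pos])
        (by linarith [abs_le.1 h4, Real.pi_pos])] at h
      rcases mul_eq_zero.1 h with h | h
      · have : 0 < 2 * Real.pi / L := by positivity
        exact this.ne' h
      · exact hi h
    have := lt_of_le_of_ne (Real.cos_le_one (2 * Real.pi / L * x i)) h5
    linarith
  rw [bump, ← Finset.mul_prod_erase _ _ (Finset.mem_univ i)]
  exact (mul_le_of_le_one_right (h2 i)
    (Finset.prod_le_one (fun j _ => h2 j) fun j _ => h1 j)).trans_lt h3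

/-- Normalized powers of `bump` concentrate at the origin, so their integrals against `u` tend to `u
0`. They are trigonometric polynomials, hence all these integrals vanish. Integrability and
continuity at one point are enough, which suits potentials with singularities. -/
theorem eq_zero_of_fourier_eq_zero_at_zero {L : ℝ} (hL : 0 < L) {u : E3 → ℂ}
    (hu : IntegrableOn u (cell L)) (hc : ContinuousAt u 0)
    (h0 : ∀ n, ∫ x in cell L, u x * wave (latticePoint (2 * Real.pi / L) n) x = 0) : u 0 = 0 := by
  have hint : (0 : E3) ∈ interior {x : E3 | ∀ i, x i ∈ Set.Icc (-(L / 2)) (L / 2)} := by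
    refine mem_interior.2 ⟨{x : E3 | ∀ i, x i ∈ Set.Ioo (-(L / 2)) (L / 2)},
      fun x hx i => Set.Ioo_subset_Icc_self (hx i), ?_, fun i => by simp [hL]⟩
    simp only [Set.ofPred_forall]
    exact isOpen_iInter_of_finite fun i => isOpen_Ioo.preimage (by fun_prop)
  have h := tendsto_setIntegral_pow_smul_of_unique_maximum_of_isCompact_of_integrableOn
    (μ := volume) (isCompact_closedCell L) (continuous_bump L).continuousOn
    (x₀ := 0) (g := u) (fun y hy hy0 => by rw [bump_zero]; exact bump_lt_one hL hy hy0)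
    (fun x _ => bump_nonneg L x) (by rw [bump_zero]; exact one_pos) (subset_closure hint)
    (hu.congr_set_ae (closedCell_ae_eq_cell L)) hc.continuousWithinAt
  refine tendsto_nhds_unique h (tendsto_const_nhds.congr fun n => ?_)
  rw [setIntegral_congr_set (closedCell_ae_eq_cell L) (f := fun x => bump L x ^ n • u x)]
  have h2 := integral_mul_eq_zero_of_mem_adjoin hu h0 (pow_mem (bump_mem_adjoin L) n)
  simp only [Pi.pow_apply] at h2
  have h3 : ∫ x in cell L, bump L x ^ n • u x = 0 := by
    rw [← h2]
    refine integral_congr_ae (Eventually.of_forall fun x => ?_)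
    simp only [Complex.real_smul]
    push_cast
    ring
  rw [h3, smul_zero]

theorem LatticePeriodic.eq_zero_of_fourier_eq_zero {L : ℝ} (hL : 0 < L) {u : E3 → ℂ}
    (hp : LatticePeriodic L u) (hu : IntegrableOn u (cell L))
    (h0 : ∀ n, ∫ x in cell L, u x * wave (latticePoint (2 * Real.pi / L) n) x = 0)
    {x₀ : E3} (hc : ContinuousAt u x₀) : u x₀ = 0 := by
  have h := eq_zero_of_fourier_eq_zero_at_zero hL (u := fun x => u (x + x₀))
    (hp.integrableOn_add hL hu x₀) (by
      have : ContinuousAt u (0 + x₀) := by rwa [zero_add]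
      exact ContinuousAt.comp (g := u) this (by fun_prop)) fun n => by
      set k := latticePoint (2 * Real.pi / L) n
      have h1 : LatticePeriodic L fun x => u x * wave k (x - x₀) := fun m x => by
        have h3 : x + latticePoint L m - x₀ = x - x₀ + latticePoint L m := by abel
        simp only [hp m x]
        rw [h3, wave_latticePeriodic hL.ne' n m]
      have h2 := h1.setIntegral_add hL x₀
      simp only [add_sub_cancel_right] at h2
      rw [h2]
      simp only [wave_sub_right, ← mul_assoc]
      rw [integral_mul_const, h0, zero_mul]
  simpa using h

/-! ### Integration by parts on the torus -/

section Parts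

variable {F : Type*} [NormedAddCommGroup F]

theorem LatticePeriodic.fderiv_apply [NormedSpace ℝ F] {L : ℝ} {g : E3 → F} (hg : LatticePeriodic L g) (v : E3) :
    LatticePeriodic L fun x => fderiv ℝ g x v := by
  intro n x
  have h : (fun y => g (y + latticePoint L n)) = g := funext fun y => hg n y
  have h2 := fderiv_comp_add_right (𝕜 := ℝ) (f := g) (x := x) (latticePoint L n)
  rw [h] at h2
  simp only [← h2]

theorem integrable_of_bounded_continuous {X : Type*} [TopologicalSpace X] [MeasurableSpace X]
    [OpensMeasurableSpace X] [SecondCountableTopologyEither X F] {μ : Measure X} [IsFiniteMeasure μ]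
    {f : X → F} (hf : Continuous f) {C : ℝ} (hC : ∀ x, ‖f x‖ ≤ C) : Integrable f μ :=
  (integrable_const C).mono' hf.aestronglyMeasurable (Eventually.of_forall hC)

/-- Integrating `g (x + v) - g x = ∫₀¹ (∂_v g) (x + t v) dt` over the cell, translation invariance
annihilates the left side and removes `t` from the right side; no boundary terms occur. -/
theorem LatticePeriodic.integral_fderiv [NormedSpace ℝ F] [CompleteSpace F] {L : ℝ} (hL : 0 < L) {g : E3 → F}
    (hg : LatticePeriodic L g) (hs : ContDiff ℝ 1 g) (v : E3) :
    ∫ x in cell L, fderiv ℝ g x v = 0 := by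
  have hc : Continuous fun x => fderiv ℝ g x v :=
    (hs.continuous_fderiv one_ne_zero).clm_apply continuous_const
  obtain ⟨C, hC⟩ := (hg.fderiv_apply v).exists_bound hL hc
  have h1 : ∀ x, ∫ t in (0 : ℝ)..1, fderiv ℝ g (x + t • v) v = g (x + v) - g x := fun x => by
    have h := intervalIntegral.integral_eq_sub_of_hasDerivAt (a := 0) (b := 1)
      (f := fun t : ℝ => g (x + t • v)) (f' := fun t => fderiv ℝ g (x + t • v) v)
      (fun t _ => by
        have h2 : HasDerivAt (fun t : ℝ => x + t • v) v t := by
          simpa using ((hasDerivAt_id t).smul_const v).const_add x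
        exact ((hs.differentiable one_ne_zero _).hasFDerivAt).comp_hasDerivAt t h2)
      ((hc.comp (by fun_prop : Continuous fun t : ℝ => x + t • v)).intervalIntegrable _ _)
    simpa using h
  have h2 : ∫ x in cell L, ∫ t in (0 : ℝ)..1, fderiv ℝ g (x + t • v) v = 0 := by
    simp only [h1]
    have hgc := hs.continuous
    have i1 : IntegrableOn (fun x => g (x + v)) (cell L) :=
      (by fun_prop : Continuous fun x => g (x + v)).integrableOn_cell L
    rw [integral_sub i1 (hgc.integrableOn_cell L)]
    exact sub_eq_zero.2 (hg.setIntegral_add hL v)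
  simp only [intervalIntegral.integral_of_le zero_le_one] at h2
  rw [integral_integral_swap] at h2
  · have h3 : ∀ t : ℝ, ∫ x in cell L, fderiv ℝ g (x + t • v) v = ∫ x in cell L, fderiv ℝ g x v :=
      fun t => (hg.fderiv_apply v).setIntegral_add hL (t • v)
    simpa [h3] using h2
  · exact integrable_of_bounded_continuous (C := C)
      (hc.comp (by fun_prop : Continuous fun z : E3 × ℝ => z.1 + z.2 • v)) fun z => hC _

end Parts

theorem contDiff_wave (k : E3) {n : WithTop ℕ∞} : ContDiff ℝ n (wave k) := by
  unfold wave
  have h : ContDiff ℝ n fun x : E3 => ((inner ℝ k x : ℝ) : ℂ) :=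
    Complex.ofRealCLM.contDiff.comp (contDiff_const.inner ℝ contDiff_id)
  exact (contDiff_const.mul h).cexp

theorem fderiv_wave (k x v : E3) :
    fderiv ℝ (wave k) x v = Complex.I * (inner ℝ k v : ℝ) * wave k x := by
  have h1 : HasFDerivAt (fun x : E3 => Complex.I * ((inner ℝ k x : ℝ) : ℂ))
      (Complex.I • (Complex.ofRealCLM.comp (innerSL ℝ k))) x :=
    (Complex.ofRealCLM.hasFDerivAt.comp x (innerSL ℝ k).hasFDerivAt).const_mul Complex.I
  have h2 : HasFDerivAt (wave k) _ x := h1.cexp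
  rw [h2.fderiv]
  simp [wave, mul_comm]

theorem integral_fderiv_mul_wave {L : ℝ} (hL : 0 < L) {φ : E3 → ℂ} (hφ : LatticePeriodic L φ)
    (hs : ContDiff ℝ 1 φ) (v : E3) (n : Fin 3 → ℤ) :
    ∫ x in cell L, fderiv ℝ φ x v * wave (latticePoint (2 * Real.pi / L) n) x =
      -(Complex.I * (inner ℝ (latticePoint (2 * Real.pi / L) n) v : ℝ)) *
        ∫ x in cell L, φ x * wave (latticePoint (2 * Real.pi / L) n) x := by
  have hw := wave_latticePeriodic hL.ne' n
  set k := latticePoint (2 * Real.pi / L) n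
  have h1 : LatticePeriodic L fun x => φ x * wave k x := fun m x => by
    simp only [hφ m x, hw m x]
  have h2 := h1.integral_fderiv hL (hs.mul (contDiff_wave k)) v
  have h3 : ∀ x, fderiv ℝ (fun x => φ x * wave k x) x v =
      fderiv ℝ φ x v * wave k x + Complex.I * (inner ℝ k v : ℝ) * (φ x * wave k x) := fun x => by
    rw [fderiv_fun_mul (hs.differentiable one_ne_zero x)
      ((contDiff_wave k (n := 1)).differentiable one_ne_zero x)]
    simp only [add_apply, smul_apply, smul_eq_mul,
      fderiv_wave]
    ring
  simp only [h3] at h2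
  have hc : Continuous fun x => fderiv ℝ φ x v :=
    (hs.continuous_fderiv one_ne_zero).clm_apply continuous_const
  have hw1 := continuous_wave k
  have i1 : IntegrableOn (fun x => fderiv ℝ φ x v * wave k x) (cell L) :=
    (hc.mul hw1).integrableOn_cell L
  have i2 : IntegrableOn (fun x => φ x * wave k x) (cell L) :=
    (hs.continuous.mul hw1).integrableOn_cell L
  rw [integral_add i1 (i2.const_mul _), integral_const_mul] at h2
  linear_combination h2

theorem contDiff_fderiv_apply {φ : E3 → ℂ} {m n : WithTop ℕ∞} (hs : ContDiff ℝ n φ)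
    (hmn : m + 1 ≤ n) (v : E3) : ContDiff ℝ m fun x => fderiv ℝ φ x v :=
  (hs.fderiv_right hmn).clm_apply contDiff_const

theorem laplacian_eq_sum_fderiv {φ : E3 → ℂ} (hs : ContDiff ℝ 2 φ) (x : E3) :
    Laplacian.laplacian φ x = ∑ i, fderiv ℝ (fun y => fderiv ℝ φ y
      (EuclideanSpace.basisFun (Fin 3) ℝ i)) x (EuclideanSpace.basisFun (Fin 3) ℝ i) := by
  rw [InnerProductSpace.laplacian_eq_iteratedFDeriv_orthonormalBasis φ
    (EuclideanSpace.basisFun (Fin 3) ℝ)]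
  refine Finset.sum_congr rfl fun i _ => ?_
  rw [iteratedFDeriv_two_apply, fderiv_clm_apply]
  · simp
  · exact (hs.fderiv_right (m := 1) le_rfl).differentiable one_ne_zero x
  · fun_prop

theorem continuous_laplacian {φ : E3 → ℂ} (hs : ContDiff ℝ 2 φ) :
    Continuous (Laplacian.laplacian φ) := by
  rw [funext (laplacian_eq_sum_fderiv hs)]
  exact continuous_finsetSum _ fun i _ =>
    (contDiff_fderiv_apply (m := 0) (contDiff_fderiv_apply (m := 1) hs le_rfl _)
      (by norm_num) _).continuous

theorem LatticePeriodic.laplacian {L : ℝ} {φ : E3 → ℂ} (hφ : LatticePeriodic L φ)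
    (hs : ContDiff ℝ 2 φ) : LatticePeriodic L (Laplacian.laplacian φ) := by
  intro n x
  simp only [laplacian_eq_sum_fderiv hs]
  exact Finset.sum_congr rfl fun i _ => (hφ.fderiv_apply _).fderiv_apply _ n x

theorem sum_inner_basisFun_sq (k : E3) :
    ∑ i, (inner ℝ k (EuclideanSpace.basisFun (Fin 3) ℝ i)) ^ 2 = ‖k‖ ^ 2 := by
  have h := (EuclideanSpace.basisFun (Fin 3) ℝ).sum_sq_norm_inner_left k
  rw [← h]
  exact Finset.sum_congr rfl fun i _ => by rw [Real.norm_eq_abs, sq_abs]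

theorem laplacian_wave (k x : E3) :
    Laplacian.laplacian (wave k) x = -((‖k‖ ^ 2 : ℝ) : ℂ) * wave k x := by
  rw [laplacian_eq_sum_fderiv (contDiff_wave k), ← sum_inner_basisFun_sq]
  simp only [fderiv_wave]
  push_cast
  rw [← Finset.sum_neg_distrib, Finset.sum_mul]
  refine Finset.sum_congr rfl fun i _ => ?_
  rw [fderiv_const_mul ((contDiff_wave k (n := 1)).differentiable one_ne_zero x)]
  simp only [smul_apply, smul_eq_mul, fderiv_wave]
  linear_combination (inner ℝ k (EuclideanSpace.basisFun (Fin 3) ℝ i) : ℂ) ^ 2 * wave k x *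
    Complex.I_mul_I

theorem integral_laplacian_mul_wave {L : ℝ} (hL : 0 < L) {φ : E3 → ℂ} (hφ : LatticePeriodic L φ)
    (hs : ContDiff ℝ 2 φ) (n : Fin 3 → ℤ) :
    ∫ x in cell L, Laplacian.laplacian φ x * wave (latticePoint (2 * Real.pi / L) n) x =
      -((‖latticePoint (2 * Real.pi / L) n‖ ^ 2 : ℝ) : ℂ) *
        ∫ x in cell L, φ x * wave (latticePoint (2 * Real.pi / L) n) x := by
  simp only [laplacian_eq_sum_fderiv hs, Finset.sum_mul]
  have h1 : ∀ v, ContDiff ℝ 1 fun x => fderiv ℝ φ x v := fun v =>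
    contDiff_fderiv_apply hs le_rfl v
  have h2 : ∀ v, Continuous fun x => fderiv ℝ (fun y => fderiv ℝ φ y v) x v := fun v =>
    (contDiff_fderiv_apply (m := 0) (h1 v) (by norm_num) v).continuous
  have h3 : ∀ v, IntegrableOn (fun x => fderiv ℝ (fun y => fderiv ℝ φ y v) x v *
      wave (latticePoint (2 * Real.pi / L) n) x) (cell L) := fun v =>
    ((h2 v).mul (continuous_wave _)).integrableOn_cell L
  rw [integral_finsetSum _ fun i _ => h3 _, ← sum_inner_basisFun_sq]
  push_cast
  rw [← Finset.sum_neg_distrib, Finset.sum_mul]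
  refine Finset.sum_congr rfl fun i _ => ?_
  rw [integral_fderiv_mul_wave hL (hφ.fderiv_apply _) (h1 _),
    integral_fderiv_mul_wave hL hφ (hs.of_le one_le_two)]
  linear_combination (inner ℝ (latticePoint (2 * Real.pi / L) n)
    (EuclideanSpace.basisFun (Fin 3) ℝ i) : ℂ) ^ 2 *
    (∫ x in cell L, φ x * wave (latticePoint (2 * Real.pi / L) n) x) * Complex.I_mul_I

/-! ### The periodic Coulomb potential through its Fourier coefficients -/

/-- The Fourier coefficients of `W`, apart from the mean, are those of the Coulomb potential. -/
def HasCoulombCoeff (L : ℝ) (W : E3 → ℝ) : Prop :=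
  ∀ n : Fin 3 → ℤ, n ≠ 0 → ∫ x in cell L, (W x : ℂ) * wave (latticePoint (2 * Real.pi / L) n) x =
    ((4 * Real.pi / ‖latticePoint (2 * Real.pi / L) n‖ ^ 2 : ℝ) : ℂ)

theorem laplacian_ofReal {φ : E3 → ℝ} (hs : ContDiff ℝ 2 φ) (x : E3) :
    Laplacian.laplacian (fun y => (φ y : ℂ)) x = ((Laplacian.laplacian φ x : ℝ) : ℂ) :=
  (hs.contDiffAt (x := x)).laplacian_CLM_comp_left (l := Complex.ofRealCLM)

/-- The identity is the value at zero of a family: with `φ` translated by `x`, the difference `u x`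
of the two sides is continuous and periodic. Its Fourier coefficients vanish by Fubini and
integration by parts, so `u` vanishes identically. -/
theorem HasCoulombCoeff.equation_complex {L : ℝ} (hL : 0 < L) {W : E3 → ℝ}
    (hW : IntegrableOn W (cell L)) (h : HasCoulombCoeff L W)
    {φ : E3 → ℂ} (hs : ContDiff ℝ 2 φ) (hφ : LatticePeriodic L φ) :
    (∫ x in cell L, (W x : ℂ) * -(Laplacian.laplacian φ x)) =
      4 * Real.pi * (φ 0 - (L ^ 3 : ℝ)⁻¹ * (∫ x in cell L, φ x)) := by
  have hlc := continuous_laplacian hs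
  have hlp := hφ.laplacian hs
  obtain ⟨C, hC⟩ := hlp.exists_bound hL hlc
  have hWc : Integrable (fun x => (W x : ℂ)) (volume.restrict (cell L)) := hW.ofReal
  set c : ℂ := (L ^ 3 : ℝ)⁻¹ * (∫ x in cell L, φ x) with hc
  set u : E3 → ℂ := fun x => (∫ y in cell L, (W y : ℂ) * -(Laplacian.laplacian φ (y + x))) -
    4 * Real.pi * (φ x - c) with hu
  have hcont1 : Continuous fun x => ∫ y in cell L, (W y : ℂ) * -(Laplacian.laplacian φ (y + x)) := by
    refine continuous_of_dominated (bound := fun y => ‖(W y : ℂ)‖ * C) (fun x => ?_) (fun x => ?_)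
      (hWc.norm.mul_const C) (Eventually.of_forall fun y => by fun_prop)
    · exact hWc.aestronglyMeasurable.mul
        (by fun_prop : Continuous fun y => -(Laplacian.laplacian φ (y + x))).aestronglyMeasurable
    · refine Eventually.of_forall fun y => ?_
      rw [norm_mul, norm_neg]
      exact mul_le_mul_of_nonneg_left (hC _) (norm_nonneg _)
  have hφc := hs.continuous
  have hcont : Continuous u := hcont1.sub (by fun_prop)
  have hper : LatticePeriodic L u := fun n x => by
    simp only [hu, ← add_assoc, hlp n, hφ n x]
  have hcoef : ∀ n, ∫ x in cell L, u x * wave (latticePoint (2 * Real.pi / L) n) x = 0 := by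
    intro n
    have hIL := integral_laplacian_mul_wave hL hφ hs n
    have hIw := integral_wave hL n
    have hwp := wave_latticePeriodic hL.ne' n
    have hco : n ≠ 0 → ∫ x in cell L, (W x : ℂ) * wave (-latticePoint (2 * Real.pi / L) n) x =
        ((4 * Real.pi / ‖latticePoint (2 * Real.pi / L) n‖ ^ 2 : ℝ) : ℂ) := fun hn => by
      have h2 := h (-n) (neg_ne_zero.2 hn)
      rwa [latticePoint_neg, norm_neg] at h2
    have hk0 : n ≠ 0 → ‖latticePoint (2 * Real.pi / L) n‖ ≠ 0 := fun hn =>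
      ((by positivity : 0 < 2 * Real.pi / L).trans_le (le_norm_latticePoint (by positivity) hn)).ne'
    have hkz : n = 0 → latticePoint (2 * Real.pi / L) n = 0 := fun hn => by
      rw [hn, latticePoint_zero]
    set k := latticePoint (2 * Real.pi / L) n
    have h1 : ∫ x in cell L, (∫ y in cell L, (W y : ℂ) * -(Laplacian.laplacian φ (y + x))) *
        wave k x = (∫ y in cell L, (W y : ℂ) * wave (-k) y) *
          (((‖k‖ ^ 2 : ℝ) : ℂ) * ∫ x in cell L, φ x * wave k x) := by
      simp only [← integral_mul_const]
      rw [integral_integral_swap]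
      · refine integral_congr_ae (Eventually.of_forall fun y => ?_)
        have h2 : LatticePeriodic L fun x => Laplacian.laplacian φ x * wave k (x - y) := fun m x => by
          have h3 : x + latticePoint L m - y = x - y + latticePoint L m := by abel
          simp only [hlp m x]
          rw [h3, hwp m]
        have h4 := h2.setIntegral_add hL y
        simp only [add_sub_cancel_right] at h4
        simp only [wave_sub_right, ← mul_assoc] at h4
        rw [integral_mul_const, hIL] at h4
        have h5 : ∀ x, (W y : ℂ) * -(Laplacian.laplacian φ (y + x)) * wave k x =
            -(W y : ℂ) * (Laplacian.laplacian φ (x + y) * wave k x) := fun x => by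
          rw [add_comm y x]; ring
        simp only [h5]
        rw [integral_const_mul, h4]
        ring
      · have h2 : Integrable (Function.uncurry fun x y => (W y : ℂ))
            ((volume.restrict (cell L)).prod (volume.restrict (cell L))) :=
          hWc.comp_snd _
        have h3 := h2.mul_bdd (c := C) (g := fun z : E3 × E3 =>
          -(Laplacian.laplacian φ (z.2 + z.1)) * wave k z.1)
          (by have := continuous_wave k; fun_prop :
            Continuous fun z : E3 × E3 => -(Laplacian.laplacian φ (z.2 + z.1)) *
              wave k z.1).aestronglyMeasurable
          (Eventually.of_forall fun z => by rw [norm_wave_mul_le, norm_neg]; exact hC _)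
        refine h3.congr (Eventually.of_forall fun z => ?_)
        simp only [Function.uncurry]
        ring
    have h6 : ∀ x, u x * wave k x = (∫ y in cell L, (W y : ℂ) * -(Laplacian.laplacian φ (y + x))) *
        wave k x - 4 * Real.pi * (φ x * wave k x - c * wave k x) := fun x => by
      simp only [hu]; ring
    simp only [h6]
    have hw := continuous_wave k
    have i1 : IntegrableOn (fun x => (∫ y in cell L, (W y : ℂ) *
        -(Laplacian.laplacian φ (y + x))) * wave k x) (cell L) :=
      (hcont1.mul hw).integrableOn_cell L
    have i2 : IntegrableOn (fun x => φ x * wave k x) (cell L) := (hφc.mul hw).integrableOn_cell L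
    have i3 : IntegrableOn (fun x => c * wave k x) (cell L) :=
      (continuous_const.mul hw).integrableOn_cell L
    rw [integral_sub i1 ((i2.fun_sub i3).const_mul _), integral_const_mul,
      integral_sub i2 i3, integral_const_mul, hIw, h1]
    -- For the zero mode the factor `|k|²` removes the unknown mean of `W`, and `φ - c` has mean
    -- zero. For the other modes `|k|²` cancels the denominator of the Coulomb coefficient.
    split_ifs with hn
    · simp only [hkz hn, wave_zero_left, norm_zero, mul_one, hc]
      have : ((L ^ 3 : ℝ) : ℂ) ≠ 0 := by exact_mod_cast (pow_pos hL 3).ne'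
      push_cast at this ⊢
      field_simp
      ring
    · rw [hco hn]
      have := hk0 hn
      have : ((‖k‖ : ℝ) : ℂ) ≠ 0 := by exact_mod_cast this
      push_cast
      field_simp
      ring
  have h0 := hper.eq_zero_of_fourier_eq_zero hL (hcont.integrableOn_cell L) hcoef
    (x₀ := 0) hcont.continuousAt
  simp only [hu, add_zero] at h0
  exact sub_eq_zero.1 h0

theorem HasCoulombCoeff.equation {L : ℝ} (hL : 0 < L) {W : E3 → ℝ}
    (hW : IntegrableOn W (cell L)) (h : HasCoulombCoeff L W)
    {φ : E3 → ℝ} (hs : ContDiff ℝ 2 φ) (hφ : LatticePeriodic L φ) :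
    (∫ x in cell L, W x * -(Laplacian.laplacian φ x)) =
      4 * Real.pi * (φ 0 - (L ^ 3)⁻¹ * (∫ x in cell L, φ x)) := by
  have h1 := h.equation_complex hL hW (φ := fun x => (φ x : ℂ))
    (Complex.ofRealCLM.contDiff.comp hs) fun n x => by simp only [hφ n x]
  simp only [laplacian_ofReal hs] at h1
  rw [integral_complex_ofReal] at h1
  have h2 : ∀ x, (W x : ℂ) * -((Laplacian.laplacian φ x : ℝ) : ℂ) =
      ((W x * -(Laplacian.laplacian φ x) : ℝ) : ℂ) := fun x => by push_cast; ring
  simp only [h2] at h1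
  rw [integral_complex_ofReal] at h1
  exact_mod_cast h1

/-- The equation is tested on real functions only, so it is applied to `l (wave k x)` for `l` the
real and the imaginary part; these are eigenfunctions of `-Δ` with eigenvalue `|k|²`. -/
theorem IsTorusCoulomb.hasCoulombCoeff {L : ℝ} (hL : 0 < L) {W : E3 → ℝ}
    (h : IsTorusCoulomb L W) : HasCoulombCoeff L W := by
  intro n hn
  have hwp := wave_latticePeriodic hL.ne' n
  have hIw := integral_wave hL n
  rw [if_neg hn] at hIw
  have hk0 : ‖latticePoint (2 * Real.pi / L) n‖ ≠ 0 :=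
      ((by positivity : 0 < 2 * Real.pi / L).trans_le (le_norm_latticePoint (by positivity) hn)).ne'
  set k := latticePoint (2 * Real.pi / L) n
  have hWc : Integrable (fun x => (W x : ℂ)) (volume.restrict (cell L)) := h.integrable.ofReal
  have hi := integrable_mul_wave hWc k
  have hl : ∀ l : ℂ →L[ℝ] ℝ, (∫ x in cell L, W x * l (wave k x)) =
      4 * Real.pi / ‖k‖ ^ 2 * l 1 := fun l => by
    have hs : ContDiff ℝ ∞ fun x => l (wave k x) := l.contDiff.comp (contDiff_wave k)
    have h1 := h.equation _ hs fun m x => by rw [hwp m x]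
    have h2 : ∀ x, Laplacian.laplacian (fun x => l (wave k x)) x = -‖k‖ ^ 2 * l (wave k x) :=
      fun x => by
        have h3 := ((contDiff_wave k (n := 2)).contDiffAt (x := x)).laplacian_CLM_comp_left (l := l)
        have h4 : Laplacian.laplacian (fun x => l (wave k x)) x =
          l (Laplacian.laplacian (wave k) x) := h3
        rw [h4, laplacian_wave]
        have h5 : -((‖k‖ ^ 2 : ℝ) : ℂ) * wave k x = (-‖k‖ ^ 2 : ℝ) • wave k x := by
          rw [Complex.real_smul]; push_cast; ring
        rw [h5, map_smul, smul_eq_mul]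
    simp only [h2] at h1
    rw [l.integral_comp_comm ((continuous_wave k).integrableOn_cell L), hIw, map_zero, mul_zero,
      sub_zero, wave_zero_right] at h1
    have h6 : ∀ x, W x * -(-‖k‖ ^ 2 * l (wave k x)) = ‖k‖ ^ 2 * (W x * l (wave k x)) :=
      fun x => by ring
    simp only [h6] at h1
    rw [integral_const_mul] at h1
    field_simp
    linarith
  apply Complex.ext
  · rw [← RCLike.re_eq_complex_re, ← integral_re hi, RCLike.re_eq_complex_re, Complex.ofReal_re]
    have := hl Complex.reCLM
    simpa using this
  · rw [← RCLike.im_eq_complex_im, ← integral_im hi, RCLike.im_eq_complex_im, Complex.ofReal_im]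
    have := hl Complex.imCLM
    simpa using this

/-! ### Uniqueness of the periodic Coulomb potential -/

theorem isClosed_range_latticePoint {L : ℝ} (hL : L ≠ 0) :
    IsClosed (Set.range (latticePoint L)) := by
  have h : Set.range (latticePoint L) =
      ⋂ i, (fun x : E3 => x i / L) ⁻¹' Set.range ((↑) : ℤ → ℝ) := by
    ext x
    simp only [Set.mem_range, Set.mem_iInter, Set.mem_preimage]
    constructor
    · rintro ⟨n, rfl⟩ i
      exact ⟨n i, by rw [latticePoint_apply, mul_div_cancel_left₀ _ hL]⟩
    · intro h
      choose n hn using h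
      refine ⟨n, ?_⟩
      ext i
      rw [latticePoint_apply, hn i, mul_div_cancel₀ _ hL]
  rw [h]
  exact isClosed_iInter fun i => Int.isClosedEmbedding_coe_real.isClosed_range.preimage (by fun_prop)

/-- Two solutions share all nonzero Fourier coefficients, so their difference minus its mean
vanishes at every continuity point. The remaining constant is fixed by the common minimum. -/
theorem IsTorusCoulomb.eq_of_notMem {L : ℝ} (hL : 0 < L) {W W' : E3 → ℝ}
    (h : IsTorusCoulomb L W) (h' : IsTorusCoulomb L W') {x : E3}
    (hx : x ∈ (Set.range (latticePoint L))ᶜ) : W x = W' x := by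
  set m : ℂ := ((L ^ 3 : ℝ) : ℂ)⁻¹ * ∫ x in cell L, ((W x : ℂ) - W' x) with hm
  have hWc : IntegrableOn (fun x => (W x : ℂ)) (cell L) := h.integrable.ofReal
  have hWc' : IntegrableOn (fun x => (W' x : ℂ)) (cell L) := h'.integrable.ofReal
  have hcst : IntegrableOn (fun _ : E3 => m) (cell L) := integrable_const _
  have key : ∀ y ∈ (Set.range (latticePoint L))ᶜ, ((W y : ℂ) - W' y) - m = 0 := by
    intro y hy
    refine LatticePeriodic.eq_zero_of_fourier_eq_zero hL (u := fun x => ((W x : ℂ) - W' x) - m)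
      (fun n x => by simp only [h.periodic n x, h'.periodic n x])
      ((hWc.fun_sub hWc').fun_sub hcst) (fun n => ?_) ?_
    · have hc1 := h.hasCoulombCoeff hL n
      have hc2 := h'.hasCoulombCoeff hL n
      have hIw := integral_wave hL n
      have hkz : n = 0 → latticePoint (2 * Real.pi / L) n = 0 := fun hn => by
        rw [hn, latticePoint_zero]
      set k := latticePoint (2 * Real.pi / L) n
      simp only [sub_mul]
      have i1 : IntegrableOn (fun x => (W x : ℂ) * wave k x - W' x * wave k x) (cell L) :=
        (integrable_mul_wave hWc k).sub (integrable_mul_wave hWc' k)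
      rw [integral_sub i1 (integrable_mul_wave hcst k), integral_sub (integrable_mul_wave hWc k)
        (integrable_mul_wave hWc' k), integral_const_mul, hIw]
      split_ifs with hn
      · have : ((L ^ 3 : ℝ) : ℂ) ≠ 0 := by exact_mod_cast (pow_pos hL 3).ne'
        simp only [hkz hn, wave_zero_left, mul_one, hm]
        rw [mul_right_comm, inv_mul_cancel₀ this, one_mul, integral_sub hWc hWc', sub_self]
      · rw [hc1 hn, hc2 hn]
        simp
    · have ho := (isClosed_range_latticePoint hL.ne').isOpen_compl.mem_nhds hy
      have c1 := h.continuous.continuousAt ho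
      have c2 := h'.continuous.continuousAt ho
      exact ((Complex.continuous_ofReal.continuousAt.comp c1).sub
        (Complex.continuous_ofReal.continuousAt.comp c2)).sub continuousAt_const
  have key2 : ∀ y ∈ (Set.range (latticePoint L))ᶜ, W y - W' y = m.re := fun y hy => by
    have := congrArg Complex.re (sub_eq_zero.1 (key y hy))
    simpa using this
  -- At a zero of `W` the constant equals `-W'`, hence is at most zero; at a zero of `W'` it equals
  -- `W`, hence is at least zero.
  obtain ⟨⟨y, hy, hy0⟩, hmin⟩ := h.min_eq_zero
  obtain ⟨⟨z, hz, hz0⟩, hmin'⟩ := h'.min_eq_zero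
  have h1 := hmin' ⟨y, hy, rfl⟩
  have h2 := hmin ⟨z, hz, rfl⟩
  have h3 := key2 y hy
  have h4 := key2 z hz
  have h5 := key2 x hx
  linarith

/-! ### Theta functions -/

/-- The periodic heat kernel `∑ₙ exp(-π n² t) exp(2π i n x)` in dimension one. -/
def theta (x t : ℝ) : ℝ := HurwitzZeta.cosKernel (x : UnitAddCircle) t

theorem continuousAt_theta {x t : ℝ} (ht : 0 < t) :
    ContinuousAt (fun z : ℝ × ℝ => theta z.1 z.2) (x, t) := by
  have h : (fun z : ℝ × ℝ => theta z.1 z.2) =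
      fun z => (jacobiTheta₂ (z.1 : ℂ) (Complex.I * z.2)).re := by
    ext z
    rw [theta, ← HurwitzZeta.cosKernel_def, Complex.ofReal_re]
  rw [h]
  refine Complex.continuous_re.continuousAt.comp ?_
  have h2 := continuousAt_jacobiTheta₂ (x : ℂ) (τ := Complex.I * t) (by simpa using ht)
  exact ContinuousAt.comp (x := (x, t)) (f := fun z : ℝ × ℝ => ((z.1 : ℂ), Complex.I * (z.2 : ℂ))) h2
    (by fun_prop : Continuous fun z : ℝ × ℝ => ((z.1 : ℂ), Complex.I * (z.2 : ℂ))).continuousAt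

theorem theta_add_int (x t : ℝ) (n : ℤ) : theta (x + n) t = theta x t := by
  have h : ((x + n : ℝ) : UnitAddCircle) = (x : UnitAddCircle) := by
    have h0 : ((n : ℝ) : UnitAddCircle) = 0 := (AddCircle.coe_eq_zero_iff (1 : ℝ)).2 ⟨n, by simp⟩
    rw [AddCircle.coe_add, h0, add_zero]
  rw [theta, h, theta]

theorem hasSum_gaussian {t : ℝ} (ht : 0 < t) :
    HasSum (fun n : ℤ => Real.exp (-Real.pi * n ^ 2 * t)) (theta 0 t) := by
  have h := HurwitzZeta.hasSum_int_cosKernel 0 ht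
  simp only [Complex.ofReal_zero, mul_zero, zero_mul, Complex.exp_zero, one_mul] at h
  exact_mod_cast h

/-- A bound for the difference of the heat kernel from its mean. -/
def thetaTail (t : ℝ) : ℝ := theta 0 t - 1

theorem norm_cexp_two_pi (x : ℝ) (n : ℤ) : ‖Complex.exp (2 * Real.pi * Complex.I * x * n)‖ = 1 := by
  rw [show 2 * (Real.pi : ℂ) * Complex.I * x * n = ((2 * Real.pi * x * n : ℝ) : ℂ) * Complex.I by
    push_cast; ring, Complex.norm_exp_ofReal_mul_I]

/-- The term `n = 0` is the mean; every other term is dominated in absolute value by its value at `x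
= 0`. -/
theorem abs_theta_sub_one_le (x : ℝ) {t : ℝ} (ht : 0 < t) : |theta x t - 1| ≤ thetaTail t := by
  have h1 := (HurwitzZeta.hasSum_int_cosKernel x ht).sub (hasSum_ite_eq (0 : ℤ) (1 : ℂ))
  have h2 := (hasSum_gaussian ht).sub (hasSum_ite_eq (0 : ℤ) (1 : ℝ))
  have h3 : ∀ n : ℤ, ‖Complex.exp (2 * Real.pi * Complex.I * x * n) *
      Real.exp (-Real.pi * n ^ 2 * t) - (if n = 0 then 1 else 0)‖ ≤
      Real.exp (-Real.pi * n ^ 2 * t) - (if n = 0 then 1 else 0) := fun n => by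
    split_ifs with hn
    · simp [hn]
    · rw [sub_zero, sub_zero, norm_mul, norm_cexp_two_pi, one_mul,
        Complex.norm_of_nonneg (Real.exp_pos _).le]
  have h4 := tsum_of_norm_bounded h2 h3
  rw [h1.tsum_eq] at h4
  rw [thetaTail]
  have h5 : ((theta x t : ℂ) - 1) = ((theta x t - 1 : ℝ) : ℂ) := by push_cast; rfl
  rw [← theta, h5, Complex.norm_real] at h4
  exact h4

theorem thetaTail_nonneg {t : ℝ} (ht : 0 < t) : 0 ≤ thetaTail t :=
  (abs_nonneg _).trans (abs_theta_sub_one_le 0 ht)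

theorem continuousOn_thetaTail : ContinuousOn thetaTail (Set.Ici 1) := fun t ht =>
  (((continuousAt_theta (x := 0) (zero_lt_one.trans_le ht)).comp
    (f := fun t : ℝ => ((0 : ℝ), t)) (by fun_prop)).sub continuousAt_const).continuousWithinAt

/-- Poisson summation: this dual form, a sum of Gaussians centred at the lattice points, displays
positivity and the behaviour as `t` tends to zero. -/
theorem theta_eq {x t : ℝ} (ht : 0 < t) :
    theta x t = (Real.sqrt t)⁻¹ * HurwitzZeta.evenKernel (x : UnitAddCircle) (1 / t) := by
  have h := HurwitzZeta.evenKernel_functional_equation (x : UnitAddCircle) (1 / t)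
  rw [one_div_one_div, ← Real.sqrt_eq_rpow] at h
  rw [h, theta, ← mul_assoc]
  have h2 : (Real.sqrt t)⁻¹ * (1 / Real.sqrt (1 / t)) = 1 := by
    rw [Real.sqrt_div zero_le_one, Real.sqrt_one, one_div_one_div]
    exact inv_mul_cancel₀ (Real.sqrt_pos.2 ht).ne'
  rw [h2, one_mul]

theorem gaussian_le_theta (x : ℝ) {t : ℝ} (ht : 0 < t) :
    (Real.sqrt t)⁻¹ * Real.exp (-Real.pi * x ^ 2 / t) ≤ theta x t := by
  rw [theta_eq ht]
  refine mul_le_mul_of_nonneg_left ?_ (by positivity)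
  have h := (HurwitzZeta.hasSum_int_evenKernel x (one_div_pos.2 ht))
  have h2 := le_hasSum h 0 fun n _ => (Real.exp_pos _).le
  simpa [div_eq_mul_inv] using h2

theorem theta_nonneg (x : ℝ) {t : ℝ} (ht : 0 < t) : 0 ≤ theta x t :=
  le_trans (by positivity) (gaussian_le_theta x ht)

/-- In each Gaussian the exponent is split as `1/t = (1/t - 1) + 1`; the first part is bounded
through the distance of `x` to the integers, and the second sums to the kernel at time one. -/
theorem theta_le {x t : ℝ} (ht : 0 < t) (ht1 : t ≤ 1) :
    theta x t ≤ (1 + thetaTail 1) * (Real.sqrt t)⁻¹ *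
      Real.exp (-(Real.pi * ‖(x : UnitAddCircle)‖ ^ 2 * (1 / t - 1))) := by
  have h1 : HurwitzZeta.evenKernel (x : UnitAddCircle) 1 ≤ 1 + thetaTail 1 := by
    rw [HurwitzZeta.evenKernel_functional_equation]
    simp only [Real.one_rpow, div_one, one_mul]
    have := (abs_le.1 (abs_theta_sub_one_le x one_pos)).2
    rw [theta] at this
    linarith
  have h2 := HurwitzZeta.hasSum_int_evenKernel x (one_div_pos.2 ht)
  have h3 := (HurwitzZeta.hasSum_int_evenKernel x one_pos).mul_left
    (Real.exp (-(Real.pi * ‖(x : UnitAddCircle)‖ ^ 2 * (1 / t - 1))))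
  have h4 : HurwitzZeta.evenKernel (x : UnitAddCircle) (1 / t) ≤
      Real.exp (-(Real.pi * ‖(x : UnitAddCircle)‖ ^ 2 * (1 / t - 1))) *
        HurwitzZeta.evenKernel (x : UnitAddCircle) 1 := by
    refine hasSum_le (fun n => ?_) h2 h3
    rw [← Real.exp_add, Real.exp_le_exp]
    have h5 : ‖(x : UnitAddCircle)‖ ^ 2 ≤ ((n : ℝ) + x) ^ 2 := by
      rw [UnitAddCircle.norm_eq, sq_abs, sq_le_sq]
      have := round_le x (-n)
      push_cast at this
      rwa [sub_neg_eq_add, add_comm x] at this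
    have h6 : 0 ≤ 1 / t - 1 := by rw [sub_nonneg, le_div_iff₀ ht]; linarith
    nlinarith [mul_nonneg (mul_nonneg Real.pi_pos.le h6) (sub_nonneg.2 h5)]
  rw [theta_eq ht]
  calc (Real.sqrt t)⁻¹ * HurwitzZeta.evenKernel (x : UnitAddCircle) (1 / t)
      ≤ (Real.sqrt t)⁻¹ * (Real.exp (-(Real.pi * ‖(x : UnitAddCircle)‖ ^ 2 * (1 / t - 1))) *
        (1 + thetaTail 1)) := by gcongr; exact h4.trans (by gcongr)
    _ = _ := by ring

theorem setIntegral_cexp (j : ℤ) :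
    ∫ x in Set.Ico (-(1 / 2) : ℝ) (1 / 2), Complex.exp (2 * Real.pi * Complex.I * x * j) =
      if j = 0 then 1 else 0 := by
  rw [integral_Ico_eq_integral_Ioc, ← intervalIntegral.integral_of_le (by norm_num)]
  split_ifs with hj
  · simp [hj]; norm_num
  · have hc : 2 * (Real.pi : ℂ) * Complex.I * j ≠ 0 := by
      simp [Real.pi_ne_zero, hj]
    have h := integral_exp_mul_complex (a := -(1 / 2)) (b := 1 / 2) hc
    have h1 : ∀ x : ℝ, 2 * (Real.pi : ℂ) * Complex.I * x * j =
      2 * (Real.pi : ℂ) * Complex.I * j * x := fun x => by ring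
    simp only [h1]
    rw [h, div_eq_zero_iff]
    left
    rw [sub_eq_zero, Complex.exp_eq_exp_iff_exists_int]
    exact ⟨j, by push_cast; ring⟩

/-- The defining series is integrated term by term; only the mode `n = -m` survives. -/
theorem integral_theta {t : ℝ} (ht : 0 < t) (m : ℤ) :
    ∫ x in Set.Ico (-(1 / 2) : ℝ) (1 / 2), (theta x t : ℂ) *
      Complex.exp (2 * Real.pi * Complex.I * x * m) = Real.exp (-Real.pi * m ^ 2 * t) := by
  set F : ℤ → ℝ → ℂ := fun n x => Complex.exp (2 * Real.pi * Complex.I * x * (n + m : ℤ)) *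
    Real.exp (-Real.pi * n ^ 2 * t) with hF
  have hFc : ∀ n, Continuous (F n) := fun n => by simp only [hF]; fun_prop
  have hFn : ∀ n x, ‖F n x‖ = Real.exp (-Real.pi * n ^ 2 * t) := fun n x => by
    rw [hF]
    simp only
    rw [norm_mul, norm_cexp_two_pi, one_mul, Complex.norm_of_nonneg (Real.exp_pos _).le]
  have h1 := hasSum_integral_of_summable_integral_norm
    (μ := volume.restrict (Set.Ico (-(1 / 2) : ℝ) (1 / 2))) (F := F)
    (fun n => integrable_of_bounded_continuous (hFc n) fun x => (hFn n x).le) (by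
      simp only [hFn]
      norm_num
      simpa using (hasSum_gaussian ht).summable)
  have h2 : ∀ n, ∫ x in Set.Ico (-(1 / 2) : ℝ) (1 / 2), F n x =
      if n = -m then (Real.exp (-Real.pi * m ^ 2 * t) : ℂ) else 0 := fun n => by
    simp only [hF]
    rw [integral_mul_const, setIntegral_cexp]
    by_cases hn : n = -m
    · simp [hn]
    · rw [if_neg hn, if_neg (fun h => hn (eq_neg_of_add_eq_zero_left h)), zero_mul]
  simp only [h2] at h1
  rw [(hasSum_ite_eq (-m) (Real.exp (-Real.pi * m ^ 2 * t) : ℂ)).unique h1]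
  refine integral_congr_ae (Eventually.of_forall fun x => ?_)
  simp only
  have h3 := (HurwitzZeta.hasSum_int_cosKernel x ht).mul_right
    (Complex.exp (2 * Real.pi * Complex.I * x * m))
  rw [theta, ← h3.tsum_eq]
  refine tsum_congr fun n => ?_
  simp only [hF]
  push_cast
  rw [mul_right_comm, ← Complex.exp_add]
  ring_nf

/-! ### The periodic heat kernel in dimension three -/

/-- The periodic heat kernel on the unit torus. -/
def heat (x : E3) (t : ℝ) : ℝ := ∏ i, theta (x i) t

theorem continuousAt_heat {z : E3 × ℝ} (ht : 0 < z.2) :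
    ContinuousAt (fun z : E3 × ℝ => heat z.1 z.2) z := by
  unfold heat
  refine tendsto_finsetProd _ fun i _ => ?_
  exact (continuousAt_theta (x := z.1 i) ht).comp (f := fun z : E3 × ℝ => (z.1 i, z.2))
    (by fun_prop : Continuous fun z : E3 × ℝ => (z.1 i, z.2)).continuousAt

theorem heat_latticePeriodic (t : ℝ) : LatticePeriodic 1 fun x => heat x t := by
  intro n x
  refine Finset.prod_congr rfl fun i _ => ?_
  rw [PiLp.add_apply, latticePoint_apply, one_mul, theta_add_int]

theorem heat_nonneg (x : E3) {t : ℝ} (ht : 0 < t) : 0 ≤ heat x t :=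
  Finset.prod_nonneg fun _ _ => theta_nonneg _ ht

/-- A bound for the difference of the heat kernel from its mean. -/
def heatTail (t : ℝ) : ℝ := (1 + thetaTail t) ^ 3 - 1

theorem abs_heat_sub_one_le (x : E3) {t : ℝ} (ht : 0 < t) : |heat x t - 1| ≤ heatTail t := by
  have h1 := fun i => abs_theta_sub_one_le (x i) ht
  have h2 := thetaTail_nonneg ht
  set d := thetaTail t
  rw [heat, heatTail, Fin.prod_univ_three]
  -- Expansion of the product around one in the three deviations, mirrored by the expansion of `(1 +
  -- d)³ - 1`.
  have e : theta (x 0) t * theta (x 1) t * theta (x 2) t - 1 =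
      (theta (x 0) t - 1) * (theta (x 1) t - 1) * (theta (x 2) t - 1) +
      ((theta (x 0) t - 1) * (theta (x 1) t - 1) + (theta (x 0) t - 1) * (theta (x 2) t - 1) +
        (theta (x 1) t - 1) * (theta (x 2) t - 1)) +
      ((theta (x 0) t - 1) + (theta (x 1) t - 1) + (theta (x 2) t - 1)) := by ring
  rw [e]
  have h3 := h1 0
  have h4 := h1 1
  have h5 := h1 2
  generalize theta (x 0) t - 1 = a at h3 ⊢
  generalize theta (x 1) t - 1 = b at h4 ⊢
  generalize theta (x 2) t - 1 = c at h5 ⊢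
  have hab : |a * b| ≤ d * d := by rw [abs_mul]; gcongr
  have hac : |a * c| ≤ d * d := by rw [abs_mul]; gcongr
  have hbc : |b * c| ≤ d * d := by rw [abs_mul]; gcongr
  have habc : |a * b * c| ≤ d * d * d := by rw [abs_mul]; gcongr
  rw [abs_le] at *
  constructor <;> nlinarith

theorem integral_heat {t : ℝ} (ht : 0 < t) (n : Fin 3 → ℤ) :
    ∫ x in cell 1, (heat x t : ℂ) * wave (latticePoint (2 * Real.pi / 1) n) x =
      Real.exp (-Real.pi * (∑ i, (n i : ℝ) ^ 2) * t) := by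
  have h1 : ∀ x : E3, (heat x t : ℂ) * wave (latticePoint (2 * Real.pi / 1) n) x =
      ∏ i, (theta (x i) t : ℂ) * Complex.exp (2 * Real.pi * Complex.I * (x i : ℝ) * n i) := by
    intro x
    rw [Finset.prod_mul_distrib, ← Complex.exp_sum, heat, wave, inner_latticePoint]
    push_cast
    rw [Finset.mul_sum]
    congr 2
    refine Finset.sum_congr rfl fun i _ => ?_
    ring
  simp only [h1]
  have h2 := (EuclideanSpace.volume_preserving_symm_measurableEquiv_toLp
    (Fin 3)).setIntegral_preimage_emb (MeasurableEquiv.measurableEmbedding _)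
    (fun y => ∏ i, (theta (y i) t : ℂ) * Complex.exp (2 * Real.pi * Complex.I * (y i : ℝ) * n i))
    (Set.univ.pi fun _ => Set.Ico (-(1 / 2)) (1 / 2))
  rw [← cell_eq_preimage] at h2
  refine h2.trans ?_
  rw [volume_pi, Measure.restrict_pi_pi, integral_fintype_prod_eq_prod (𝕜 := ℂ) (fun i (y : ℝ) =>
    (theta y t : ℂ) * Complex.exp (2 * Real.pi * Complex.I * y * n i))]
  simp only [integral_theta ht]
  rw [← Complex.ofReal_prod, ← Real.exp_sum]
  congr 2
  rw [Finset.mul_sum, Finset.sum_mul]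

theorem integral_heat_eq_one {t : ℝ} (ht : 0 < t) : ∫ x in cell 1, heat x t = 1 := by
  have h := integral_heat ht 0
  simp only [latticePoint_zero, wave_zero_left, mul_one, Pi.zero_apply, Int.cast_zero] at h
  rw [integral_complex_ofReal] at h
  norm_num at h
  exact_mod_cast h

theorem heat_le {x : E3} {t : ℝ} (ht : 0 < t) (ht1 : t ≤ 1) (i : Fin 3) :
    heat x t ≤ ((1 + thetaTail 1) * (Real.sqrt t)⁻¹) ^ 3 *
      Real.exp (-(Real.pi * ‖(x i : UnitAddCircle)‖ ^ 2 * (1 / t - 1))) := by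
  have h0 : 0 ≤ (1 + thetaTail 1) * (Real.sqrt t)⁻¹ := by
    have := thetaTail_nonneg one_pos
    positivity
  have h6 : 0 ≤ 1 / t - 1 := by rw [sub_nonneg, le_div_iff₀ ht]; linarith
  have h1 : ∀ j, theta (x j) t ≤ (1 + thetaTail 1) * (Real.sqrt t)⁻¹ := fun j =>
    (theta_le ht ht1).trans (mul_le_of_le_one_right h0
      (Real.exp_le_one_iff.2 (neg_nonpos.2 (mul_nonneg (by positivity) h6))))
  rw [heat, ← Finset.mul_prod_erase _ _ (Finset.mem_univ i)]
  calc theta (x i) t * ∏ j ∈ Finset.univ.erase i, theta (x j) t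
      ≤ ((1 + thetaTail 1) * (Real.sqrt t)⁻¹ *
        Real.exp (-(Real.pi * ‖(x i : UnitAddCircle)‖ ^ 2 * (1 / t - 1)))) *
        ∏ j ∈ Finset.univ.erase i, ((1 + thetaTail 1) * (Real.sqrt t)⁻¹) := by
        gcongr with j
        · exact Finset.prod_nonneg fun j _ => theta_nonneg _ ht
        · exact theta_le ht ht1
        · exact fun j _ => theta_nonneg _ ht
        · exact h1 j
    _ = _ := by
        rw [Finset.prod_const, Finset.card_erase_of_mem (Finset.mem_univ i)]
        simp only [Finset.card_univ, Fintype.card_fin]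
        ring

/-- Away from the lattice the factor `exp (-c / t)` beats the power `t^(-3/2)`, uniformly as `t`
tends to zero. -/
theorem exists_heat_le {d : ℝ} (hd : 0 < d) : ∃ C, ∀ (x : E3) (i : Fin 3) (t : ℝ),
    d ≤ ‖(x i : UnitAddCircle)‖ → 0 < t → t ≤ 1 → heat x t ≤ C := by
  set c := Real.pi * d ^ 2 with hc
  have hc0 : 0 < c := by positivity
  have hA := thetaTail_nonneg one_pos
  refine ⟨(1 + thetaTail 1) ^ 3 * (2 / c ^ 2 * Real.exp c), fun x i t hx ht ht1 => ?_⟩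
  refine (heat_le ht ht1 i).trans ?_
  rw [mul_pow, mul_assoc]
  refine mul_le_mul_of_nonneg_left ?_ (by positivity)
  have h6 : 0 ≤ 1 / t - 1 := by rw [sub_nonneg, le_div_iff₀ ht]; linarith
  have h1 : Real.exp (-(Real.pi * ‖(x i : UnitAddCircle)‖ ^ 2 * (1 / t - 1))) ≤
      Real.exp c * (Real.exp (c * (1 / t)))⁻¹ := by
    rw [← Real.exp_neg, ← Real.exp_add, Real.exp_le_exp]
    have : c * (1 / t - 1) ≤ Real.pi * ‖(x i : UnitAddCircle)‖ ^ 2 * (1 / t - 1) := by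
      rw [hc]; gcongr
    linarith
  have h2 : (Real.sqrt t)⁻¹ ^ 3 ≤ (1 / t) ^ 2 := by
    have h3 : (1 / t) ^ 2 = (Real.sqrt t)⁻¹ ^ 4 := by
      nth_rw 1 [← Real.sq_sqrt ht.le]
      field_simp
    rw [h3]
    exact pow_le_pow_right₀ ((one_le_inv₀ (Real.sqrt_pos.2 ht)).2
      (Real.sqrt_le_one.2 ht1)) (by norm_num)
  have h3 : (1 / t) ^ 2 ≤ 2 / c ^ 2 * Real.exp (c * (1 / t)) := by
    have h4 := Real.quadratic_le_exp_of_nonneg (x := c * (1 / t)) (by positivity)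
    have h5 : 0 ≤ c * (1 / t) := by positivity
    rw [div_mul_eq_mul_div, le_div_iff₀ (by positivity)]
    nlinarith
  calc (Real.sqrt t)⁻¹ ^ 3 * Real.exp (-(Real.pi * ‖(x i : UnitAddCircle)‖ ^ 2 * (1 / t - 1)))
      ≤ (2 / c ^ 2 * Real.exp (c * (1 / t))) * (Real.exp c * (Real.exp (c * (1 / t)))⁻¹) := by
        gcongr
        exact h2.trans h3
    _ = _ := by
        have := (Real.exp_pos (c * (1 / t))).ne'
        field_simp

theorem continuousOn_heatTail : ContinuousOn heatTail (Set.Ici 1) :=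
  ((continuousOn_const.add continuousOn_thetaTail).pow 3).sub continuousOn_const

theorem integrableOn_heatTail : IntegrableOn heatTail (Set.Ioi 1) := by
  obtain ⟨p, hp, h⟩ := HurwitzZeta.isBigO_atTop_cosKernel_sub 0
  have h1 : thetaTail =O[atTop] fun t => Real.exp (-p * t) := by
    refine h.congr_left fun t => ?_
    simp [thetaTail, theta]
  have h0 : Tendsto thetaTail atTop (𝓝 0) := by
    refine h1.trans_tendsto (Real.tendsto_exp_atBot.comp ?_)
    exact tendsto_id.const_mul_atTop_of_neg (neg_neg_of_pos hp)
  refine integrable_of_isBigO_exp_neg hp continuousOn_heatTail ?_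
  have h2 : heatTail = fun t => thetaTail t * (3 + 3 * thetaTail t + thetaTail t ^ 2) := by
    ext t
    rw [heatTail]
    ring
  have h3 : Tendsto (fun t => 3 + 3 * thetaTail t + thetaTail t ^ 2) atTop
      (𝓝 (3 + 3 * 0 + 0 ^ 2)) :=
    ((h0.const_mul 3).const_add 3).add (h0.pow 2)
  rw [h2]
  simpa using h1.mul (h3.isBigO_one ℝ)

theorem heatTail_nonneg {t : ℝ} (ht : 0 < t) : 0 ≤ heatTail t :=
  (abs_nonneg _).trans (abs_heat_sub_one_le 0 ht)

theorem integrableOn_heatBound (C : ℝ) :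
    IntegrableOn (fun t => if t ≤ 1 then C else heatTail t) (Set.Ioi 0) := by
  rw [← Set.Ioc_union_Ioi_eq_Ioi zero_le_one]
  refine IntegrableOn.union ?_ ?_
  · refine IntegrableOn.congr_fun (f := fun _ => C) (by simp) (fun t ht => ?_) measurableSet_Ioc
    simp [ht.2]
  · refine IntegrableOn.congr_fun integrableOn_heatTail (fun t ht => ?_) measurableSet_Ioi
    simp [not_le.2 (Set.mem_Ioi.1 ht)]

/-! ### The Green function of the unit torus -/

/-- The periodic Coulomb potential with vanishing mean on the unit torus, divided by its
normalization. -/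
def greenFunction (x : E3) : ℝ := ∫ t in Set.Ioi 0, (heat x t - 1)

theorem greenFunction_latticePeriodic : LatticePeriodic 1 greenFunction := by
  intro n x
  simp only [greenFunction, heat_latticePeriodic _ n x]

theorem continuousOn_heat :
    ContinuousOn (fun z : E3 × ℝ => heat z.1 z.2) (Set.univ ×ˢ Set.Ioi 0) := fun _ hz =>
  (continuousAt_heat hz.2).continuousWithinAt

theorem continuousOn_heat_right (x : E3) : ContinuousOn (heat x) (Set.Ioi 0) := fun t ht =>
  (ContinuousAt.comp (x := t) (f := fun t : ℝ => (x, t)) (continuousAt_heat (z := (x, t)) ht)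
    (by fun_prop)).continuousWithinAt

theorem continuous_heat_left {t : ℝ} (ht : 0 < t) : Continuous fun x => heat x t :=
  continuous_iff_continuousAt.2 fun x =>
    ContinuousAt.comp (x := x) (f := fun x : E3 => (x, t)) (continuousAt_heat (z := (x, t)) ht)
      (by fun_prop)

theorem abs_heat_sub_one_le_bound {x : E3} {t C : ℝ} (ht : 0 < t)
    (h : t ≤ 1 → heat x t ≤ C) :
    ‖heat x t - 1‖ ≤ if t ≤ 1 then C + 1 else heatTail t := by
  split_ifs with h1
  · have h2 := heat_nonneg x ht
    rw [Real.norm_eq_abs, abs_le]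
    have h3 := h h1
    constructor <;> linarith
  · exact abs_heat_sub_one_le x ht

theorem exists_norm_pos_of_notMem {x : E3} (hx : x ∈ (Set.range (latticePoint 1))ᶜ) :
    ∃ i, 0 < ‖(x i : UnitAddCircle)‖ := by
  by_contra! h
  have h1 : ∀ i, ∃ n : ℤ, n • (1 : ℝ) = x i := fun i =>
    (AddCircle.coe_eq_zero_iff (1 : ℝ)).1 (norm_le_zero_iff.1 (h i))
  choose n hn using h1
  refine hx ⟨n, ?_⟩
  ext i
  rw [latticePoint_apply, ← hn i]
  simp

theorem integrableOn_heat_sub_one {x : E3} (hx : x ∈ (Set.range (latticePoint 1))ᶜ) :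
    IntegrableOn (fun t => heat x t - 1) (Set.Ioi 0) := by
  obtain ⟨i, hi⟩ := exists_norm_pos_of_notMem hx
  obtain ⟨C, hC⟩ := exists_heat_le hi
  refine (integrableOn_heatBound (C + 1)).mono'
    (((continuousOn_heat_right x).sub continuousOn_const).aestronglyMeasurable measurableSet_Ioi)
    ((ae_restrict_iff' measurableSet_Ioi).2 (Eventually.of_forall fun t ht => ?_))
  exact abs_heat_sub_one_le_bound ht fun h1 => hC x i t le_rfl ht h1

/-- Off the lattice one coordinate stays at a fixed distance from the integers on a neighbourhood,
giving one dominating function for all nearby points. -/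
theorem continuousAt_greenFunction {x : E3} (hx : x ∈ (Set.range (latticePoint 1))ᶜ) :
    ContinuousAt greenFunction x := by
  obtain ⟨i, hd⟩ := exists_norm_pos_of_notMem hx
  obtain ⟨C, hC⟩ := exists_heat_le (half_pos hd)
  have hcont : Continuous fun y : E3 => ‖(y i : UnitAddCircle)‖ :=
    continuous_norm.comp ((AddCircle.continuous_mk' (1 : ℝ)).comp (by fun_prop))
  have hnear : ∀ᶠ y : E3 in 𝓝 x, ‖(x i : UnitAddCircle)‖ / 2 < ‖(y i : UnitAddCircle)‖ :=
    hcont.continuousAt.eventually (lt_mem_nhds (half_lt_self hd))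
  refine continuousAt_of_dominated (bound := fun t => if t ≤ 1 then C + 1 else heatTail t)
    (Eventually.of_forall fun y => ?_) ?_ (integrableOn_heatBound _) ?_
  · exact ((continuousOn_heat_right y).sub continuousOn_const).aestronglyMeasurable
      measurableSet_Ioi
  · filter_upwards [hnear] with y hy
    refine (ae_restrict_iff' measurableSet_Ioi).2 (Eventually.of_forall fun t ht => ?_)
    exact abs_heat_sub_one_le_bound ht fun h1 => hC y i t hy.le ht h1
  · refine (ae_restrict_iff' measurableSet_Ioi).2 (Eventually.of_forall fun t ht => ?_)
    exact ((continuous_heat_left ht).sub continuous_const).continuousAt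

/-- No pointwise bound near the lattice is needed: for `t ≤ 1` positivity and unit mass bound the
norm in `x` by two, and for `t > 1` the tail bound applies. -/
theorem integrable_heat_prod : Integrable (fun z : E3 × ℝ => heat z.1 z.2 - 1)
    ((volume.restrict (cell 1)).prod (volume.restrict (Set.Ioi 0))) := by
  have hm : AEStronglyMeasurable (fun z : E3 × ℝ => heat z.1 z.2 - 1)
      ((volume.restrict (cell 1)).prod (volume.restrict (Set.Ioi 0))) := by
    rw [Measure.prod_restrict]
    exact ((continuousOn_heat.sub continuousOn_const).mono
      (Set.prod_mono (Set.subset_univ _) subset_rfl)).aestronglyMeasurable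
      ((measurableSet_cell 1).prod measurableSet_Ioi)
  have hint : ∀ t : ℝ, 0 < t → IntegrableOn (fun x => heat x t) (cell 1) := fun t ht =>
    (continuous_heat_left ht).integrableOn_cell 1
  have hvol : volume.real (cell 1) = 1 := by
    rw [measureReal_def, volume_cell zero_le_one]; simp
  have hcst : IntegrableOn (fun _ : E3 => (1 : ℝ)) (cell 1) := integrable_const _
  refine (integrable_prod_iff' hm).2 ⟨?_, ?_⟩
  · refine (ae_restrict_iff' measurableSet_Ioi).2 (Eventually.of_forall fun t ht => ?_)
    exact (hint t ht).sub hcst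
  · refine (integrableOn_heatBound 2).mono' hm.norm.prod_swap.integral_prod_right' ?_
    refine (ae_restrict_iff' measurableSet_Ioi).2 (Eventually.of_forall fun t ht => ?_)
    rw [Real.norm_of_nonneg (integral_nonneg fun _ => norm_nonneg _)]
    split_ifs with h1
    · calc ∫ x in cell 1, ‖heat x t - 1‖ ≤ ∫ x in cell 1, (heat x t + 1) := by
            refine integral_mono ((hint t ht).sub hcst).norm ((hint t ht).add hcst) fun x => ?_
            have := heat_nonneg x ht
            rw [Real.norm_eq_abs, abs_le]
            constructor <;> linarith
        _ = 2 := by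
            rw [integral_add (hint t ht) hcst, integral_heat_eq_one ht]
            simp [hvol]; norm_num
    · calc ∫ x in cell 1, ‖heat x t - 1‖ ≤ ∫ x in cell 1, heatTail t :=
            integral_mono ((hint t ht).sub hcst).norm (integrable_const _)
              fun x => abs_heat_sub_one_le x ht
        _ = heatTail t := by simp [hvol]

theorem integrableOn_greenFunction : IntegrableOn greenFunction (cell 1) :=
  integrable_heat_prod.integral_prod_left

theorem norm_latticePoint_sq (a : ℝ) (n : Fin 3 → ℤ) :
    ‖latticePoint a n‖ ^ 2 = a ^ 2 * ∑ i, (n i : ℝ) ^ 2 := by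
  rw [EuclideanSpace.norm_sq_eq, Finset.mul_sum]
  refine Finset.sum_congr rfl fun i _ => ?_
  rw [latticePoint_apply, Real.norm_eq_abs, sq_abs, mul_pow]

/-- By Fubini the coefficient is `∫ exp (-π |n|² t) dt = 1 / (π |n|²)`, which is `4π / |2πn|²`. -/
theorem hasCoulombCoeff_greenFunction : HasCoulombCoeff 1 greenFunction := by
  intro n hn
  have hpos : 0 < ∑ i, (n i : ℝ) ^ 2 := by
    have h1 := le_norm_latticePoint one_pos hn
    have h2 := norm_latticePoint_sq 1 n
    rw [one_pow, one_mul] at h2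
    rw [← h2]
    positivity
  have hN := norm_latticePoint_sq (2 * Real.pi / 1) n
  have hIw := integral_wave one_pos n
  have hheat := fun t (ht : 0 < t) => integral_heat (t := t) ht n
  rw [if_neg hn] at hIw
  rw [hN]
  set k := latticePoint (2 * Real.pi / 1) n
  set N := ∑ i, (n i : ℝ) ^ 2
  have h1 : ∀ x, (greenFunction x : ℂ) * wave k x =
      ∫ t in Set.Ioi 0, ((heat x t - 1 : ℝ) : ℂ) * wave k x := fun x => by
    rw [integral_mul_const, integral_complex_ofReal, greenFunction]
  simp only [h1]
  rw [integral_integral_swap]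
  · have h2 : ∫ t in Set.Ioi (0 : ℝ), ∫ x in cell 1, ((heat x t - 1 : ℝ) : ℂ) * wave k x =
        ∫ t in Set.Ioi (0 : ℝ), ((Real.exp (-(Real.pi * N) * t) : ℝ) : ℂ) := by
      refine setIntegral_congr_fun measurableSet_Ioi fun t ht => ?_
      have hw := continuous_wave k
      have hh := continuous_heat_left ht
      have i1 : IntegrableOn (fun x => (heat x t : ℂ) * wave k x) (cell 1) :=
        (by fun_prop : Continuous fun x => (heat x t : ℂ) * wave k x).integrableOn_cell 1
      have h3 : ∀ x, ((heat x t - 1 : ℝ) : ℂ) * wave k x = (heat x t : ℂ) * wave k x - wave k x :=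
        fun x => by push_cast; ring
      simp only [h3]
      rw [integral_sub i1 (hw.integrableOn_cell 1), hIw, hheat t ht, sub_zero]
      congr 2
      ring
    rw [h2, integral_complex_ofReal, integral_exp_mul_Ioi (neg_neg_of_pos (by positivity))]
    congr 1
    rw [mul_zero, Real.exp_zero]
    field_simp
    norm_num
  · have h3 : Integrable (fun z : E3 × ℝ => ((heat z.1 z.2 - 1 : ℝ) : ℂ))
      ((volume.restrict (cell 1)).prod (volume.restrict (Set.Ioi 0))) := integrable_heat_prod.ofReal
    exact h3.mul_bdd (c := 1) ((continuous_wave k).comp continuous_fst).aestronglyMeasurable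
      (Eventually.of_forall fun z => (norm_wave k z.1).le)

/-! ### Existence of the periodic Coulomb potential -/

/-- The potential blows up at least like a constant over `|x|`: it is enough to keep one Gaussian
per coordinate during the times between `|x|²` and `4|x|²`, and to bound `heat - 1` below by `-1` or
by the tail otherwise. Near the lattice no minimum can then occur. -/
theorem le_greenFunction {x : E3} (hx : x ∈ (Set.range (latticePoint 1))ᶜ) (h0 : 0 < ‖x‖)
    (h1 : ‖x‖ ≤ 1 / 2) : 3 * Real.exp (-Real.pi) / 8 / ‖x‖ -
      (∫ t in Set.Ioi 0, if t ≤ 1 then 1 else heatTail t) ≤ greenFunction x := by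
  set r := ‖x‖ with hr
  -- A lower bound of the heat kernel on the window: `√t ≤ 2r` controls the prefactor, `t ≥ r²` the
  -- exponential. The window lies in `t ≤ 1` because `r ≤ 1/2`.
  set c := ((2 * r)⁻¹) ^ 3 * Real.exp (-Real.pi) with hc
  have hI : IntegrableOn ((Set.Icc (r ^ 2) (4 * r ^ 2)).indicator fun _ => c) (Set.Ioi 0) :=
    (integrable_indicator_iff measurableSet_Icc).2 (by
      refine (integrableOn_const (C := c) (μ := volume) (s := Set.Icc (r ^ 2) (4 * r ^ 2))
        (by simp)).mono_measure Measure.restrict_le_self)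
  have h2 : ∫ t in Set.Ioi (0 : ℝ), (Set.Icc (r ^ 2) (4 * r ^ 2)).indicator (fun _ => c) t =
      3 * r ^ 2 * c := by
    have hsub : Set.Icc (r ^ 2) (4 * r ^ 2) ⊆ Set.Ioi 0 := fun t ht =>
      lt_of_lt_of_le (by positivity) ht.1
    rw [integral_indicator measurableSet_Icc, Measure.restrict_restrict measurableSet_Icc,
      Set.inter_eq_left.2 hsub]
    simp only [integral_const, measureReal_restrict_apply, MeasurableSet.univ, Set.univ_inter,
      smul_eq_mul]
    rw [Real.volume_real_Icc_of_le (by nlinarith [sq_nonneg r])]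
    ring
  have h3 : 3 * r ^ 2 * c = 3 * Real.exp (-Real.pi) / 8 / r := by
    rw [hc]
    field_simp
    norm_num
  rw [← h3, ← h2, ← integral_sub hI (integrableOn_heatBound 1), greenFunction]
  refine setIntegral_mono_on (hI.sub (integrableOn_heatBound 1)) (integrableOn_heat_sub_one hx)
    measurableSet_Ioi fun t ht => ?_
  by_cases ht1 : t ≤ 1
  · rw [if_pos ht1]
    refine sub_le_sub_right ?_ 1
    by_cases hti : t ∈ Set.Icc (r ^ 2) (4 * r ^ 2)
    · rw [Set.indicator_of_mem hti]
      have ht0 : 0 < t := ht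
      have h4 : (2 * r)⁻¹ ≤ (Real.sqrt t)⁻¹ := by
        refine inv_anti₀ (Real.sqrt_pos.2 ht0) ((Real.sqrt_le_left (by positivity)).2 ?_)
        nlinarith [hti.2]
      calc c ≤ ((Real.sqrt t)⁻¹) ^ 3 * Real.exp (-Real.pi * r ^ 2 / t) := by
            rw [hc]
            gcongr
            rw [le_div_iff₀ ht0]
            nlinarith [Real.pi_pos, hti.1]
        _ = ∏ i, ((Real.sqrt t)⁻¹ * Real.exp (-Real.pi * x i ^ 2 / t)) := by
            rw [Finset.prod_mul_distrib, Finset.prod_const, ← Real.exp_sum, hr,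
              EuclideanSpace.norm_sq_eq, Finset.mul_sum, Finset.sum_div]
            simp
        _ ≤ heat x t := Finset.prod_le_prod (fun i _ => by positivity)
            fun i _ => gaussian_le_theta _ ht0
    · rw [Set.indicator_of_notMem hti]
      exact heat_nonneg x ht
  · rw [if_neg ht1, Set.indicator_of_notMem, zero_sub]
    · exact (abs_le.1 (abs_heat_sub_one_le x ht)).1
    · rintro ⟨-, h5⟩
      nlinarith

/-- On a small ball around the origin the potential exceeds its value at a corner of the cell. The
minimum is thus attained on the compact closed cell minus that ball, and periodicity extends it to
all points. -/
theorem exists_min_greenFunction : ∃ x ∈ (Set.range (latticePoint 1))ᶜ,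
    ∀ y ∈ (Set.range (latticePoint 1))ᶜ, greenFunction x ≤ greenFunction y := by
  have hhalf : (0 : ℝ) < 1 / 2 := by norm_num
  set x₁ : E3 := latticePoint (1 / 2) fun _ => 1 with hx₁
  have hx₁n : 1 / 2 ≤ ‖x₁‖ := le_norm_latticePoint hhalf fun h => by
    have := congrFun h 0
    simp at this
  set A := ∫ t in Set.Ioi (0 : ℝ), if t ≤ 1 then 1 else heatTail t
  have hA : 0 ≤ A := setIntegral_nonneg measurableSet_Ioi fun t ht => by
    split_ifs
    · exact zero_le_one
    · exact heatTail_nonneg ht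
  set c := 3 * Real.exp (-Real.pi) / 8 with hc
  have hc0 : 0 < c := by positivity
  -- If `|z| ≤ c / M`, the lower bound `c / |z| - A` is at least `|greenFunction x₁| + 1`.
  set M := |greenFunction x₁| + A + 1 with hM
  have hM0 : 0 < M := by positivity
  set r := min (1 / 2) (c / M) with hr
  have hr0 : 0 < r := lt_min hhalf (by positivity)
  set K : Set E3 := {x | ∀ i, x i ∈ Set.Icc (-((1 : ℝ) / 2)) (1 / 2)} \ Metric.ball 0 r with hK
  have hKc : IsCompact K := (isCompact_closedCell 1).diff Metric.isOpen_ball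
  have hKl : ∀ y ∈ K, y ∈ (Set.range (latticePoint 1))ᶜ := by
    rintro _ ⟨hy1, hy2⟩ ⟨n, rfl⟩
    refine hy2 ?_
    have hn : n = 0 := by
      funext i
      have h1 := hy1 i
      rw [latticePoint_apply, one_mul] at h1
      have h2 : (-1 : ℝ) < n i := by linarith [h1.1]
      have h3 : (n i : ℝ) < 1 := by linarith [h1.2]
      have h4 : -1 < n i := by exact_mod_cast h2
      have h5 : n i < 1 := by exact_mod_cast h3
      rw [Pi.zero_apply]
      omega
    rw [hn, latticePoint_zero]
    simpa using hr0
  have hx₁K : x₁ ∈ K := by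
    refine ⟨fun i => ?_, ?_⟩
    · rw [hx₁, latticePoint_apply]
      constructor <;> norm_num
    · simpa only [Metric.mem_ball, dist_zero_right, not_lt] using (min_le_left _ _).trans hx₁n
  obtain ⟨x, hxK, hmin⟩ := hKc.exists_isMinOn ⟨x₁, hx₁K⟩
    fun y hy => (continuousAt_greenFunction (hKl y hy)).continuousWithinAt
  refine ⟨x, hKl x hxK, fun y hy => ?_⟩
  obtain ⟨n, hn⟩ := exists_mem_cell one_pos y
  rw [← greenFunction_latticePeriodic n y]
  have hz : y + latticePoint 1 n ∈ (Set.range (latticePoint 1))ᶜ := by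
    rintro ⟨m, hm⟩
    exact hy ⟨m - n, by rw [latticePoint_sub, hm, add_sub_cancel_right]⟩
  set z := y + latticePoint 1 n
  by_cases hzr : z ∈ Metric.ball 0 r
  · have hz0 : 0 < ‖z‖ := norm_pos_iff.2 fun h => hz ⟨0, by rw [latticePoint_zero, h]⟩
    have hzr' : ‖z‖ < r := by simpa using hzr
    have h1 := le_greenFunction hz hz0 (hzr'.le.trans (min_le_left _ _))
    have h2 : M ≤ c / ‖z‖ := by
      rw [le_div_iff₀ hz0]
      have h3 := hzr'.le.trans (min_le_right _ _)
      rwa [le_div_iff₀ hM0, mul_comm] at h3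
    have h4 : greenFunction x ≤ greenFunction x₁ := hmin hx₁K
    have h5 := le_abs_self (greenFunction x₁)
    linarith
  · exact hmin ⟨cell_subset_closedCell 1 hn, hzr⟩

theorem HasCoulombCoeff.sub_const {L : ℝ} (hL : 0 < L) {W : E3 → ℝ} (hW : IntegrableOn W (cell L))
    (h : HasCoulombCoeff L W) (c : ℝ) : HasCoulombCoeff L fun x => W x - c := by
  intro n hn
  have hWc : IntegrableOn (fun x => (W x : ℂ)) (cell L) := hW.ofReal
  rw [← h n hn]
  have hIw := integral_wave hL n
  rw [if_neg hn] at hIw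
  have hcst : IntegrableOn (fun _ : E3 => (c : ℂ)) (cell L) := integrable_const _
  push_cast
  simp only [sub_mul]
  rw [integral_sub (integrable_mul_wave hWc _) (integrable_mul_wave hcst _), integral_const_mul,
    hIw, mul_zero, sub_zero]

theorem isTorusCoulomb_of_coeff {L : ℝ} (hL : 0 < L) {W : E3 → ℝ} (hp : LatticePeriodic L W)
    (hi : IntegrableOn W (cell L)) (hc : HasCoulombCoeff L W)
    (hcont : ContinuousOn W (Set.range (latticePoint L))ᶜ)
    (hmin : IsLeast (W '' (Set.range (latticePoint L))ᶜ) 0) : IsTorusCoulomb L W where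
  periodic := hp
  integrable := hi
  equation := fun _ hs hφ => hc.equation hL hi (contDiff_infty.1 hs 2) hφ
  continuous := hcont
  min_eq_zero := hmin

theorem exists_isTorusCoulomb_one : ∃ W, IsTorusCoulomb 1 W := by
  obtain ⟨x, hx, hmin⟩ := exists_min_greenFunction
  refine ⟨fun y => greenFunction y - greenFunction x, isTorusCoulomb_of_coeff one_pos
    (fun n y => by simp only [greenFunction_latticePeriodic n y])
    (integrableOn_greenFunction.sub (integrable_const _))
    (hasCoulombCoeff_greenFunction.sub_const one_pos integrableOn_greenFunction _)
    (fun y hy => ((continuousAt_greenFunction hy).sub continuousAt_const).continuousWithinAt)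
    ⟨⟨x, hx, sub_self _⟩, ?_⟩⟩
  rintro _ ⟨y, hy, rfl⟩
  exact sub_nonneg.2 (hmin y hy)

theorem smul_latticePoint (a b : ℝ) (n : Fin 3 → ℤ) :
    a • latticePoint b n = latticePoint (a * b) n := by
  ext i
  simp [latticePoint_apply, mul_assoc]

theorem inv_smul_mem_cell {L : ℝ} (hL : 0 < L) (x : E3) : L⁻¹ • x ∈ cell 1 ↔ x ∈ cell L := by
  refine forall_congr' fun i => ?_
  rw [PiLp.smul_apply, smul_eq_mul, Set.mem_Ico, Set.mem_Ico, inv_mul_eq_div, le_div_iff₀ hL,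
    div_lt_iff₀ hL]
  constructor <;> rintro ⟨h1, h2⟩ <;> constructor <;> linarith

theorem inv_smul_mem_range {L : ℝ} (hL : 0 < L) (x : E3) :
    L⁻¹ • x ∈ (Set.range (latticePoint 1))ᶜ ↔ x ∈ (Set.range (latticePoint L))ᶜ := by
  refine not_congr ⟨?_, ?_⟩
  · rintro ⟨n, hn⟩
    refine ⟨n, ?_⟩
    rw [← smul_inv_smul₀ hL.ne' x, ← hn, smul_latticePoint, mul_one]
  · rintro ⟨n, rfl⟩
    exact ⟨n, by rw [smul_latticePoint, inv_mul_cancel₀ hL.ne']⟩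

open scoped Pointwise in
theorem setIntegral_cell_comp_inv_smul {F : Type*} [NormedAddCommGroup F] [NormedSpace ℝ F]
    {L : ℝ} (hL : 0 < L) (f : E3 → F) :
    ∫ x in cell L, f (L⁻¹ • x) = L ^ 3 • ∫ x in cell 1, f x := by
  rw [Measure.setIntegral_comp_smul_of_pos volume f (cell L) (inv_pos.2 hL)]
  have h : L⁻¹ • cell L = cell 1 := by
    ext x
    rw [Set.mem_inv_smul_set_iff₀ hL.ne', ← inv_smul_mem_cell hL, inv_smul_smul₀ hL.ne']
  rw [h]
  simp

theorem integrableOn_cell_comp_inv_smul {F : Type*} [NormedAddCommGroup F]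
    {L : ℝ} (hL : 0 < L) {f : E3 → F} (hf : IntegrableOn f (cell 1)) :
    IntegrableOn (fun x => f (L⁻¹ • x)) (cell L) := by
  rw [← integrable_indicator_iff (measurableSet_cell _)] at hf ⊢
  refine (hf.comp_smul (inv_ne_zero hL.ne')).congr (Eventually.of_forall fun x => ?_)
  classical
  simp only [Set.indicator_apply, inv_smul_mem_cell hL]

/-- Coulomb scaling: `W_L` is `L⁻¹` times the unit potential at `x / L`, so existence on the unit
torus suffices. -/
theorem IsTorusCoulomb.rescale {L : ℝ} (hL : 0 < L) {W : E3 → ℝ} (h : IsTorusCoulomb 1 W) :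
    IsTorusCoulomb L fun x => L⁻¹ * W (L⁻¹ • x) := by
  refine isTorusCoulomb_of_coeff hL (fun n x => ?_)
    ((integrableOn_cell_comp_inv_smul hL h.integrable).const_mul _) (fun n hn => ?_) ?_ ?_
  · simp only [smul_add, smul_latticePoint, inv_mul_cancel₀ hL.ne', h.periodic n]
  · have h1 := h.hasCoulombCoeff one_pos n hn
    have h2 : ∀ x, wave (latticePoint (2 * Real.pi / L) n) x =
        wave (latticePoint (2 * Real.pi / 1) n) (L⁻¹ • x) := fun x => by
      rw [wave, wave, inner_smul_right, ← real_inner_smul_left, smul_latticePoint]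
      ring_nf
    have h3 : ∀ x, ((L⁻¹ * W (L⁻¹ • x) : ℝ) : ℂ) * wave (latticePoint (2 * Real.pi / L) n) x =
        (L⁻¹ : ℝ) * ((fun y => (W y : ℂ) * wave (latticePoint (2 * Real.pi / 1) n) y)
          (L⁻¹ • x)) := fun x => by
      rw [h2]; push_cast; ring
    simp only [h3]
    rw [integral_const_mul, setIntegral_cell_comp_inv_smul hL
      (fun y => (W y : ℂ) * wave (latticePoint (2 * Real.pi / 1) n) y), h1, Complex.real_smul,
      ← Complex.ofReal_mul, ← Complex.ofReal_mul]
    congr 1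
    rw [norm_latticePoint_sq, norm_latticePoint_sq]
    field_simp
  · refine continuousOn_const.mul (h.continuous.comp (by fun_prop) fun x hx => ?_)
    exact (inv_smul_mem_range hL x).2 hx
  · obtain ⟨⟨x, hx, hx0⟩, hmin⟩ := h.min_eq_zero
    refine ⟨⟨L • x, ?_, ?_⟩, ?_⟩
    · rwa [← inv_smul_mem_range hL, inv_smul_smul₀ hL.ne']
    · simp only [inv_smul_smul₀ hL.ne', hx0, mul_zero]
    · rintro _ ⟨y, hy, rfl⟩
      exact mul_nonneg (inv_nonneg.2 hL.le) (hmin ⟨_, (inv_smul_mem_range hL y).2 hy, rfl⟩)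

theorem ae_notMem_lattice (L : ℝ) : ∀ᵐ x : E3, x ∈ (Set.range (latticePoint L))ᶜ :=
  (Set.countable_range _).ae_notMem volume

/-- `torusCoulomb` is an epsilon choice; existence is what gives it its defining properties. -/
theorem isTorusCoulomb_torusCoulomb {L : ℝ} (hL : 0 < L) : IsTorusCoulomb L (torusCoulomb L) := by
  obtain ⟨W, hW⟩ := exists_isTorusCoulomb_one
  exact Classical.epsilon_spec ⟨_, hW.rescale hL⟩

/-- The scaling `L⁻¹ L³` of the zero mode. Divided by the volume it is of order `1 / L`, so the
normalization of `W_L` leaves no trace in the limit. -/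
theorem exists_integral_torusCoulomb :
    ∃ c : ℝ, ∀ L, 0 < L → ∫ x in cell L, torusCoulomb L x = c * L ^ 2 := by
  obtain ⟨W, hW⟩ := exists_isTorusCoulomb_one
  refine ⟨∫ x in cell 1, W x, fun L hL => ?_⟩
  have h : ∫ x in cell L, torusCoulomb L x = ∫ x in cell L, L⁻¹ * W (L⁻¹ • x) := by
    refine integral_congr_ae (ae_restrict_of_ae ?_)
    filter_upwards [ae_notMem_lattice L] with x hx
    exact (isTorusCoulomb_torusCoulomb hL).eq_of_notMem hL (hW.rescale hL) hx
  rw [h, integral_const_mul, setIntegral_cell_comp_inv_smul hL W, smul_eq_mul]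
  field_simp

theorem torusCoulomb_nonneg {L : ℝ} (hL : 0 < L) : ∀ᵐ x : E3, 0 ≤ torusCoulomb L x := by
  filter_upwards [ae_notMem_lattice L] with x hx
  exact (isTorusCoulomb_torusCoulomb hL).min_eq_zero.2 ⟨x, hx, rfl⟩

/-! ### The Hartree-Fock energy on the torus in Fourier variables -/

/-- The Fourier coefficients `∫ W_L(x) exp(i κ·x) dx` of the periodic Coulomb potential. -/
def coulombHat (L : ℝ) (κ : E3) : ℝ :=
  if κ = 0 then ∫ x in cell L, torusCoulomb L x else 4 * Real.pi * invSq κ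

theorem integral_torusCoulomb_wave {L : ℝ} (hL : 0 < L) {κ : E3} (hκ : κ ∈ lattice (2 * Real.pi / L)) :
    ∫ x in cell L, (torusCoulomb L x : ℂ) * wave κ x = coulombHat L κ := by
  obtain ⟨n, rfl⟩ := hκ
  change ∫ x in cell L, (torusCoulomb L x : ℂ) * wave (latticePoint (2 * Real.pi / L) n) x =
    coulombHat L (latticePoint (2 * Real.pi / L) n)
  by_cases hn : n = 0
  · subst hn
    simp only [latticePoint_zero, wave_zero_left, mul_one, coulombHat, if_true]
    exact integral_complex_ofReal
  · rw [(isTorusCoulomb_torusCoulomb hL).hasCoulombCoeff hL n hn, coulombHat, if_neg, invSq]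
    · rfl
    · intro h
      have h1 := le_norm_latticePoint (by positivity : 0 < 2 * Real.pi / L) hn
      rw [h, norm_zero] at h1
      have : 0 < 2 * Real.pi / L := by positivity
      linarith

theorem coulombHat_neg (L : ℝ) (κ : E3) : coulombHat L (-κ) = coulombHat L κ := by
  simp only [coulombHat, neg_eq_zero, invSq_neg]

/-- The normalization makes `W_L` nonnegative, hence its zero mode dominates every Fourier
coefficient. This supplies the kernel comparison at coincident momenta. -/
theorem coulombHat_le_zero {L : ℝ} (hL : 0 < L) {κ : E3} (hκ : κ ∈ lattice (2 * Real.pi / L)) :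
    coulombHat L κ ≤ coulombHat L 0 := by
  have h1 := integral_torusCoulomb_wave hL hκ
  have h2 : ‖∫ x in cell L, (torusCoulomb L x : ℂ) * wave κ x‖ ≤
      ∫ x in cell L, torusCoulomb L x := by
    refine (norm_integral_le_integral_norm _).trans (le_of_eq ?_)
    refine integral_congr_ae (ae_restrict_of_ae ?_)
    filter_upwards [torusCoulomb_nonneg hL] with x hx
    rw [norm_wave_mul_le, Complex.norm_real, Real.norm_of_nonneg hx]
  rw [h1, Complex.norm_real, Real.norm_eq_abs] at h2
  have h3 : coulombHat L 0 = ∫ x in cell L, torusCoulomb L x := if_pos rfl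
  rw [h3]
  exact (le_abs_self _).trans h2

theorem coulombHat_nonneg {L : ℝ} (hL : 0 < L) (κ : E3) : 0 ≤ coulombHat L κ := by
  rw [coulombHat]
  split_ifs
  · exact integral_nonneg_of_ae (ae_restrict_of_ae (torusCoulomb_nonneg hL))
  · exact mul_nonneg (by positivity) (invSq_nonneg _)

theorem latticePeriodic_of_mem {L : ℝ} (hL : L ≠ 0) {κ : E3} (hκ : κ ∈ lattice (2 * Real.pi / L)) :
    LatticePeriodic L (wave κ) := by
  obtain ⟨n, rfl⟩ := hκ
  exact wave_latticePeriodic hL n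

theorem integral_wave_of_mem {L : ℝ} (hL : 0 < L) {κ : E3} (hκ : κ ∈ lattice (2 * Real.pi / L)) :
    ∫ x in cell L, wave κ x = if κ = 0 then ((L ^ 3 : ℝ) : ℂ) else 0 := by
  obtain ⟨n, rfl⟩ := hκ
  change ∫ x in cell L, wave (latticePoint (2 * Real.pi / L) n) x =
    if latticePoint (2 * Real.pi / L) n = 0 then ((L ^ 3 : ℝ) : ℂ) else 0
  rw [integral_wave hL]
  congr 1
  rw [← latticePoint_zero (2 * Real.pi / L), (latticePoint_injective (by positivity)).eq_iff]

theorem integrable_wave_mul_torusCoulomb {L : ℝ} (hL : 0 < L) (μ x : E3) :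
    IntegrableOn (fun y => wave μ y * (torusCoulomb L (x - y) : ℂ)) (cell L) := by
  have hT := isTorusCoulomb_torusCoulomb hL
  have hp : LatticePeriodic L (torusCoulomb L) := hT.periodic
  have h1 : IntegrableOn (fun y => (torusCoulomb L (x - y) : ℂ)) (cell L) :=
    (hp.integrableOn_sub hL hT.integrable x).ofReal
  exact (integrable_mul_wave h1 μ).congr (Eventually.of_forall fun y => mul_comm _ _)

theorem integral_wave_mul_torusCoulomb {L : ℝ} (hL : 0 < L) {μ : E3}
    (hμ : μ ∈ lattice (2 * Real.pi / L)) (x : E3) :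
    ∫ y in cell L, wave μ y * (torusCoulomb L (x - y) : ℂ) = wave μ x * coulombHat L μ := by
  have hT := isTorusCoulomb_torusCoulomb hL
  have h1 : LatticePeriodic L fun y => wave μ (x - y) * (torusCoulomb L y : ℂ) := fun n y => by
    have h2 : x - (y + latticePoint L n) = x - y - latticePoint L n := by abel
    simp only [h2, (latticePeriodic_of_mem hL.ne' hμ).sub_latticePoint, hT.periodic n y]
  have h3 := h1.setIntegral_sub hL x
  simp only [sub_sub_cancel] at h3
  rw [h3, ← coulombHat_neg, ← integral_torusCoulomb_wave hL (neg_mem hμ), ← integral_const_mul]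
  refine integral_congr_ae (Eventually.of_forall fun y => ?_)
  simp only [wave_sub_right]
  ring

/-- The inner integral multiplies each wave by a Fourier coefficient of the potential; the outer one
selects pairs of opposite frequencies. -/
theorem integral_integral_sum_wave {ι : Type*} [Fintype ι] {L : ℝ} (hL : 0 < L) (c : ι → ℂ)
    {κ μ : ι → E3} (hκ : ∀ i, κ i ∈ lattice (2 * Real.pi / L))
    (hμ : ∀ i, μ i ∈ lattice (2 * Real.pi / L)) :
    ∫ x in cell L, ∫ y in cell L, (∑ i, c i * wave (κ i) x * wave (μ i) y) *
      (torusCoulomb L (x - y) : ℂ) =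
      (L ^ 3 : ℝ) * ∑ i, if κ i + μ i = 0 then c i * coulombHat L (μ i) else 0 := by
  have h1 : ∀ x, ∫ y in cell L, (∑ i, c i * wave (κ i) x * wave (μ i) y) *
      (torusCoulomb L (x - y) : ℂ) = ∑ i, c i * coulombHat L (μ i) * wave (κ i + μ i) x := by
    intro x
    simp only [Finset.sum_mul]
    have h2 : ∀ i y, c i * wave (κ i) x * wave (μ i) y * (torusCoulomb L (x - y) : ℂ) =
        c i * wave (κ i) x * (wave (μ i) y * (torusCoulomb L (x - y) : ℂ)) := fun i y => by ring
    simp only [h2]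
    rw [integral_finsetSum _ fun i _ => (integrable_wave_mul_torusCoulomb hL _ x).const_mul _]
    refine Finset.sum_congr rfl fun i _ => ?_
    rw [integral_const_mul, integral_wave_mul_torusCoulomb hL (hμ i), wave_add_left]
    ring
  simp only [h1]
  rw [integral_finsetSum _ fun i _ => (((continuous_wave _).integrableOn_cell L).const_mul _),
    Finset.mul_sum]
  refine Finset.sum_congr rfl fun i _ => ?_
  rw [integral_const_mul, integral_wave_of_mem hL (add_mem (hκ i) (hμ i))]
  split_ifs <;> ring

theorem integral_sum_norm_sq_mul_torusCoulomb {S ι : Type*} [Fintype S] [Fintype ι] {L : ℝ}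
    (hL : 0 < L) (c : S → ι → ℂ) {κ l : ι → E3} (hκ : ∀ i, κ i ∈ lattice (2 * Real.pi / L))
    (hl : ∀ i, l i ∈ lattice (2 * Real.pi / L)) :
    ∫ x in cell L, ∫ y in cell L, (∑ s, ‖∑ i, c s i * wave (κ i) x * wave (-l i) y‖ ^ 2) *
      torusCoulomb L (x - y) =
    L ^ 3 * ∑ i, ∑ j, (if κ i - κ j = l i - l j then coulombHat L (l i - l j) else 0) *
      ∑ s, (c s i * star (c s j)).re := by
  have h := integral_integral_sum_wave hL (ι := S × ι × ι)
    (fun z => c z.1 z.2.1 * star (c z.1 z.2.2)) (κ := fun z => κ z.2.1 - κ z.2.2)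
    (μ := fun z => -(l z.2.1 - l z.2.2)) (fun z => sub_mem (hκ _) (hκ _))
    (fun z => neg_mem (sub_mem (hl _) (hl _)))
  have h1 : ∀ x y, (∑ z : S × ι × ι, c z.1 z.2.1 * star (c z.1 z.2.2) *
      wave (κ z.2.1 - κ z.2.2) x * wave (-(l z.2.1 - l z.2.2)) y) * (torusCoulomb L (x - y) : ℂ) =
      (((∑ s, ‖∑ i, c s i * wave (κ i) x * wave (-l i) y‖ ^ 2) * torusCoulomb L (x - y) : ℝ) :
        ℂ) := by
    intro x y
    push_cast
    congr 1
    rw [Fintype.sum_prod_type]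
    refine Finset.sum_congr rfl fun s _ => ?_
    rw [Fintype.sum_prod_type, ← Complex.mul_conj', map_sum, Finset.sum_mul_sum]
    refine Finset.sum_congr rfl fun i _ => Finset.sum_congr rfl fun j _ => ?_
    have e1 : (starRingEnd ℂ) (c s j * wave (κ j) x * wave (-l j) y) =
        star (c s j) * wave (-κ j) x * wave (l j) y := by
      rw [map_mul, map_mul, ← Complex.star_def, star_wave, star_wave, neg_neg]
    rw [e1, sub_eq_add_neg, wave_add_left, neg_sub, sub_eq_add_neg, wave_add_left]
    ring
  simp only [h1, integral_complex_ofReal] at h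
  have h2 := congrArg Complex.re h
  rw [Complex.ofReal_re, Complex.re_ofReal_mul] at h2
  rw [h2]
  congr 1
  rw [Complex.re_sum, Fintype.sum_prod_type, Finset.sum_comm, Fintype.sum_prod_type]
  refine Finset.sum_congr rfl fun i _ => Finset.sum_congr rfl fun j _ => ?_
  rw [Finset.mul_sum]
  refine Finset.sum_congr rfl fun s _ => ?_
  simp only [coulombHat_neg, ← sub_eq_add_neg, sub_eq_zero]
  split_ifs
  · rw [Complex.re_mul_ofReal, mul_comm]
  · simp

/-- All Fourier coefficients of `W_L` are nonnegative, the zero mode included, so the form is a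
nonnegative combination of squared Fourier coefficients of `ρ`. -/
theorem integral_mul_star_mul_torusCoulomb_nonneg {ι : Type*} [Fintype ι] {L : ℝ} (hL : 0 < L)
    (c : ι → ℂ) {κ : ι → E3} (hκ : ∀ i, κ i ∈ lattice (2 * Real.pi / L)) {ρ : E3 → ℝ}
    (hρ : ∀ x, (ρ x : ℂ) = ∑ i, c i * wave (κ i) x) :
    0 ≤ ∫ x in cell L, ∫ y in cell L, ρ x * ρ y * torusCoulomb L (x - y) := by
  classical
  have h := integral_integral_sum_wave hL (ι := ι × ι) (fun z => c z.1 * star (c z.2))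
    (κ := fun z => κ z.1) (μ := fun z => -κ z.2) (fun z => hκ _) (fun z => neg_mem (hκ _))
  have h1 : ∀ x y, (∑ z : ι × ι, c z.1 * star (c z.2) * wave (κ z.1) x * wave (-κ z.2) y) *
      (torusCoulomb L (x - y) : ℂ) = ((ρ x * ρ y * torusCoulomb L (x - y) : ℝ) : ℂ) := by
    intro x y
    push_cast
    congr 1
    have h2 : (ρ y : ℂ) = ∑ i, star (c i) * wave (-κ i) y := by
      rw [← Complex.conj_ofReal, hρ, map_sum]
      refine Finset.sum_congr rfl fun i _ => ?_
      rw [map_mul, ← Complex.star_def, star_wave]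
    rw [h2, hρ, Finset.sum_mul_sum, Fintype.sum_prod_type]
    refine Finset.sum_congr rfl fun i _ => Finset.sum_congr rfl fun j _ => ?_
    ring
  simp only [h1, integral_complex_ofReal] at h
  have h2 := congrArg Complex.re h
  rw [Complex.ofReal_re, Complex.re_ofReal_mul] at h2
  rw [h2]
  refine mul_nonneg (by positivity) ?_
  -- Different indices may carry the same frequency, so the coefficients are first grouped by
  -- frequency; only then do squares appear.
  have h3 : (∑ z : ι × ι, if κ z.1 + -κ z.2 = 0 then c z.1 * star (c z.2) * coulombHat L (-κ z.2)
      else 0) = ∑ v ∈ Finset.univ.image κ, ((coulombHat L v *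
        ‖∑ i, if κ i = v then c i else 0‖ ^ 2 : ℝ) : ℂ) := by
    have h4 : ∀ v, ((coulombHat L v * ‖∑ i, if κ i = v then c i else 0‖ ^ 2 : ℝ) : ℂ) =
        ∑ i, ∑ j, if κ i = v then (if κ j = v then c i * star (c j) * coulombHat L v else 0)
          else 0 := fun v => by
      push_cast
      rw [← Complex.mul_conj', map_sum, Finset.sum_mul_sum, Finset.mul_sum]
      refine Finset.sum_congr rfl fun i _ => ?_
      rw [Finset.mul_sum]
      refine Finset.sum_congr rfl fun j _ => ?_
      split_ifs
      · rw [Complex.star_def]; ring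
      all_goals simp
    simp only [h4]
    rw [Finset.sum_comm, Fintype.sum_prod_type]
    refine Finset.sum_congr rfl fun i _ => ?_
    rw [Finset.sum_comm]
    refine Finset.sum_congr rfl fun j _ => ?_
    rw [Finset.sum_ite_eq (Finset.univ.image κ) (κ i)
      (fun v => if κ j = v then c i * star (c j) * (coulombHat L v : ℂ) else 0),
      if_pos (Finset.mem_image_of_mem κ (Finset.mem_univ i))]
    simp only [coulombHat_neg, ← sub_eq_add_neg, sub_eq_zero]
    by_cases hij : κ i = κ j
    · simp [hij]
    · rw [if_neg hij, if_neg (Ne.symm hij)]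
  rw [h3, Complex.re_sum]
  exact Finset.sum_nonneg fun v _ => by
    rw [Complex.ofReal_re]
    exact mul_nonneg (coulombHat_nonneg hL v) (by positivity)

/-! ### Momentum blocks, exchange energy and density -/

theorem mem_lattice_of_momenta {L Λ : ℝ} (k : momenta L Λ) : (k : E3) ∈ lattice (2 * Real.pi / L) := by
  obtain ⟨_, ⟨n, rfl⟩, -⟩ := k
  exact ⟨n, rfl⟩

/-- The `4 × 4` block `γ̂(k,l)`. -/
def block {L Λ : ℝ} (γ : TorusOp L Λ) (p : momenta L Λ × momenta L Λ) : M4 :=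
  Matrix.of fun σ τ => γ (σ, p.1) (τ, p.2)

/-- The real inner product of matrices. -/
def hsInner (A B : M4) : ℝ := ∑ s : Fin 4 × Fin 4, (A s.1 s.2 * star (B s.1 s.2)).re

theorem sq_cpow_three_half {L : ℝ} (hL : 0 < L) :
    ((L ^ (3 / 2 : ℝ) : ℝ) : ℂ) * ((L ^ (3 / 2 : ℝ) : ℝ) : ℂ) = ((L ^ 3 : ℝ) : ℂ) := by
  rw [← Complex.ofReal_mul, ← Real.rpow_add hL]
  norm_num

theorem planeWave_mul_star {L : ℝ} (hL : 0 < L) (k l x y : E3) :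
    planeWave L k x * star (planeWave L l y) = ((L ^ 3 : ℝ) : ℂ)⁻¹ * (wave k x * wave (-l) y) := by
  have h : ∀ k x, planeWave L k x = wave k x / ((L ^ (3 / 2 : ℝ) : ℝ) : ℂ) := fun _ _ => rfl
  rw [h, h, star_div₀, star_wave, Complex.star_def, Complex.conj_ofReal, div_mul_div_comm,
    sq_cpow_three_half hL, div_eq_inv_mul]

theorem kernel_apply {L Λ : ℝ} (hL : 0 < L) (γ : TorusOp L Λ) (x y : E3) (σ τ : Fin 4) :
    kernel γ x y σ τ = ∑ p : momenta L Λ × momenta L Λ,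
      ((L ^ 3 : ℝ) : ℂ)⁻¹ * block γ p σ τ * wave p.1 x * wave (-(p.2 : E3)) y := by
  rw [Fintype.sum_prod_type]
  simp only [kernel, Matrix.of_apply, block]
  refine Finset.sum_congr rfl fun k _ => Finset.sum_congr rfl fun l _ => ?_
  rw [mul_assoc, planeWave_mul_star hL]
  ring

theorem hsNormSq_eq_sum (A : M4) : hsNormSq A = ∑ s : Fin 4 × Fin 4, ‖A s.1 s.2‖ ^ 2 := by
  rw [Fintype.sum_prod_type]
  rfl

/-- The coefficients of the exchange energy. -/
def pairWeight {L Λ : ℝ} (p q : momenta L Λ × momenta L Λ) : ℝ :=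
  if (p.1 : E3) - q.1 = (p.2 : E3) - q.2 then coulombHat L ((p.2 : E3) - q.2) else 0

/-- The exchange energy in Fourier variables. -/
def exchange {L Λ : ℝ} (γ : TorusOp L Λ) : ℝ :=
  ∑ p, ∑ q, pairWeight p q * hsInner (block γ p) (block γ q)

theorem integral_hsNormSq_kernel {L Λ : ℝ} (hL : 0 < L) (γ : TorusOp L Λ) :
    ∫ x in cell L, ∫ y in cell L, hsNormSq (kernel γ x y) * torusCoulomb L (x - y) =
      (L ^ 3)⁻¹ * exchange γ := by
  have h := integral_sum_norm_sq_mul_torusCoulomb hL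
    (fun (s : Fin 4 × Fin 4) (p : momenta L Λ × momenta L Λ) =>
      ((L ^ 3 : ℝ) : ℂ)⁻¹ * block γ p s.1 s.2) (κ := fun p => (p.1 : E3)) (l := fun p => (p.2 : E3))
    (fun p => mem_lattice_of_momenta _) (fun p => mem_lattice_of_momenta _)
  simp only [hsNormSq_eq_sum, kernel_apply hL]
  rw [h, exchange, Finset.mul_sum, Finset.mul_sum]
  refine Finset.sum_congr rfl fun p _ => ?_
  rw [Finset.mul_sum, Finset.mul_sum]
  refine Finset.sum_congr rfl fun q _ => ?_
  rw [hsInner, pairWeight, mul_left_comm, mul_left_comm ((L ^ 3)⁻¹)]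
  congr 1
  rw [Finset.mul_sum, Finset.mul_sum]
  refine Finset.sum_congr rfl fun s _ => ?_
  have h1 : ((L ^ 3 : ℝ) : ℂ)⁻¹ * block γ p s.1 s.2 * star (((L ^ 3 : ℝ) : ℂ)⁻¹ * block γ q s.1 s.2) =
      (((L ^ 3)⁻¹ * (L ^ 3)⁻¹ : ℝ) : ℂ) * (block γ p s.1 s.2 * star (block γ q s.1 s.2)) := by
    rw [star_mul', ← Complex.ofReal_inv, Complex.star_def, Complex.conj_ofReal]
    push_cast
    ring
  rw [h1, Complex.re_ofReal_mul]
  field_simp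

theorem kernel_diag_isHermitian {L Λ : ℝ} {γ : TorusOp L Λ} (hγ : γ.IsHermitian) (x : E3) :
    (kernel γ x x).IsHermitian := by
  ext σ τ
  rw [Matrix.conjTranspose_apply]
  simp only [kernel, Matrix.of_apply, star_sum, star_mul', star_star]
  rw [Finset.sum_comm]
  refine Finset.sum_congr rfl fun k _ => Finset.sum_congr rfl fun l _ => ?_
  rw [hγ.apply]
  ring

theorem density_eq {L Λ : ℝ} (hL : 0 < L) {γ : TorusOp L Λ} (hγ : γ.IsHermitian) (x : E3) :
    (density γ x : ℂ) = ∑ p : momenta L Λ × momenta L Λ,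
      (((L ^ 3 : ℝ) : ℂ)⁻¹ * (block γ p).trace) * wave ((p.1 : E3) - p.2) x := by
  have h1 : ((kernel γ x x).trace.re : ℂ) = (kernel γ x x).trace := by
    rw [← Complex.conj_eq_iff_re, ← Complex.star_def, ← Matrix.trace_conjTranspose,
      (kernel_diag_isHermitian hγ x).eq]
  rw [density, h1, Matrix.trace]
  simp only [Matrix.diag_apply, kernel_apply hL]
  rw [Finset.sum_comm]
  refine Finset.sum_congr rfl fun p _ => ?_
  rw [Matrix.trace, Finset.mul_sum, Finset.sum_mul]
  refine Finset.sum_congr rfl fun σ _ => ?_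
  rw [sub_eq_add_neg, wave_add_left, Matrix.diag_apply]
  ring

theorem density_energy_nonneg {L Λ : ℝ} (hL : 0 < L) {γ : TorusOp L Λ} (hγ : γ.IsHermitian) :
    0 ≤ ∫ x in cell L, ∫ y in cell L, density γ x * density γ y * torusCoulomb L (x - y) :=
  integral_mul_star_mul_torusCoulomb_nonneg hL
    (fun p : momenta L Λ × momenta L Λ => ((L ^ 3 : ℝ) : ℂ)⁻¹ * (block γ p).trace)
    (κ := fun p => (p.1 : E3) - p.2)
    (fun p => sub_mem (mem_lattice_of_momenta p.1) (mem_lattice_of_momenta p.2))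
    (ρ := density γ) (density_eq hL hγ)

theorem block_fourierMultiplier {L Λ : ℝ} (f : momenta L Λ → M4) (p : momenta L Λ × momenta L Λ) :
    block (fourierMultiplier f) p = if p.1 = p.2 then f p.1 else 0 := by
  ext σ τ
  simp only [block, fourierMultiplier, Matrix.of_apply, Matrix.blockDiagonal_apply]
  split_ifs <;> rfl

theorem fourierMultiplier_isHermitian {L Λ : ℝ} {f : momenta L Λ → M4}
    (hf : ∀ k, (f k).IsHermitian) : (fourierMultiplier f).IsHermitian := by
  rw [Matrix.IsHermitian, fourierMultiplier, Matrix.blockDiagonal_conjTranspose]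
  congr 1
  funext k
  exact (hf k).eq

/-- Only diagonal blocks are present and they are traceless. This removes the direct term at the
candidate minimizer. -/
theorem density_fourierMultiplier {L Λ : ℝ} (hL : 0 < L) {f : momenta L Λ → M4}
    (hf : ∀ k, (f k).IsHermitian) (hf0 : ∀ k, (f k).trace = 0) (x : E3) :
    density (fourierMultiplier f) x = 0 := by
  have h := density_eq hL (fourierMultiplier_isHermitian hf) x
  rw [Finset.sum_eq_zero] at h
  · exact_mod_cast h
  · intro p _
    rw [block_fourierMultiplier]
    split_ifs
    · rw [hf0]; simp
    · simp

/-! ### The mean-field equation on the torus -/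

variable {α m L Λ θ : ℝ}

/-- The reflections of the momenta. -/
def torusReflect (L Λ : ℝ) (i : Fin 3) (k : momenta L Λ) : momenta L Λ :=
  ⟨reflect i k, by
    obtain ⟨_, ⟨n, rfl⟩, hn⟩ := k
    refine ⟨⟨fun j => if j = i then -n j else n j, ?_⟩, ?_⟩
    · ext j
      rw [reflect_apply, latticePoint_apply, latticePoint_apply]
      split_ifs <;> push_cast <;> ring
    · simpa using hn⟩

theorem torusReflect_involutive (L Λ : ℝ) (i : Fin 3) : Function.Involutive (torusReflect L Λ i) :=
  fun k => Subtype.ext (reflect_reflect i k)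

/-- The interaction kernel on the torus. -/
def torusKernel (α L Λ : ℝ) (k l : momenta L Λ) : ℝ :=
  α / 2 * (L ^ 3)⁻¹ * coulombHat L ((k : E3) - l)

theorem torusKernel_comm (α L Λ : ℝ) (k l : momenta L Λ) :
    torusKernel α L Λ k l = torusKernel α L Λ l k := by
  rw [torusKernel, torusKernel, ← coulombHat_neg, neg_sub]

/-- For distinct momenta it is the geometric comparison of `invSq`; the sign condition excludes `k =
reflect i l` with `k ≠ l`. For `k = l` it is the maximality of the zero mode. -/
theorem coulombHat_reflect_le (hL : 0 < L) (i : Fin 3) {k l : momenta L Λ}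
    (h : 0 ≤ (k : E3) i * (l : E3) i) :
    coulombHat L ((k : E3) - reflect i l) ≤ coulombHat L ((k : E3) - l) := by
  rcases eq_or_ne (k : E3) l with hkl | hkl
  · have h1 : (reflect i l : E3) ∈ lattice (2 * Real.pi / L) :=
      mem_lattice_of_momenta (torusReflect L Λ i l)
    rw [← hkl, sub_self]
    rw [← hkl] at h1
    exact coulombHat_le_zero hL (sub_mem (mem_lattice_of_momenta k) h1)
  · have h1 : (k : E3) - reflect i l ≠ 0 := by
      intro h2
      have h3 : (k : E3) = reflect i l := sub_eq_zero.1 h2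
      have h4 : (k : E3) i = -(l : E3) i := by rw [h3, reflect_apply, if_pos rfl]
      have h5 : (l : E3) i = 0 := by nlinarith [sq_nonneg ((l : E3) i)]
      refine hkl (h3.trans ?_)
      ext j
      rw [reflect_apply]
      split_ifs with hj
      · rw [hj, h5, neg_zero]
      · rfl
    rw [coulombHat, if_neg h1, coulombHat, if_neg (sub_ne_zero.2 hkl)]
    exact mul_le_mul_of_nonneg_left (invSq_sub_reflect hkl h) (by positivity)

theorem coulombHat_reflect (i : Fin 3) (κ : E3) : coulombHat L (reflect i κ) = coulombHat L κ := by
  simp only [coulombHat, invSq, LinearIsometryEquiv.norm_map, EmbeddingLike.map_eq_zero_iff]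

/-- The abstract mean-field theory with counting measure on the finite set of momenta. The Schur
bound is left as a hypothesis because it is available only for large `L`. -/
theorem isMeanField_torus (hα : 0 ≤ α) (hm : 0 < m) (hL : 0 < L) (hθ : 0 ≤ θ)
    (hS : ∀ k : momenta L Λ, ∑ l, torusKernel α L Λ k l * weight Λ m l ≤
      θ * ‖diracVec m k‖ * weight Λ m k) :
    IsMeanField Measure.count (torusKernel α L Λ) (fun k => diracVec m k) (torusReflect L Λ)
      (fun k => weight Λ m k) θ m (Λ ^ 2 + m ^ 2)⁻¹ (m ^ 2)⁻¹ where
  m_pos := hm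
  c_pos := by positivity
  θ_nonneg := hθ
  X_cont := continuous_of_discreteTopology
  X_ge p := by simp [diracVec]
  X_r i p := diracVec_reflect m i p
  r_invol i p := torusReflect_involutive L Λ i p
  integral_r i f := by
    rw [integral_count, integral_count]
    exact Equiv.sum_comp (torusReflect_involutive L Λ i).toPerm f
  K_nonneg p q := mul_nonneg (by positivity) (coulombHat_nonneg hL _)
  K_r i p q := by
    rw [torusKernel, torusKernel]
    congr 1
    exact (congrArg (coulombHat L) (map_sub (reflect i) (p : E3) q).symm).trans
      (coulombHat_reflect i _)
  K_le i p := by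
    refine Eventually.of_forall fun q => ?_
    rw [diracVec_castSucc, diracVec_castSucc]
    have ha : 0 ≤ α / 2 * (L ^ 3)⁻¹ := by positivity
    refine ⟨fun h => mul_le_mul_of_nonneg_left (coulombHat_reflect_le hL i h) ha,
      fun h => mul_le_mul_of_nonneg_left ?_ ha⟩
    have h1 := coulombHat_reflect_le hL i (k := p) (l := torusReflect L Λ i q)
      (by change 0 ≤ (p : E3) i * (reflect i (q : E3)) i; simp [reflect_apply]; linarith)
    have h2 : (reflect i (torusReflect L Λ i q : E3)) = q := reflect_reflect i (q : E3)
    rwa [h2] at h1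
  pot_cont g M hg hM := continuous_of_discreteTopology
  smul_int g M hg hM p := Integrable.of_finite
  h_cont := continuous_of_discreteTopology
  h_ge k := weight_ge Λ hm k
  h_le k := weight_le Λ hm k
  schur_int p := Integrable.of_finite
  schur p := by
    rw [integral_count]
    exact hS p

/-- The constants match since `(α/2) L⁻³ * 4π = α / (4π²) * (2π/L)³`. As `invSq 0 = 0`, the diagonal
enters the lattice sum with weight zero and the zero mode appears as a separate term. -/
theorem sum_torusKernel_smul {F : Type*} [NormedAddCommGroup F] [NormedSpace ℝ F] (hL : 0 < L)
    (k : momenta L Λ) (ψ : E3 → F) :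
    ∑ l : momenta L Λ, torusKernel α L Λ k l • ψ l =
      (α / 2 * (L ^ 3)⁻¹ * ∫ x in cell L, torusCoulomb L x) • ψ k +
      (α / (4 * Real.pi ^ 2)) • ((2 * Real.pi / L) ^ 3 •
        ∑ l : momenta L Λ, invSq ((k : E3) - l) • ψ l) := by
  have h1 : ∀ l : momenta L Λ, torusKernel α L Λ k l • ψ l =
      (if k = l then (α / 2 * (L ^ 3)⁻¹ * ∫ x in cell L, torusCoulomb L x) • ψ l else 0) +
        (α / (4 * Real.pi ^ 2)) • ((2 * Real.pi / L) ^ 3 • (invSq ((k : E3) - l) • ψ l)) := by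
    intro l
    by_cases hkl : k = l
    · simp [hkl, torusKernel, coulombHat, invSq]
    · have h2 : (k : E3) - l ≠ 0 := sub_ne_zero.2 fun h => hkl (Subtype.ext h)
      rw [if_neg hkl, zero_add, torusKernel, coulombHat, if_neg h2, smul_smul, smul_smul]
      congr 1
      field_simp
      norm_num
  simp only [h1]
  rw [Finset.sum_add_distrib, Finset.sum_ite_eq, if_pos (Finset.mem_univ k), ← Finset.smul_sum,
    ← Finset.smul_sum]

theorem tendsto_torusKernel_diag (α : ℝ) : Tendsto
    (fun L : ℝ => α / 2 * (L ^ 3)⁻¹ * ∫ x in cell L, torusCoulomb L x) atTop (𝓝 0) := by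
  obtain ⟨c, hc⟩ := exists_integral_torusCoulomb
  have h1 : Tendsto (fun L : ℝ => α / 2 * c * L⁻¹) atTop (𝓝 (α / 2 * c * 0)) :=
    tendsto_inv_atTop_zero.const_mul _
  rw [mul_zero] at h1
  refine h1.congr' ?_
  filter_upwards [eventually_gt_atTop 0] with L hL
  rw [hc L hL]
  field_simp

/-- Potentials on the torus converge to those in the whole space, uniformly on the momenta. -/
theorem eventually_torusKernel_potential {F : Type*} [NormedAddCommGroup F] [NormedSpace ℝ F]
    [CompleteSpace F] (hα : 0 ≤ α) {M : ℝ} {ψ : E3 → F}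
    (hψ : ContinuousOn ψ (Metric.ball 0 Λ)) (hM : ∀ q ∈ Metric.ball (0 : E3) Λ, ‖ψ q‖ ≤ M)
    {ε : ℝ} (hε : 0 < ε) :
    ∀ᶠ L : ℝ in atTop, ∀ k : momenta L Λ,
      ‖∑ l : momenta L Λ, torusKernel α L Λ k l • ψ l -
        ∫ q in Metric.ball (0 : E3) Λ, (α / (4 * Real.pi ^ 2) * invSq ((k : E3) - q)) • ψ q‖ ≤
          ε := by
  set a := α / (4 * Real.pi ^ 2) with ha
  have ha0 : 0 ≤ a := by positivity
  have hd := (tendsto_torusKernel_diag α).norm.mul_const |M|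
  rw [norm_zero, zero_mul] at hd
  filter_upwards [eventually_riemannSum_potential hψ hM
    (by positivity : 0 < ε / 2 / (a + 1)), hd.eventually (eventually_le_nhds (half_pos hε)),
    eventually_gt_atTop 0] with L h1 h2 hL k
  rw [sum_torusKernel_smul hL]
  have h6 : ∫ q in Metric.ball (0 : E3) Λ, (a * invSq ((k : E3) - q)) • ψ q =
      a • ∫ q in Metric.ball (0 : E3) Λ, invSq ((k : E3) - q) • ψ q := by
    simp only [mul_smul, integral_smul]
  rw [h6, add_sub_assoc, ← smul_sub]
  refine (norm_add_le _ _).trans ?_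
  rw [norm_smul _ (ψ k), norm_smul a, Real.norm_of_nonneg ha0]
  have h3 : ‖α / 2 * (L ^ 3)⁻¹ * ∫ x in cell L, torusCoulomb L x‖ * ‖ψ k‖ ≤ ε / 2 :=
    (mul_le_mul_of_nonneg_left ((hM k k.2.2).trans (le_abs_self M)) (norm_nonneg _)).trans h2
  have h4 : a * (ε / 2 / (a + 1)) ≤ ε / 2 := by
    rw [mul_div_assoc', div_le_iff₀ (by positivity)]
    nlinarith
  have h5 := mul_le_mul_of_nonneg_left (h1 k) ha0
  linarith

/-- The sums of the weight converge uniformly to the continuum integrals. The slack `(θ - α π / 4)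
|X| h` is bounded below by a positive constant and absorbs the error. -/
theorem eventually_schur (hα : 0 ≤ α) (hm : 0 < m) (hΛ : 0 < Λ) (hθ : α * Real.pi / 4 < θ) :
    ∀ᶠ L : ℝ in atTop, ∀ k : momenta L Λ, ∑ l, torusKernel α L Λ k l * weight Λ m l ≤
      θ * ‖diracVec m k‖ * weight Λ m k := by
  have H := isMeanField_ball (α := α) hα hm hΛ
  have hε : 0 < (θ - α * Real.pi / 4) * m * (Λ ^ 2 + m ^ 2)⁻¹ := by
    have := sub_pos.2 hθ
    positivity
  filter_upwards [eventually_torusKernel_potential (Λ := Λ) hα (continuous_weight Λ hm).continuousOn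
    (M := (m ^ 2)⁻¹) (fun q _ => by
      rw [Real.norm_of_nonneg (weight_pos Λ hm q).le]; exact weight_le Λ hm q) hε] with L h k
  have h1 := (abs_le.1 (h k)).2
  have h2 := H.schur (k : E3)
  simp only [smul_eq_mul] at h1
  have h3 : (θ - α * Real.pi / 4) * m * (Λ ^ 2 + m ^ 2)⁻¹ ≤
      (θ - α * Real.pi / 4) * ‖diracVec m (k : E3)‖ * weight Λ m k := by
    have h4 := H.le_norm_X (k : E3)
    have h5 := weight_ge Λ hm (k : E3)
    have h6 := sub_pos.2 hθ
    gcongr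
  linarith

/-! ### The energy difference -/

theorem block_add (γ Q : TorusOp L Λ) (p : momenta L Λ × momenta L Λ) :
    block (γ + Q) p = block γ p + block Q p := rfl

theorem hsInner_comm (A B : M4) : hsInner A B = hsInner B A := by
  refine Finset.sum_congr rfl fun s _ => ?_
  rw [← Complex.conj_re, map_mul, ← Complex.star_def, star_star, mul_comm]

theorem hsInner_add_left (A B C : M4) : hsInner (A + B) C = hsInner A C + hsInner B C := by
  simp only [hsInner, Matrix.add_apply, add_mul, Complex.add_re, Finset.sum_add_distrib]

theorem hsInner_add_right (A B C : M4) : hsInner A (B + C) = hsInner A B + hsInner A C := by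
  rw [hsInner_comm, hsInner_add_left, hsInner_comm B, hsInner_comm C]

theorem hsInner_zero_left (A : M4) : hsInner 0 A = 0 := by simp [hsInner]

theorem two_mul_hsInner_le (A B : M4) {t : ℝ} (ht : 0 < t) :
    2 * hsInner A B ≤ t * hsNormSq A + t⁻¹ * hsNormSq B := by
  rw [hsInner, hsNormSq_eq_sum, hsNormSq_eq_sum, Finset.mul_sum, Finset.mul_sum, Finset.mul_sum,
    ← Finset.sum_add_distrib]
  refine Finset.sum_le_sum fun s _ => ?_
  have h1 : (A s.1 s.2 * star (B s.1 s.2)).re ≤ ‖A s.1 s.2‖ * ‖B s.1 s.2‖ := by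
    refine (Complex.re_le_norm _).trans ?_
    rw [norm_mul, norm_star]
  have h2 : 2 * (‖A s.1 s.2‖ * ‖B s.1 s.2‖) ≤ t * ‖A s.1 s.2‖ ^ 2 + t⁻¹ * ‖B s.1 s.2‖ ^ 2 := by
    have h3 : t * ‖A s.1 s.2‖ ^ 2 + t⁻¹ * ‖B s.1 s.2‖ ^ 2 - 2 * (‖A s.1 s.2‖ * ‖B s.1 s.2‖) =
        t⁻¹ * (t * ‖A s.1 s.2‖ - ‖B s.1 s.2‖) ^ 2 := by
      field_simp
      ring
    have h4 : 0 ≤ t⁻¹ * (t * ‖A s.1 s.2‖ - ‖B s.1 s.2‖) ^ 2 := by positivity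
    linarith
  linarith

theorem hsInner_spinState (v : E4) (A : M4) : hsInner (spinState v) A = -(1 / 2) * cliffPairing A v := by
  rw [← trace_mul_spinState, hsInner_comm, hsInner, Matrix.trace, Complex.re_sum,
    Fintype.sum_prod_type]
  refine Finset.sum_congr rfl fun σ _ => ?_
  rw [Matrix.diag_apply, Matrix.mul_apply, Complex.re_sum]
  refine Finset.sum_congr rfl fun τ _ => ?_
  rw [(spinState_isHermitian v).apply]

theorem pairWeight_comm (p q : momenta L Λ × momenta L Λ) : pairWeight p q = pairWeight q p := by
  simp only [pairWeight]
  have h : ((p.1 : E3) - q.1 = (p.2 : E3) - q.2) ↔ ((q.1 : E3) - p.1 = (q.2 : E3) - p.2) := by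
    rw [← neg_inj, neg_sub, neg_sub]
  rw [← coulombHat_neg, neg_sub]
  by_cases h1 : (p.1 : E3) - q.1 = (p.2 : E3) - q.2
  · rw [if_pos h1, if_pos (h.1 h1)]
  · rw [if_neg h1, if_neg (fun h2 => h1 (h.2 h2))]

theorem pairWeight_nonneg (hL : 0 < L) (p q : momenta L Λ × momenta L Λ) : 0 ≤ pairWeight p q := by
  rw [pairWeight]
  split_ifs
  · exact coulombHat_nonneg hL _
  · exact le_rfl

theorem exchange_add (γ Q : TorusOp L Λ) : exchange (γ + Q) = exchange γ +
    2 * (∑ p, ∑ q, pairWeight p q * hsInner (block γ p) (block Q q)) + exchange Q := by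
  have h1 : ∑ p, ∑ q, pairWeight p q * hsInner (block Q p) (block γ q) =
      ∑ p, ∑ q, pairWeight p q * hsInner (block γ p) (block Q q) := by
    rw [Finset.sum_comm]
    refine Finset.sum_congr rfl fun p _ => Finset.sum_congr rfl fun q _ => ?_
    rw [pairWeight_comm, hsInner_comm]
  simp only [exchange, block_add, hsInner_add_left, hsInner_add_right, mul_add,
    Finset.sum_add_distrib]
  rw [h1]
  ring

/-- Momentum conservation couples diagonal blocks with diagonal blocks only, so a
translation-invariant state does not see the off-diagonal part of `Q` in the cross term. -/
theorem sum_pairWeight_diag (f : momenta L Λ → M4) (Q : TorusOp L Λ) :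
    ∑ p, ∑ q, pairWeight p q * hsInner (block (fourierMultiplier f) p) (block Q q) =
      ∑ k : momenta L Λ, ∑ l : momenta L Λ, coulombHat L ((k : E3) - l) * hsInner (f k) (block Q (l, l)) := by
  simp only [block_fourierMultiplier]
  rw [Fintype.sum_prod_type]
  refine Finset.sum_congr rfl fun k _ => ?_
  rw [Finset.sum_eq_single k]
  · rw [Fintype.sum_prod_type]
    refine Finset.sum_congr rfl fun l _ => ?_
    rw [Finset.sum_eq_single l]
    · simp [pairWeight]
    · intro l' _ hl
      rw [pairWeight, if_neg, zero_mul]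
      intro h
      exact hl (Subtype.ext (sub_right_injective h)).symm
    · simp
  · intro k' _ hk
    simp [Ne.symm hk, hsInner_zero_left]
  · simp

/-- Schur's test with a weight depending on the first momentum only. Given `p` and the first
momentum of `q`, conservation leaves at most one second momentum, so the row sums are no larger than
those of the kernel on single momenta. -/
theorem exchange_le_schur (hL : 0 < L) (Q : TorusOp L Λ) {h : momenta L Λ → ℝ}
    (hh : ∀ k, 0 < h k) : exchange Q ≤ ∑ p : momenta L Λ × momenta L Λ, hsNormSq (block Q p) *
      ((∑ k : momenta L Λ, coulombHat L ((p.1 : E3) - k) * h k) / h p.1) := by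
  set S := ∑ p : momenta L Λ × momenta L Λ, ∑ q : momenta L Λ × momenta L Λ,
    pairWeight p q * (hsNormSq (block Q p) * (h q.1 / h p.1)) with hS
  have h1 : 2 * exchange Q ≤ S + S := by
    have h2 : S = ∑ p : momenta L Λ × momenta L Λ, ∑ q : momenta L Λ × momenta L Λ,
        pairWeight p q * (hsNormSq (block Q q) * (h p.1 / h q.1)) := by
      rw [hS, Finset.sum_comm]
      refine Finset.sum_congr rfl fun p _ => Finset.sum_congr rfl fun q _ => ?_
      rw [pairWeight_comm]
    nth_rw 2 [h2]
    rw [hS, ← Finset.sum_add_distrib, exchange, Finset.mul_sum]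
    refine Finset.sum_le_sum fun p _ => ?_
    rw [← Finset.sum_add_distrib, Finset.mul_sum]
    refine Finset.sum_le_sum fun q _ => ?_
    have h3 := two_mul_hsInner_le (block Q p) (block Q q) (div_pos (hh q.1) (hh p.1))
    rw [inv_div] at h3
    have h4 := mul_le_mul_of_nonneg_left h3 (pairWeight_nonneg hL p q)
    linarith
  have h5 : S ≤ ∑ p : momenta L Λ × momenta L Λ, hsNormSq (block Q p) *
      ((∑ k : momenta L Λ, coulombHat L ((p.1 : E3) - k) * h k) / h p.1) := by
    refine Finset.sum_le_sum fun p _ => ?_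
    rw [Finset.sum_div, Finset.mul_sum, Fintype.sum_prod_type]
    refine Finset.sum_le_sum fun k _ => ?_
    have h6 : ∑ l, pairWeight p (k, l) * (hsNormSq (block Q p) * (h k / h p.1)) =
        (∑ l, pairWeight p (k, l)) * (hsNormSq (block Q p) * (h k / h p.1)) :=
      (Finset.sum_mul _ _ _).symm
    have h7 : ∑ l, pairWeight p (k, l) ≤ coulombHat L ((p.1 : E3) - k) := by
      by_cases hex : ∃ l : momenta L Λ, (p.1 : E3) - k = (p.2 : E3) - l
      · obtain ⟨l, hl⟩ := hex
        rw [Finset.sum_eq_single l]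
        · simp only [pairWeight, ← hl]
          exact le_rfl
        · intro l' _ hl'
          refine if_neg fun h8 => hl' ?_
          simp only at h8
          rw [hl] at h8
          exact Subtype.ext (sub_right_injective h8).symm
        · simp
      · rw [Finset.sum_eq_zero]
        · exact coulombHat_nonneg hL _
        · intro l _
          exact if_neg fun h8 => hex ⟨l, h8⟩
    rw [h6]
    have h9 : 0 ≤ hsNormSq (block Q p) * (h k / h p.1) :=
      mul_nonneg (hsNormSq_nonneg _) (div_pos (hh _) (hh _)).le
    calc _ ≤ coulombHat L ((p.1 : E3) - k) * (hsNormSq (block Q p) * (h k / h p.1)) := by gcongr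
      _ = _ := by ring
  linarith

theorem trace_fourierMultiplier_mul (f : momenta L Λ → M4) (Q : TorusOp L Λ) :
    (fourierMultiplier f * Q).trace = ∑ k, (f k * block Q (k, k)).trace := by
  simp only [Matrix.trace, Matrix.diag_apply]
  rw [Fintype.sum_prod_type, Finset.sum_comm]
  refine Finset.sum_congr rfl fun k _ => Finset.sum_congr rfl fun σ _ => ?_
  rw [Matrix.mul_apply, Matrix.mul_apply, Fintype.sum_prod_type]
  refine Finset.sum_congr rfl fun τ _ => ?_
  rw [Finset.sum_eq_single k]
  · simp [fourierMultiplier, Matrix.blockDiagonal_apply, block]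
  · intro l _ hl
    simp [fourierMultiplier, Matrix.blockDiagonal_apply, Ne.symm hl]
  · simp

theorem trace_D0_mul_re (Q : TorusOp L Λ) :
    (fourierMultiplier (fun k : momenta L Λ => D0 m k) * Q).trace.re =
      ∑ k : momenta L Λ, cliffPairing (block Q (k, k)) (diracVec m k) := by
  rw [trace_fourierMultiplier_mul, Complex.re_sum]
  refine Finset.sum_congr rfl fun k _ => ?_
  rw [cliffPairing_apply, D0_eq_cliff, Matrix.trace_mul_comm]

theorem torusEnergy_eq (hL : 0 < L) (γ : TorusOp L Λ) : torusEnergy α m L Λ γ =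
    (∑ k : momenta L Λ, cliffPairing (block γ (k, k)) (diracVec m k)) +
      α / 2 * (∫ x in cell L, ∫ y in cell L, density γ x * density γ y * torusCoulomb L (x - y)) -
      α / 2 * ((L ^ 3)⁻¹ * exchange γ) := by
  rw [torusEnergy, trace_D0_mul_re, integral_hsNormSq_kernel hL]

/-- The translation-invariant state with symbol `spinState ∘ N`. -/
def spinMultiplier (N : momenta L Λ → E4) : TorusOp L Λ := fourierMultiplier fun k => spinState (N k)

/-- The mean field on the torus. -/
def torusField (α m L Λ : ℝ) (N : momenta L Λ → E4) (k : momenta L Λ) : E4 :=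
  diracVec m k + ∑ l, torusKernel α L Λ k l • N l

theorem field_count (N : momenta L Λ → E4) :
    IsMeanField.field Measure.count (torusKernel α L Λ) (fun k => diracVec m k) N =
      torusField α m L Λ N := by
  funext k
  rw [IsMeanField.field, integral_count, torusField]

/-- Written through `N` and its field, the energy is a single sum over momenta, whose limit follows
from uniform convergence of both. -/
theorem torusEnergy_spinMultiplier (hL : 0 < L) (N : momenta L Λ → E4) :
    torusEnergy α m L Λ (spinMultiplier N) =
      -∑ k : momenta L Λ, (inner ℝ (N k) (diracVec m k) + inner ℝ (N k) (torusField α m L Λ N k)) := by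
  have h1 : ∀ k : momenta L Λ, cliffPairing (block (spinMultiplier N) (k, k)) (diracVec m k) =
      -2 * inner ℝ (N k) (diracVec m k) := fun k => by
    have h2 := trace_spinState_mul (N k) (diracVec m k)
    rw [trace_mul_spinState] at h2
    rw [spinMultiplier, block_fourierMultiplier, if_pos rfl]
    linarith
  have h3 : exchange (spinMultiplier N) =
      ∑ k : momenta L Λ, ∑ l : momenta L Λ, coulombHat L ((k : E3) - l) * inner ℝ (N k) (N l) := by
    rw [exchange, spinMultiplier, sum_pairWeight_diag]
    refine Finset.sum_congr rfl fun k _ => Finset.sum_congr rfl fun l _ => ?_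
    rw [block_fourierMultiplier, if_pos rfl, hsInner_spinState, ← trace_mul_spinState,
      trace_spinState_mul, real_inner_comm]
  rw [torusEnergy_eq hL, h3]
  simp only [h1]
  have h4 : ∀ x, density (spinMultiplier N) x = 0 := density_fourierMultiplier hL
    (fun k => spinState_isHermitian _) (fun k => trace_spinState _)
  simp only [h4, zero_mul, integral_zero, mul_zero, add_zero]
  have h5 : ∀ k, inner ℝ (N k) (torusField α m L Λ N k) = inner ℝ (N k) (diracVec m k) +
      ∑ l : momenta L Λ, α / 2 * (L ^ 3)⁻¹ * (coulombHat L ((k : E3) - l) * inner ℝ (N k) (N l)) := by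
    intro k
    rw [torusField, inner_add_right, inner_sum]
    congr 1
    refine Finset.sum_congr rfl fun l _ => ?_
    rw [inner_smul_right, torusKernel]
    ring
  simp only [h5, ← Finset.mul_sum, Finset.sum_add_distrib]
  ring

/-- The inequality `R² ≤ R`, traced over the spinor indices at momentum `k`. Keeping the
off-diagonal blocks in the row is what controls states that are not translation-invariant. -/
theorem hsNormSq_block_add_le {γ : TorusOp L Λ} (hγ : γ ∈ torusStates L Λ) (k : momenta L Λ) :
    hsNormSq (block γ (k, k) + (1 / 2 : ℂ) • (1 : M4)) +
      ∑ l ∈ Finset.univ.erase k, hsNormSq (block γ (k, l)) ≤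
      (block γ (k, k) + (1 / 2 : ℂ) • (1 : M4)).trace.re := by
  set R := γ + (1 / 2 : ℂ) • (1 : TorusOp L Λ) with hR
  have h1 := fun σ => norm_entry_le_of_state hγ.2.1 hγ.2.2 (σ, k)
  have h2 : ∀ σ τ l, R (σ, k) (τ, l) = if l = k then
      (block γ (k, k) + (1 / 2 : ℂ) • (1 : M4)) σ τ else block γ (k, l) σ τ := by
    intro σ τ l
    rw [hR, Matrix.add_apply, Matrix.smul_apply, Matrix.one_apply]
    split_ifs with h3 h4 h4
    · subst h4
      have h5 : σ = τ := congrArg Prod.fst h3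
      simp [block, h5]
    · exact absurd (congrArg Prod.snd h3).symm h4
    · subst h4
      have h5 : σ ≠ τ := fun h => h3 (by rw [h])
      simp [block, h5]
    · simp [block]
  have h3 : hsNormSq (block γ (k, k) + (1 / 2 : ℂ) • (1 : M4)) +
      ∑ l ∈ Finset.univ.erase k, hsNormSq (block γ (k, l)) =
      ∑ σ, ∑ j, ‖R (σ, k) j‖ ^ 2 := by
    have h4 : ∀ σ, ∑ j, ‖R (σ, k) j‖ ^ 2 = ∑ l, ∑ τ, ‖R (σ, k) (τ, l)‖ ^ 2 := fun σ => by
      rw [Fintype.sum_prod_type, Finset.sum_comm]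
    simp only [h4]
    rw [Finset.sum_comm, ← Finset.add_sum_erase _ _ (Finset.mem_univ k)]
    congr 1
    · simp only [h2, if_true]
      rfl
    · refine Finset.sum_congr rfl fun l hl => ?_
      simp only [h2, if_neg (Finset.ne_of_mem_erase hl)]
      rfl
  rw [h3, Matrix.trace, Complex.re_sum]
  refine Finset.sum_le_sum fun σ _ => (h1 σ).trans (le_of_eq ?_)
  rw [← hR, h2, if_pos rfl, Matrix.diag_apply]

/-- Coercivity on the torus: the first variation dominates `∑ |X| |Q|²` over all blocks, the
exchange energy of `Q` takes back at most the fraction `θ`, and the direct term only helps. -/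
theorem torusEnergy_sub_ge (hα : 0 ≤ α) (hm : 0 < m) (hL : 0 < L) (hθ : 0 ≤ θ)
    (hS : ∀ k : momenta L Λ, ∑ l, torusKernel α L Λ k l * weight Λ m l ≤
      θ * ‖diracVec m k‖ * weight Λ m k) {N : momenta L Λ → E4}
    (hN : IsMeanField.Cone (fun k : momenta L Λ => diracVec m k) (torusReflect L Λ) N)
    (hfix : ∀ k, N k = ‖torusField α m L Λ N k‖⁻¹ • torusField α m L Λ N k)
    {γ : TorusOp L Λ} (hγ : γ ∈ torusStates L Λ) :
    (1 - θ) * ∑ p : momenta L Λ × momenta L Λ,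
      ‖diracVec m p.1‖ * hsNormSq (block (γ - spinMultiplier N) p) ≤
      torusEnergy α m L Λ γ - torusEnergy α m L Λ (spinMultiplier N) := by
  have H := isMeanField_torus hα hm hL hθ hS
  set Q := γ - spinMultiplier N with hQ
  have hγQ : γ = spinMultiplier N + Q := by rw [hQ, add_sub_cancel]
  set Y := torusField α m L Λ N with hY
  have hXY : ∀ k : momenta L Λ, ‖diracVec m (k : E3)‖ ≤ ‖Y k‖ := fun k => by
    have := H.norm_le_norm_field hN k
    rwa [field_count] at this
  have hYpos : ∀ k, 0 < ‖Y k‖ := fun k => by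
    have := H.field_pos hN k
    rwa [field_count] at this
  have hN1 : ∀ k, ‖N k‖ = 1 := fun k => by
    rw [hfix, norm_smul, norm_inv, norm_norm, inv_mul_cancel₀ (hYpos k).ne']
  have hYN : ∀ k, Y k = ‖Y k‖ • N k := fun k => by
    rw [hfix k, smul_inv_smul₀ (hYpos k).ne']
  have hdiag : ∀ k, ∑ l, hsNormSq (block Q (k, l)) ≤ cliffPairing (block Q (k, k)) (N k) := by
    intro k
    have h1 := hsNormSq_add_le_trace_cliff_mul (hN1 k) _ _ (hsNormSq_block_add_le hγ k)
    have h2 : block γ (k, k) + (1 / 2 : ℂ) • (1 : M4) - (spinState (N k) + (1 / 2 : ℂ) • (1 : M4)) =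
        block Q (k, k) := by
      rw [hγQ, block_add, spinMultiplier, block_fourierMultiplier, if_pos rfl]
      abel
    have h3 : ∀ l ∈ Finset.univ.erase k, hsNormSq (block γ (k, l)) = hsNormSq (block Q (k, l)) := by
      intro l hl
      rw [hγQ, block_add, spinMultiplier, block_fourierMultiplier,
        if_neg (Finset.ne_of_mem_erase hl).symm, zero_add]
    rw [h2, Finset.sum_congr rfl h3, Finset.add_sum_erase _ (fun l => hsNormSq (block Q (k, l)))
      (Finset.mem_univ k)] at h1
    rwa [cliffPairing_apply, Matrix.trace_mul_comm]
  have hex := exchange_le_schur hL Q (h := fun k => weight Λ m k) fun k => weight_pos Λ hm k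
  have hex2 : α / 2 * ((L ^ 3)⁻¹ * exchange Q) ≤
      ∑ p : momenta L Λ × momenta L Λ, θ * (‖diracVec m p.1‖ * hsNormSq (block Q p)) := by
    have h1 : 0 ≤ α / 2 * (L ^ 3)⁻¹ := by positivity
    rw [← mul_assoc]
    refine (mul_le_mul_of_nonneg_left hex h1).trans ?_
    rw [Finset.mul_sum]
    refine Finset.sum_le_sum fun p _ => ?_
    have hw := weight_pos Λ hm (p.1 : E3)
    have h2 : α / 2 * (L ^ 3)⁻¹ * ((∑ k : momenta L Λ, coulombHat L ((p.1 : E3) - k) *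
        weight Λ m k) / weight Λ m p.1) ≤ θ * ‖diracVec m (p.1 : E3)‖ := by
      rw [mul_div_assoc', div_le_iff₀ hw, Finset.mul_sum]
      refine le_trans (le_of_eq ?_) (hS p.1)
      refine Finset.sum_congr rfl fun k _ => ?_
      rw [torusKernel]
      ring
    have h3 := mul_le_mul_of_nonneg_left h2 (hsNormSq_nonneg (block Q p))
    linarith
  -- The factor two of the cross term and the `-1/2` in `spinState` turn it into minus the pairing
  -- with the potential part of the field, so the linear terms add up to the pairing with `Y`.
  have hcross : α * (L ^ 3)⁻¹ * ∑ p, ∑ q, pairWeight p q *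
      hsInner (block (spinMultiplier N) p) (block Q q) =
      -∑ k : momenta L Λ, cliffPairing (block Q (k, k)) (Y k - diracVec m k) := by
    rw [spinMultiplier, sum_pairWeight_diag, Finset.sum_comm, Finset.mul_sum,
      ← Finset.sum_neg_distrib]
    refine Finset.sum_congr rfl fun k _ => ?_
    rw [hY, torusField, add_sub_cancel_left, map_sum, Finset.mul_sum, ← Finset.sum_neg_distrib]
    refine Finset.sum_congr rfl fun l _ => ?_
    rw [hsInner_spinState, map_smul, smul_eq_mul, torusKernel_comm, torusKernel]
    ring
  -- The direct term vanishes at the solution, so its contribution to the difference is its own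
  -- nonnegative value at `γ`.
  have hdens := density_energy_nonneg hL hγ.1
  have hE0 := torusEnergy_eq (α := α) (m := m) hL (spinMultiplier N)
  have h4 : ∀ x, density (spinMultiplier N) x = 0 := density_fourierMultiplier hL
    (fun k => spinState_isHermitian _) (fun k => trace_spinState _)
  simp only [h4, zero_mul, integral_zero, mul_zero, add_zero] at hE0
  have hE := torusEnergy_eq (α := α) (m := m) hL γ
  have hlin : ∀ k : momenta L Λ, cliffPairing (block γ (k, k)) (diracVec m k) =
      cliffPairing (block (spinMultiplier N) (k, k)) (diracVec m k) +
        cliffPairing (block Q (k, k)) (diracVec m k) := fun k => by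
    rw [hγQ, block_add, cliffPairing_apply, cliffPairing_apply, cliffPairing_apply, add_mul,
      Matrix.trace_add, Complex.add_re]
  have hexadd := exchange_add (spinMultiplier N) Q
  rw [← hγQ] at hexadd
  simp only [hlin, Finset.sum_add_distrib] at hE
  rw [hexadd] at hE
  have hmain : ∑ p : momenta L Λ × momenta L Λ, ‖diracVec m p.1‖ * hsNormSq (block Q p) ≤
      ∑ k : momenta L Λ, cliffPairing (block Q (k, k)) (Y k) := by
    rw [Fintype.sum_prod_type]
    refine Finset.sum_le_sum fun k _ => ?_
    simp only
    rw [← Finset.mul_sum, hYN k, map_smul, smul_eq_mul]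
    exact mul_le_mul (hXY k) (hdiag k) (Finset.sum_nonneg fun l _ => hsNormSq_nonneg _)
      (norm_nonneg _)
  simp only [map_sub, Finset.sum_sub_distrib] at hcross
  rw [← Finset.mul_sum] at hex2
  have hd2 := mul_nonneg (div_nonneg hα zero_le_two) hdens
  linarith

/-! ### The minimizer on the torus -/

variable {α m L Λ θ : ℝ}

theorem spinState_sub (v w : E4) : spinState v - spinState w = spinState (v - w) := by
  simp only [spinState, map_sub, smul_sub]

theorem spinMultiplier_add_half (N : momenta L Λ → E4) :
    spinMultiplier N + (1 / 2 : ℂ) • (1 : TorusOp L Λ) =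
      fourierMultiplier fun k => spinState (N k) + (1 / 2 : ℂ) • (1 : M4) := by
  have h : (1 / 2 : ℂ) • (1 : TorusOp L Λ) =
      fourierMultiplier fun _ : momenta L Λ => (1 / 2 : ℂ) • (1 : M4) := by
    rw [fourierMultiplier, ← Matrix.blockDiagonal_one, ← Matrix.blockDiagonal_smul]
    rfl
  rw [h, spinMultiplier, fourierMultiplier, fourierMultiplier, ← Matrix.blockDiagonal_add]
  rfl

theorem isStarProjection_fourierMultiplier {f : momenta L Λ → M4}
    (hf : ∀ k, IsStarProjection (f k)) : IsStarProjection (fourierMultiplier f) := by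
  refine ⟨?_, fourierMultiplier_isHermitian fun k => (hf k).isSelfAdjoint⟩
  rw [IsIdempotentElem, fourierMultiplier, ← Matrix.blockDiagonal_mul]
  congr 1
  funext k
  exact (hf k).isIdempotentElem

/-- `N` solves the self-consistent equation on the torus. -/
structure IsTorusSolution (α m L Λ : ℝ) (N : momenta L Λ → E4) : Prop where
  cone : IsMeanField.Cone (fun k : momenta L Λ => diracVec m k) (torusReflect L Λ) N
  fixed : ∀ k, N k = ‖torusField α m L Λ N k‖⁻¹ • torusField α m L Λ N k

theorem exists_isTorusSolution (hα : 0 ≤ α) (hm : 0 < m) (hL : 0 < L) (hθ : 0 ≤ θ) (hθ1 : θ < 1)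
    (hS : ∀ k : momenta L Λ, ∑ l, torusKernel α L Λ k l * weight Λ m l ≤
      θ * ‖diracVec m k‖ * weight Λ m k) : ∃ N, IsTorusSolution α m L Λ N := by
  obtain ⟨N, h1, h2⟩ := (isMeanField_torus hα hm hL hθ hS).exists_solution hθ1
  refine ⟨N, h1, ?_⟩
  rwa [field_count] at h2

theorem IsTorusSolution.norm_eq_one (hα : 0 ≤ α) (hm : 0 < m) (hL : 0 < L) (hθ : 0 ≤ θ)
    (hS : ∀ k : momenta L Λ, ∑ l, torusKernel α L Λ k l * weight Λ m l ≤
      θ * ‖diracVec m k‖ * weight Λ m k) {N : momenta L Λ → E4} (hN : IsTorusSolution α m L Λ N)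
    (k : momenta L Λ) : ‖N k‖ = 1 := by
  have h := (isMeanField_torus hα hm hL hθ hS).field_pos hN.cone k
  rw [field_count] at h
  rw [hN.fixed, norm_smul, norm_inv, norm_norm, inv_mul_cancel₀ h.ne']

theorem IsTorusSolution.isStarProjection (hα : 0 ≤ α) (hm : 0 < m) (hL : 0 < L) (hθ : 0 ≤ θ)
    (hS : ∀ k : momenta L Λ, ∑ l, torusKernel α L Λ k l * weight Λ m l ≤
      θ * ‖diracVec m k‖ * weight Λ m k) {N : momenta L Λ → E4} (hN : IsTorusSolution α m L Λ N) :
    IsStarProjection (spinMultiplier N + (1 / 2 : ℂ) • (1 : TorusOp L Λ)) := by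
  rw [spinMultiplier_add_half]
  exact isStarProjection_fourierMultiplier fun k =>
    spinState_isStarProjection (hN.norm_eq_one hα hm hL hθ hS k)

theorem IsTorusSolution.mem_torusStates (hα : 0 ≤ α) (hm : 0 < m) (hL : 0 < L) (hθ : 0 ≤ θ)
    (hS : ∀ k : momenta L Λ, ∑ l, torusKernel α L Λ k l * weight Λ m l ≤
      θ * ‖diracVec m k‖ * weight Λ m k) {N : momenta L Λ → E4} (hN : IsTorusSolution α m L Λ N) :
    spinMultiplier N ∈ torusStates L Λ := by
  have h := state_of_isStarProjection (hN.isStarProjection hα hm hL hθ hS)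
  rwa [add_sub_cancel_right] at h

theorem sum_hsNormSq_block_nonneg (Q : TorusOp L Λ) :
    0 ≤ ∑ p : momenta L Λ × momenta L Λ, ‖diracVec m p.1‖ * hsNormSq (block Q p) :=
  Finset.sum_nonneg fun _ _ => mul_nonneg (norm_nonneg _) (hsNormSq_nonneg _)

theorem IsTorusSolution.isMinOn (hα : 0 ≤ α) (hm : 0 < m) (hL : 0 < L) (hθ : 0 ≤ θ) (hθ1 : θ < 1)
    (hS : ∀ k : momenta L Λ, ∑ l, torusKernel α L Λ k l * weight Λ m l ≤
      θ * ‖diracVec m k‖ * weight Λ m k) {N : momenta L Λ → E4} (hN : IsTorusSolution α m L Λ N) :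
    IsMinOn (torusEnergy α m L Λ) (torusStates L Λ) (spinMultiplier N) := by
  intro γ hγ
  have h := torusEnergy_sub_ge hα hm hL hθ hS hN.cone hN.fixed hγ
  have h2 := mul_nonneg (sub_nonneg.2 hθ1.le)
    (sum_hsNormSq_block_nonneg (m := m) (γ - spinMultiplier N))
  change torusEnergy α m L Λ (spinMultiplier N) ≤ torusEnergy α m L Λ γ
  linarith

theorem IsTorusSolution.unique (hα : 0 ≤ α) (hm : 0 < m) (hL : 0 < L) (hθ : 0 ≤ θ) (hθ1 : θ < 1)
    (hS : ∀ k : momenta L Λ, ∑ l, torusKernel α L Λ k l * weight Λ m l ≤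
      θ * ‖diracVec m k‖ * weight Λ m k) {N : momenta L Λ → E4} (hN : IsTorusSolution α m L Λ N)
    {γ : TorusOp L Λ} (hγ : γ ∈ torusStates L Λ)
    (hmin : IsMinOn (torusEnergy α m L Λ) (torusStates L Λ) γ) : γ = spinMultiplier N := by
  have h := torusEnergy_sub_ge hα hm hL hθ hS hN.cone hN.fixed hγ
  have h1 : torusEnergy α m L Λ γ ≤ torusEnergy α m L Λ (spinMultiplier N) :=
    hmin (hN.mem_torusStates hα hm hL hθ hS)
  have h2 : ∑ p : momenta L Λ × momenta L Λ, ‖diracVec m p.1‖ *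
      hsNormSq (block (γ - spinMultiplier N) p) = 0 := by
    refine le_antisymm ?_ (sum_hsNormSq_block_nonneg _)
    have h3 := sub_pos.2 hθ1
    by_contra! h4
    have h5 := mul_pos h3 h4
    linarith
  rw [Finset.sum_eq_zero_iff_of_nonneg fun _ _ => mul_nonneg (norm_nonneg _) (hsNormSq_nonneg _)]
    at h2
  rw [← sub_eq_zero]
  ext ⟨σ, k⟩ ⟨τ, l⟩
  have h3 := h2 (k, l) (Finset.mem_univ _)
  have h4 : ‖diracVec m (k : E3)‖ ≠ 0 := by
    have h5 := (isMeanField_torus hα hm hL hθ hS).le_norm_X k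
    exact (hm.trans_le h5).ne'
  have h6 : hsNormSq (block (γ - spinMultiplier N) (k, l)) = 0 :=
    (mul_eq_zero.1 h3).resolve_left h4
  rw [hsNormSq_eq_sum, Finset.sum_eq_zero_iff_of_nonneg fun _ _ => by positivity] at h6
  have h7 := h6 (σ, τ) (Finset.mem_univ _)
  have h8 : block (γ - spinMultiplier N) (k, l) σ τ = 0 := by simpa using h7
  exact h8

theorem kernel_fourierMultiplier (hL : 0 < L) (f : momenta L Λ → M4) (x y : E3) :
    kernel (fourierMultiplier f) x y =
      (((2 * Real.pi) ^ (-(3 / 2) : ℝ) : ℝ) : ℂ) • inverseFourier f (x - y) := by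
  ext σ τ
  rw [kernel_apply hL, Matrix.smul_apply, inverseFourier, Matrix.smul_apply, Matrix.sum_apply,
    Fintype.sum_prod_type, smul_smul, Finset.smul_sum]
  refine Finset.sum_congr rfl fun k _ => ?_
  rw [Finset.sum_eq_single k]
  · have h : (((2 * Real.pi) ^ (-(3 / 2) : ℝ) : ℝ) : ℂ) *
        (((2 * Real.pi / L) ^ (3 / 2 : ℝ) : ℝ) : ℂ) / ((L ^ (3 / 2 : ℝ) : ℝ) : ℂ) =
        ((L ^ 3 : ℝ) : ℂ)⁻¹ := by
      rw [← sq_cpow_three_half hL, Real.div_rpow (by positivity) hL.le,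
        Real.rpow_neg (by positivity)]
      have h1 : ((2 * Real.pi) ^ (3 / 2 : ℝ) : ℝ) ≠ 0 := (Real.rpow_pos_of_pos (by positivity) _).ne'
      have h2 : (L ^ (3 / 2 : ℝ) : ℝ) ≠ 0 := (Real.rpow_pos_of_pos hL _).ne'
      norm_cast
      field_simp
    rw [block_fourierMultiplier, if_pos rfl, Matrix.smul_apply, smul_eq_mul, smul_eq_mul, ← h]
    have h3 : planeWave L k (x - y) = wave k x * wave (-(k : E3)) y / ((L ^ (3 / 2 : ℝ) : ℝ) : ℂ) := by
      rw [← wave_sub_right]; rfl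
    rw [h3]
    ring
  · intro l _ hl
    simp [block_fourierMultiplier, Ne.symm hl]
  · simp

/-! ### The thermodynamic limit -/

/-- The mean field in the whole space. -/
def freeField (α m Λ : ℝ) (N : E3 → E4) : E3 → E4 :=
  IsMeanField.field (volume.restrict (Metric.ball 0 Λ))
    (fun p q => α / (4 * Real.pi ^ 2) * invSq (p - q)) (diracVec m) N

/-- `N` solves the self-consistent equation in the whole space. -/
structure IsFreeSolution (α m Λ : ℝ) (N : E3 → E4) : Prop where
  cone : IsMeanField.Cone (diracVec m) (fun i => reflect i) N
  fixed : ∀ p, N p = ‖freeField α m Λ N p‖⁻¹ • freeField α m Λ N p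

theorem exists_isFreeSolution (hα : 0 ≤ α) (hα1 : α * Real.pi / 4 < 1) (hm : 0 < m) (hΛ : 0 < Λ) :
    ∃ N, IsFreeSolution α m Λ N := by
  obtain ⟨N, h1, h2⟩ := (isMeanField_ball hα hm hΛ).exists_solution hα1
  exact ⟨N, h1, h2⟩

theorem zero_mem_momenta (L : ℝ) (hΛ : 0 < Λ) : (0 : E3) ∈ momenta L Λ :=
  ⟨⟨0, latticePoint_zero _⟩, by simpa using hΛ⟩

theorem norm_diracVec_le_of_mem (m : ℝ) {p : E3} (hp : p ∈ Metric.ball (0 : E3) Λ) :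
    ‖diracVec m p‖ ≤ √(Λ ^ 2 + m ^ 2) := by
  rw [norm_diracVec]
  have h : ‖p‖ < Λ := by simpa using hp
  have := norm_nonneg p
  exact Real.sqrt_le_sqrt (by gcongr)

/-- The solutions on the torus converge to the solution in the whole space, uniformly. -/
theorem eventually_torusSolution_close (hα : 0 ≤ α) (hα1 : α * Real.pi / 4 < 1) (hm : 0 < m)
    (hΛ : 0 < Λ) {N : E3 → E4} (hN : IsFreeSolution α m Λ N) {ε : ℝ} (hε : 0 < ε) :
    ∀ᶠ L : ℝ in atTop, ∀ N' : momenta L Λ → E4, IsTorusSolution α m L Λ N' → ∀ k,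
      ‖N' k - N k‖ ≤ ε ∧ ‖torusField α m L Λ N' k - freeField α m Λ N k‖ ≤ ε := by
  obtain ⟨θ, hθ, hθ1⟩ := exists_between hα1
  have hθ0 : 0 ≤ θ := le_trans (by positivity) hθ.le
  have H := isMeanField_ball hα hm hΛ
  set B := √(Λ ^ 2 + m ^ 2)
  -- Comes from `(1 - θ) d h ≤ δ / m` at the maximizing momentum together with `h ≥ (Λ² + m²)⁻¹`.
  -- The constant `C` below covers the resulting errors of both the solution and its field.
  set D := (Λ ^ 2 + m ^ 2) / (m * (1 - θ)) with hD
  have h1θ : 0 < 1 - θ := sub_pos.2 hθ1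
  have hD0 : 0 < D := by positivity
  have hB0 : 0 ≤ B := Real.sqrt_nonneg _
  set C := D * (m ^ 2)⁻¹ + D * (m ^ 2)⁻¹ * B + 1 with hC
  have hC0 : 0 < C := by positivity
  set δ := ε / C with hδ
  have hδ0 : 0 < δ := by positivity
  filter_upwards [eventually_schur hα hm hΛ hθ, eventually_torusKernel_potential (Λ := Λ) hα
    (ψ := N) (M := 1) hN.cone.cont.continuousOn (fun q _ => hN.cone.le_one q) hδ0,
    eventually_gt_atTop 0] with L hS hpot hL N' hN'
  have HT := isMeanField_torus hα hm hL hθ0 hS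
  -- The whole-space solution restricts to the torus cone, so it may be inserted into the torus
  -- contraction as an approximate fixed point.
  have hcone : IsMeanField.Cone (fun k : momenta L Λ => diracVec m k) (torusReflect L Λ)
      fun k => N k :=
    ⟨continuous_of_discreteTopology, fun k => hN.cone.le_one _, fun i k => hN.cone.refl i k,
      fun j k => hN.cone.sign j k⟩
  set X : momenta L Λ → E4 := fun k => diracVec m k
  set h : momenta L Λ → ℝ := fun k => weight Λ m k
  have hh : ∀ k, 0 < h k := fun k => weight_pos Λ hm _
  have hfield : ∀ k : momenta L Λ,
      ‖torusField α m L Λ (fun k => N k) k - freeField α m Λ N k‖ ≤ δ := fun k => by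
    have := hpot k
    rwa [torusField, freeField, IsMeanField.field, add_sub_add_left_eq_sub]
  have hne : Nonempty (momenta L Λ) := ⟨⟨0, zero_mem_momenta L hΛ⟩⟩
  obtain ⟨k₀, hk₀⟩ := Finite.exists_max fun k => ‖N' k - N k‖ / h k
  set d := ‖N' k₀ - N k₀‖ / h k₀ with hd
  have hd0 : 0 ≤ d := div_nonneg (norm_nonneg _) (hh _).le
  have hdk : ∀ k, ‖N' k - N k‖ ≤ d * h k := fun k => (div_le_iff₀ (hh k)).1 (hk₀ k)
  -- `N` is compared with `N'` through one torus iteration of `N`: contraction bounds the distance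
  -- of that iterate to `N'`, and convergence of potentials bounds its distance to `N`.
  have hstep : ∀ k, ‖N' k - N k‖ ≤ θ * d * h k + m⁻¹ * δ := by
    intro k
    have h1 := HT.normalize_sub_le hN'.cone hcone hdk k
    rw [field_count, field_count, ← hN'.fixed] at h1
    have h2 : m ≤ ‖torusField α m L Λ (fun k => N k) k‖ := by
      have h3 := (HT.le_norm_X k).trans (HT.norm_le_norm_field hcone k)
      rwa [field_count] at h3
    have h3 : m ≤ ‖freeField α m Λ N k‖ :=
      (H.le_norm_X (k : E3)).trans (H.norm_le_norm_field hN.cone (k : E3))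
    have h4 := norm_normalize_sub_le hm h2 h3
    rw [← hN.fixed] at h4
    have h5 := mul_le_mul_of_nonneg_left (hfield k) (inv_nonneg.2 hm.le)
    have h6 := norm_sub_le_norm_sub_add_norm_sub (N' k)
      (‖torusField α m L Λ (fun k => N k) k‖⁻¹ • torusField α m L Λ (fun k => N k) k) (N k)
    linarith
  have hdD : d ≤ D * δ := by
    have h1 := hstep k₀
    have h2 : ‖N' k₀ - N k₀‖ = d * h k₀ := by rw [hd, div_mul_cancel₀ _ (hh k₀).ne']
    rw [h2] at h1
    have h3 : d * (1 - θ) * h k₀ ≤ m⁻¹ * δ := by linarith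
    have h4 : d * (1 - θ) * (Λ ^ 2 + m ^ 2)⁻¹ ≤ m⁻¹ * δ :=
      (mul_le_mul_of_nonneg_left (weight_ge Λ hm _) (by positivity)).trans h3
    rw [← div_eq_mul_inv, div_le_iff₀ (by positivity)] at h4
    rw [hD, div_mul_eq_mul_div, le_div_iff₀ (by positivity)]
    have h5 := mul_le_mul_of_nonneg_left h4 hm.le
    have h6 : m * (m⁻¹ * δ * (Λ ^ 2 + m ^ 2)) = (Λ ^ 2 + m ^ 2) * δ := by field_simp
    linarith
  have hle : ∀ k, h k ≤ (m ^ 2)⁻¹ := fun k => weight_le Λ hm _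
  have hCε : C * δ = ε := by rw [hδ]; field_simp
  intro k
  have hdh : d * h k ≤ D * δ * (m ^ 2)⁻¹ := mul_le_mul hdD (hle k) (hh k).le (by positivity)
  constructor
  · have : 0 ≤ D * (m ^ 2)⁻¹ * B * δ + δ := by positivity
    have h1 := hdk k
    have h2 : C * δ = D * δ * (m ^ 2)⁻¹ + (D * (m ^ 2)⁻¹ * B * δ + δ) := by rw [hC]; ring
    linarith
  · have h1 : ‖torusField α m L Λ N' k - torusField α m L Λ (fun k => N k) k‖ ≤
        D * δ * (m ^ 2)⁻¹ * B := by
      rw [torusField, torusField, add_sub_add_left_eq_sub, ← Finset.sum_sub_distrib]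
      simp only [← smul_sub]
      calc ‖∑ l, torusKernel α L Λ k l • (N' l - N l)‖
          ≤ ∑ l, torusKernel α L Λ k l * (d * h l) := by
            refine norm_sum_le_of_le _ fun l _ => ?_
            rw [norm_smul, Real.norm_of_nonneg (HT.K_nonneg k l)]
            exact mul_le_mul_of_nonneg_left (hdk l) (HT.K_nonneg k l)
        _ = d * ∑ l, torusKernel α L Λ k l * h l := by
            rw [Finset.mul_sum]
            exact Finset.sum_congr rfl fun l _ => by ring
        _ ≤ d * (θ * ‖X k‖ * h k) := mul_le_mul_of_nonneg_left (hS k) hd0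
        _ = θ * ((d * h k) * ‖X k‖) := by ring
        _ ≤ (d * h k) * ‖X k‖ := mul_le_of_le_one_left
            (mul_nonneg (mul_nonneg hd0 (hh k).le) (norm_nonneg _)) hθ1.le
        _ ≤ D * δ * (m ^ 2)⁻¹ * B := mul_le_mul hdh (norm_diracVec_le_of_mem m k.2.2)
            (norm_nonneg _) (by positivity)
    have h2 := norm_sub_le_norm_sub_add_norm_sub (torusField α m L Λ N' k)
      (torusField α m L Λ (fun k => N k) k) (freeField α m Λ N k)
    have h3 := hfield k
    have h4 : 0 ≤ D * (m ^ 2)⁻¹ * δ := by positivity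
    have h5 : C * δ = D * δ * (m ^ 2)⁻¹ * B + δ + D * (m ^ 2)⁻¹ * δ := by rw [hC]; ring
    linarith

theorem IsFreeSolution.continuous_freeField (hα : 0 ≤ α) (hm : 0 < m) (hΛ : 0 < Λ) {N : E3 → E4}
    (hN : IsFreeSolution α m Λ N) : Continuous (freeField α m Λ N) :=
  (isMeanField_ball hα hm hΛ).continuous_field hN.cone

theorem _root_.Continuous.integrableOn_ball {F : Type*} [NormedAddCommGroup F] {f : E3 → F}
    (hf : Continuous f) (Λ : ℝ) : IntegrableOn f (Metric.ball 0 Λ) :=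
  (hf.continuousOn.integrableOn_compact (isCompact_closedBall 0 Λ)).mono_set
    Metric.ball_subset_closedBall

/-- The continuum counterpart of the torus formula; the sums there are Riemann sums of this
integrand up to the uniform error. -/
theorem IsFreeSolution.energyPerVolume_eq (hα : 0 ≤ α) (hm : 0 < m) (hΛ : 0 < Λ) {N : E3 → E4}
    (hN : IsFreeSolution α m Λ N) : energyPerVolume α m Λ (fun p => spinState (N p)) =
      -(((2 * Real.pi) ^ 3)⁻¹ * ∫ p in Metric.ball (0 : E3) Λ,
        (inner ℝ (N p) (diracVec m p) + inner ℝ (N p) (freeField α m Λ N p))) := by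
  have hNc := hN.cone.cont
  have hYc := hN.continuous_freeField hα hm hΛ
  have hXc := continuous_diracVec m
  have hs : AEStronglyMeasurable (fun p => spinState (N p)) (volume.restrict (Metric.ball 0 Λ)) :=
    (continuous_spinState.comp hNc).aestronglyMeasurable
  have hM : ∀ᵐ p ∂volume.restrict (Metric.ball (0 : E3) Λ), hsNormSq (spinState (N p)) ≤ 1 :=
    ae_of_all _ fun p => by
      rw [hsNormSq_spinState]
      exact pow_le_one₀ (norm_nonneg _) (hN.cone.le_one p)
  set a := α / (4 * Real.pi ^ 2) with ha
  rw [HFVacuum.energyPerVolume_eq hs hM, ← ha, integral_prod _ (integrable_exchange hs hs hM hM)]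
  have h1 : ∀ p, cliffPairing (spinState (N p)) (diracVec m p) = -2 * inner ℝ (N p) (diracVec m p) :=
    fun p => by
      have h2 := trace_spinState_mul (N p) (diracVec m p)
      rw [trace_mul_spinState] at h2
      linarith
  have h3 : ∀ p, a * ∫ q in Metric.ball (0 : E3) Λ,
      (spinState (N p) * spinState (N q)).trace.re * invSq (p - q) =
      inner ℝ (N p) (freeField α m Λ N p) - inner ℝ (N p) (diracVec m p) := fun p => by
    have h4 := (isMeanField_ball (Λ := Λ) hα hm hΛ).smul_int N 1 hNc hN.cone.le_one p
    rw [freeField, IsMeanField.field, inner_add_right, add_sub_cancel_left,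
      ← integral_inner h4, ← integral_const_mul]
    refine integral_congr_ae (ae_of_all _ fun q => ?_)
    simp only [trace_spinState_mul, inner_smul_right]
    ring
  simp only [h1]
  rw [← integral_const_mul a]
  simp only [h3]
  have i1 : IntegrableOn (fun p => inner ℝ (N p) (diracVec m p)) (Metric.ball 0 Λ) :=
    (hNc.inner hXc).integrableOn_ball Λ
  have i2 : IntegrableOn (fun p => inner ℝ (N p) (freeField α m Λ N p)) (Metric.ball 0 Λ) :=
    (hNc.inner hYc).integrableOn_ball Λ
  rw [integral_const_mul, integral_sub i2 i1, integral_add i1 i2]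
  ring

theorem tendsto_torusEnergy (hα : 0 ≤ α) (hα1 : α * Real.pi / 4 < 1) (hm : 0 < m)
    (hΛ : 0 < Λ) {N : E3 → E4} (hN : IsFreeSolution α m Λ N) {N' : (L : ℝ) → momenta L Λ → E4}
    (hN' : ∀ᶠ L in atTop, IsTorusSolution α m L Λ (N' L)) :
    Tendsto (fun L : ℝ => torusEnergy α m L Λ (spinMultiplier (N' L)) / L ^ 3) atTop
      (𝓝 (energyPerVolume α m Λ fun p => spinState (N p))) := by
  have hNc := hN.cone.cont
  have hYc := hN.continuous_freeField hα hm hΛ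
  have hXc := continuous_diracVec m
  set Y := freeField α m Λ N
  set g : E3 → ℝ := fun p => inner ℝ (N p) (diracVec m p) + inner ℝ (N p) (Y p) with hg
  have hgc : Continuous g := (hNc.inner hXc).add (hNc.inner hYc)
  obtain ⟨M, hM⟩ := (isCompact_closedBall (0 : E3) Λ).exists_bound_of_continuousOn hgc.continuousOn
  obtain ⟨CY, hCY⟩ := (isCompact_closedBall (0 : E3) Λ).exists_bound_of_continuousOn hYc.continuousOn
  have hR := tendsto_riemannSum (hgc.continuousOn (s := Metric.ball 0 Λ))
    fun q hq => hM q (Metric.ball_subset_closedBall hq)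
  have hR1 := tendsto_riemannSum (Λ := Λ) (ψ := fun _ => (1 : ℝ)) (M := 1)
    continuousOn_const (by simp)
  set B := √(Λ ^ 2 + m ^ 2)
  rw [hN.energyPerVolume_eq hα hm hΛ]
  set V := ∫ q in Metric.ball (0 : E3) Λ, (1 : ℝ)
  -- The torus energy is minus a sum, so adding the Riemann sum of `g` leaves the average of the
  -- pointwise errors.
  have hlim : Tendsto (fun L : ℝ => ((2 * Real.pi) ^ 3)⁻¹ *
      ((2 * Real.pi / L) ^ 3 • ∑ k : momenta L Λ, g k) + torusEnergy α m L Λ (spinMultiplier (N' L)) /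
        L ^ 3) atTop (𝓝 0) := by
    rw [Metric.tendsto_nhds]
    intro ε hε
    have hB0 : 0 ≤ B := Real.sqrt_nonneg _
    have hV0 : 0 ≤ V := integral_nonneg fun _ => zero_le_one
    set C := ((2 * Real.pi) ^ 3)⁻¹ * (V + 1) * (B + |CY| + 2) with hC
    have hC0 : 0 < C := by positivity
    set η := min 1 (ε / 2 / C) with hη
    have hη0 : 0 < η := lt_min one_pos (by positivity)
    filter_upwards [eventually_torusSolution_close hα hα1 hm hΛ hN hη0, hN', eventually_gt_atTop 0,
      hR1.eventually (eventually_le_nhds (lt_add_one V))] with L hclose hsol hL hcount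
    have hk : ∀ k : momenta L Λ, |g k - (inner ℝ (N' L k) (diracVec m k) +
        inner ℝ (N' L k) (torusField α m L Λ (N' L) k))| ≤ η * (B + |CY| + 2) := by
      intro k
      obtain ⟨h1, h2⟩ := hclose (N' L) hsol k
      set Z := torusField α m L Λ (N' L) k
      have e : g k - (inner ℝ (N' L k) (diracVec m k) + inner ℝ (N' L k) Z) =
          -(inner ℝ (N' L k - N k) (diracVec m k) + inner ℝ (N' L k - N k) Z +
            inner ℝ (N k) (Z - Y k)) := by
        rw [hg]
        simp only [inner_sub_left, inner_sub_right]
        ring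
      have hZ : ‖Z‖ ≤ |CY| + 1 := by
        have h3 := norm_sub_norm_le Z (Y k)
        have h4 := hCY k (Metric.ball_subset_closedBall k.2.2)
        have h5 := le_abs_self CY
        have h6 := min_le_left 1 (ε / 2 / C)
        linarith
      have a1 : |inner ℝ (N' L k - N k) (diracVec m (k : E3))| ≤ η * B :=
        (abs_real_inner_le_norm _ _).trans (mul_le_mul h1 (norm_diracVec_le_of_mem m k.2.2)
          (norm_nonneg _) hη0.le)
      have a2 : |inner ℝ (N' L k - N k) Z| ≤ η * (|CY| + 1) :=
        (abs_real_inner_le_norm _ _).trans (mul_le_mul h1 hZ (norm_nonneg _) hη0.le)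
      have a3 : |inner ℝ (N k) (Z - Y k)| ≤ 1 * η :=
        (abs_real_inner_le_norm _ _).trans (mul_le_mul (hN.cone.le_one _) h2 (norm_nonneg _)
          zero_le_one)
      rw [e, abs_neg]
      refine (abs_add_three _ _ _).trans ?_
      linarith
    rw [torusEnergy_spinMultiplier hL, dist_zero_right]
    have e2 : ((2 * Real.pi) ^ 3)⁻¹ * ((2 * Real.pi / L) ^ 3 • ∑ k : momenta L Λ, g k) +
        -(∑ k : momenta L Λ, (inner ℝ (N' L k) (diracVec m k) +
          inner ℝ (N' L k) (torusField α m L Λ (N' L) k))) / L ^ 3 =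
        (L ^ 3)⁻¹ * ∑ k : momenta L Λ, (g k - (inner ℝ (N' L k) (diracVec m k) +
          inner ℝ (N' L k) (torusField α m L Λ (N' L) k))) := by
      rw [Finset.sum_sub_distrib, smul_eq_mul]
      field_simp
      ring
    rw [e2, norm_mul, Real.norm_of_nonneg (by positivity), Real.norm_eq_abs]
    have e3 : |∑ k : momenta L Λ, (g k - (inner ℝ (N' L k) (diracVec m k) +
          inner ℝ (N' L k) (torusField α m L Λ (N' L) k)))| ≤
        ∑ k : momenta L Λ, 1 * (η * (B + |CY| + 2)) := by
      simp only [one_mul]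
      exact (Finset.abs_sum_le_sum_abs _ _).trans (Finset.sum_le_sum fun k _ => hk k)
    rw [← Finset.sum_mul] at e3
    -- The number of momenta per unit volume stays bounded, by the Riemann sum of the constant one.
    have e4 : (L ^ 3)⁻¹ * ∑ k : momenta L Λ, (1 : ℝ) ≤ ((2 * Real.pi) ^ 3)⁻¹ * (V + 1) := by
      have h1 := mul_le_mul_of_nonneg_left hcount
        (by positivity : 0 ≤ ((2 * Real.pi) ^ 3)⁻¹)
      rw [smul_eq_mul] at h1
      refine le_trans (le_of_eq ?_) h1
      field_simp
    have hηC : η * C ≤ ε / 2 := by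
      have h1 := mul_le_mul_of_nonneg_right (min_le_right 1 (ε / 2 / C)) hC0.le
      rwa [div_mul_cancel₀ _ hC0.ne'] at h1
    calc (L ^ 3)⁻¹ * _ ≤ (L ^ 3)⁻¹ * ((∑ k : momenta L Λ, (1 : ℝ)) * (η * (B + |CY| + 2))) :=
          mul_le_mul_of_nonneg_left e3 (by positivity)
      _ = ((L ^ 3)⁻¹ * ∑ k : momenta L Λ, (1 : ℝ)) * (η * (B + |CY| + 2)) := by ring
      _ ≤ (((2 * Real.pi) ^ 3)⁻¹ * (V + 1)) * (η * (B + |CY| + 2)) :=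
          mul_le_mul_of_nonneg_right e4 (by positivity)
      _ = η * C := by rw [hC]; ring
      _ ≤ ε / 2 := hηC
      _ < ε := half_lt_self hε
  have h := hlim.sub (hR.const_mul ((2 * Real.pi) ^ 3)⁻¹)
  rw [zero_sub] at h
  refine h.congr fun L => ?_
  ring

theorem tendsto_zero_of_eventually_le {f : ℝ → ℝ} (h0 : ∀ x, 0 ≤ f x)
    (h : ∀ ε > 0, ∀ᶠ x in atTop, f x ≤ ε) : Tendsto f atTop (𝓝 0) := by
  rw [Metric.tendsto_nhds]
  intro ε hε
  filter_upwards [h _ (half_pos hε)] with x hx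
  rw [dist_zero_right, Real.norm_of_nonneg (h0 x)]
  linarith

end HFVacuum

end

/-! ### Proof of the thermodynamic limit -/

theorem mainTheorem4 (α Λ m₀ : ℝ) (hα₀ : 0 ≤ α) (hα₁ : α < 4 / Real.pi) (hΛ : 0 < Λ)
    (hm₀ : 0 < m₀) :
    ∃ (fbar : E3 → M4) (γ P : (L : ℝ) → TorusOp L Λ) (f : (L : ℝ) → momenta L Λ → M4),
      -- `fbar` is the symbol of `γ⁰`, and `fbar + 1/2` that of the projector `𝒫⁰₋`
      IsFreeVacuum α m₀ Λ fbar ∧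
      (∀ p ∈ Metric.ball (0 : E3) Λ, IsStarProjection (fbar p + (1 / 2 : ℂ) • (1 : M4))) ∧
      -- for `L` large, `γ L = P L - I/2` is the unique minimizer; it is translation-invariant
      (∀ᶠ L in atTop,
        γ L ∈ torusStates L Λ ∧
        IsMinOn (torusEnergy α m₀ L Λ) (torusStates L Λ) (γ L) ∧
        (∀ γ' ∈ torusStates L Λ,
          IsMinOn (torusEnergy α m₀ L Λ) (torusStates L Λ) γ' → γ' = γ L) ∧
        γ L = P L - (1 / 2 : ℂ) • (1 : TorusOp L Λ) ∧
        IsStarProjection (P L) ∧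
        γ L = fourierMultiplier (f L) ∧
        (∀ x y : E3, kernel (γ L) x y =
          (((2 * Real.pi) ^ (-(3 / 2) : ℝ) : ℝ) : ℂ) • inverseFourier (f L) (x - y))) ∧
      -- the energy per unit volume
      Tendsto (fun L : ℝ => torusGroundEnergy α m₀ L Λ / L ^ 3) atTop
        (𝓝 (freeGroundEnergy α m₀ Λ)) ∧
      IsLeast (energyPerVolume α m₀ Λ '' freeStates Λ) (freeGroundEnergy α m₀ Λ) ∧
      -- convergence of `γ L` to `γ⁰`, in operator norm and uniformly for the symbols
      Tendsto (fun L : ℝ => opNorm (γ L - fourierMultiplier (fun k : momenta L Λ => fbar k)))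
        atTop (𝓝 0) ∧
      Tendsto (fun L : ℝ => ⨆ k : momenta L Λ, opNorm (f L k - fbar k)) atTop (𝓝 0) ∧
      -- convergence of `P L` to `𝒫⁰₋`, in operator norm and uniformly for the symbols
      Tendsto (fun L : ℝ => opNorm (P L - fourierMultiplier
        (fun k : momenta L Λ => fbar k + (1 / 2 : ℂ) • (1 : M4)))) atTop (𝓝 0) ∧
      Tendsto (fun L : ℝ => ⨆ k : momenta L Λ,
        opNorm ((P L).blockDiag k - (fbar k + (1 / 2 : ℂ) • (1 : M4)))) atTop (𝓝 0) := by
  have hα' : α * Real.pi / 4 < 1 := by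
    rw [lt_div_iff₀ Real.pi_pos] at hα₁
    linarith
  -- The gap between `α π / 4` and `θ` absorbs the discretization error in the torus Schur bound.
  obtain ⟨θ, hθ, hθ1⟩ := exists_between hα'
  have hθ0 : 0 ≤ θ := le_trans (by positivity) hθ.le
  obtain ⟨N, hN⟩ := exists_isFreeSolution hα₀ hα' hm₀ hΛ
  have hvac : IsFreeVacuum α m₀ Λ fun p => spinState (N p) :=
    isFreeVacuum_of_solution hα₀ hα₁ hm₀ hΛ hN.cone hN.fixed
  have hground : IsLeast (energyPerVolume α m₀ Λ '' freeStates Λ)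
      (energyPerVolume α m₀ Λ fun p => spinState (N p)) :=
    ⟨⟨_, hvac.mem, rfl⟩, by rintro _ ⟨g, hg, rfl⟩; exact hvac.isMinOn hg⟩
  have hnorm : ∀ p, ‖N p‖ = 1 := fun p => by
    have h : 0 < ‖freeField α m₀ Λ N p‖ := (isMeanField_ball hα₀ hm₀ hΛ).field_pos hN.cone p
    rw [hN.fixed, norm_smul, norm_inv, norm_norm, inv_mul_cancel₀ h.ne']
  have hex : ∀ᶠ L in atTop, ∃ N', IsTorusSolution α m₀ L Λ N' := by
    filter_upwards [eventually_schur hα₀ hm₀ hΛ hθ, eventually_gt_atTop 0] with L hS hL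
    exact exists_isTorusSolution hα₀ hm₀ hL hθ0 hθ1 hS
  obtain ⟨N', hN'⟩ : ∃ N' : (L : ℝ) → momenta L Λ → E4,
      ∀ᶠ L in atTop, IsTorusSolution α m₀ L Λ (N' L) := by
    classical
    -- The default value is irrelevant: solutions exist for all large `L`, and only those enter the
    -- conclusions.
    refine ⟨fun L => if h : ∃ N', IsTorusSolution α m₀ L Λ N' then h.choose else 0, ?_⟩
    filter_upwards [hex] with L h
    rw [dif_pos h]
    exact h.choose_spec
  have hP : ∀ L, spinMultiplier (N' L) + (1 / 2 : ℂ) • (1 : TorusOp L Λ) =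
      fourierMultiplier fun k => spinState (N' L k) + (1 / 2 : ℂ) • (1 : M4) :=
    fun L => spinMultiplier_add_half (N' L)
  obtain ⟨C, hC, hCle⟩ := exists_opNorm_spinState_le
  have hclose : ∀ ε > 0, ∀ᶠ L in atTop, ∀ k : momenta L Λ,
      opNorm (spinState (N' L k) - spinState (N k)) ≤ ε := fun ε hε => by
    filter_upwards [eventually_torusSolution_close hα₀ hα' hm₀ hΛ hN
      (div_pos hε (by linarith : 0 < C + 1)), hN'] with L hL h k
    rw [spinState_sub]
    calc opNorm (spinState (N' L k - N k)) ≤ C * ‖N' L k - N k‖ := hCle _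
      _ ≤ (C + 1) * (ε / (C + 1)) :=
        mul_le_mul (by linarith) (hL _ h k).1 (norm_nonneg _) (by linarith)
      _ = ε := mul_div_cancel₀ _ (by linarith)
  have hop : Tendsto (fun L : ℝ => opNorm (fourierMultiplier fun k : momenta L Λ =>
      spinState (N' L k) - spinState (N k))) atTop (𝓝 0) :=
    tendsto_zero_of_eventually_le (fun _ => opNorm_nonneg _) fun ε hε => by
      filter_upwards [hclose ε hε] with L hL
      exact opNorm_fourierMultiplier_le _ hε.le hL
  have hsup : Tendsto (fun L : ℝ => ⨆ k : momenta L Λ,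
      opNorm (spinState (N' L k) - spinState (N k))) atTop (𝓝 0) :=
    tendsto_zero_of_eventually_le (fun _ => Real.iSup_nonneg fun _ => opNorm_nonneg _)
      fun ε hε => by
        filter_upwards [hclose ε hε] with L hL
        exact Real.iSup_le hL hε.le
  have hsub : ∀ {L : ℝ} (f g : momenta L Λ → M4), fourierMultiplier f - fourierMultiplier g =
      fourierMultiplier fun k => f k - g k := fun f g => (Matrix.blockDiagonal_sub f g).symm
  refine ⟨fun p => spinState (N p), fun L => spinMultiplier (N' L),
    fun L => spinMultiplier (N' L) + (1 / 2 : ℂ) • (1 : TorusOp L Λ),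
    fun L k => spinState (N' L k), hvac, fun p _ => spinState_isStarProjection (hnorm p), ?_, ?_,
    ?_, ?_, hsup, ?_, ?_⟩
  · filter_upwards [eventually_schur hα₀ hm₀ hΛ hθ, eventually_gt_atTop 0, hN'] with L hS hL h
    exact ⟨h.mem_torusStates hα₀ hm₀ hL hθ0 hS, h.isMinOn hα₀ hm₀ hL hθ0 hθ1 hS,
      fun γ hγ hmin => h.unique hα₀ hm₀ hL hθ0 hθ1 hS hγ hmin, (add_sub_cancel_right _ _).symm,
      h.isStarProjection hα₀ hm₀ hL hθ0 hS, rfl, kernel_fourierMultiplier hL _⟩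
  · rw [freeGroundEnergy, hground.csInf_eq]
    refine (tendsto_torusEnergy hα₀ hα' hm₀ hΛ hN hN').congr' ?_
    filter_upwards [eventually_schur hα₀ hm₀ hΛ hθ, eventually_gt_atTop 0, hN'] with L hS hL h
    have hleast : IsLeast (torusEnergy α m₀ L Λ '' torusStates L Λ)
        (torusEnergy α m₀ L Λ (spinMultiplier (N' L))) :=
      ⟨⟨_, h.mem_torusStates hα₀ hm₀ hL hθ0 hS, rfl⟩, by
        rintro _ ⟨γ, hγ, rfl⟩; exact h.isMinOn hα₀ hm₀ hL hθ0 hθ1 hS hγ⟩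
    rw [torusGroundEnergy, hleast.csInf_eq]
  · rw [freeGroundEnergy, hground.csInf_eq]
    exact hground
  · exact hop.congr fun L => congrArg opNorm (hsub _ _).symm
  · refine hop.congr fun L => ?_
    simp only [hP, hsub, add_sub_add_right_eq_sub]
  · refine hsup.congr fun L => ?_
    simp only [hP, fourierMultiplier, Matrix.blockDiag_blockDiagonal, add_sub_add_right_eq_sub]
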